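/- Let $d\ge 1$, $0<\gamma<d$, $n=2^{\lfloor (d+1)/2\rfloor}$, and let $\alpha_1,\dots,\alpha_d,\beta$ be Hermitian $n\times n$ complex matrices with $\beta^2=I_n$, $\alpha_j\beta+\beta\alpha_j=0$ and $\alpha_j\alpha_k+\alpha_k\alpha_j=2\delta_{jk}I_n$ for all $1\le j,k\le d$. Write $\langle z,w\rangle=\sum_{j=1}^n z_j\overline{w_j}$ on $\mathbb{C}^n$. Fix a non-zero Schwartz function $g\in\mathcal S(\mathbb R^d)$. For a tempered distribution $f\in\mathcal S'(\mathbb R^d,\mathbb C^n)$ put $$V_gf(x,\xi)=\int_{\mathbb R^d}e^{-iy\cdot\xi}f(y)\overline{g(y-x)}\,dy$$ (understood as the duality pairing of $f$ with the Schwartz function $y\mapsto e^{-iy\cdot\xi}\overline{g(y-x)}$), and, for $1\le p,q<\infty$ and $s\in\mathbb R$, let $$\|f\|_{M^{p,q}_s}=\Big(\int_{\mathbb R^d}\Big(\int_{\mathbb R^d}|V_gf(x,\xi)|^p\,dx\Big)^{q/p}(1+|\xi|^2)^{sq/2}\,d\xi\Big)^{1/q}\in[0,\infty].$$ Let $M^{p,q}_s$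 be the space of all $f\in\mathcal S'(\mathbb R^d,\mathbb C^n)$ with $\|f\|_{M^{p,q}_s}<\infty$, and write $M^{p,q}=M^{p,q}_0$. Let $X$ be one of the spaces $$X=\begin{cases} M^{p,q} & \text{with } 1\le p\le 2,\ 1\le q\le \frac{2d}{d+\gamma},\\[2pt] M^{p,1}_s & \text{with } 1<p<\frac{d}{d-\gamma},\ s\ge 0.\end{cases}$$ Then there is a constant $C$, depending only on $d,\gamma,p,q,s,\beta,g$, such that for all $\psi_1,\psi_2,\psi_3\in X$ the following holds. The distributions $\psi_1,\psi_2,\psi_3$ are given by locally integrable functions, the convolution integral $|\cdot|^{-\gamma}*\langle\psi_1,\beta\psi_2\rangle$ converges absolutely almost everywhere, the function $(|\cdot|^{-\gamma}*\langle\psi_1,\beta\psi_2\rangle)\,\beta\psi_3$ defines a tempered distribution, and $$\big\|(|\cdot|^{-\gamma}*\langle\psi_1,\beta\psi_2\rangle)\,\beta\psi_3\big\|_X\le C\prod_{j=1}^3\|\psi_j\|_X .$$ -/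

import Mathlib

open MeasureTheory SchwartzMap
open scoped ENNReal NNReal

noncomputable section

/-- The matrices `α₁, …, α_d, β` of the Dirac operator: Hermitian `n × n` matrices satisfying the
usual anticommutation relations. -/
structure IsDiracSystem {d n : ℕ} (α : Fin d → Matrix (Fin n) (Fin n) ℂ)
    (β : Matrix (Fin n) (Fin n) ℂ) : Prop where
  hermitian_alpha : ∀ j, (α j).IsHermitian
  hermitian_beta : β.IsHermitian
  beta_sq : β ^ 2 = 1
  anticomm_beta : ∀ j, α j * β + β * α j = 0
  anticomm_alpha : ∀ j k, α j * α k + α k * α j = if j = k then 2 else 0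

/-- The character `y ↦ exp(-i y·ξ)` on `ℝ^d`. -/
def planeWave {d : ℕ} (ξ y : EuclideanSpace ℝ (Fin d)) : ℂ :=
  Complex.exp (-Complex.I * ((inner ℝ y ξ : ℝ) : ℂ))

theorem planeWave_hasTemperateGrowth {d : ℕ} (ξ : EuclideanSpace ℝ (Fin d)) :
    (planeWave ξ).HasTemperateGrowth := by
  have key : Function.HasTemperateGrowth (fun t : ℝ => Complex.exp (-Complex.I * (t : ℂ))) := by
    have hder : ∀ n : ℕ, iteratedDeriv n (fun t : ℝ => Complex.exp (-Complex.I * (t : ℂ))) =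
        fun t : ℝ => (-Complex.I) ^ n * Complex.exp (-Complex.I * (t : ℂ)) := by
      intro n
      induction n with
      | zero => simp
      | succ n ih =>
        rw [iteratedDeriv_succ, ih]
        funext t
        have h1 : HasDerivAt (fun t : ℝ => -Complex.I * (t : ℂ)) (-Complex.I) t := by
          simpa using (Complex.ofRealCLM.hasDerivAt (x := t)).const_mul (-Complex.I)
        rw [((h1.cexp).const_mul _).deriv]
        ring
    refine ⟨(contDiff_const.mul Complex.ofRealCLM.contDiff).cexp, fun n => ⟨0, 1, fun t => ?_⟩⟩
    rw [norm_iteratedFDeriv_eq_norm_iteratedDeriv, hder n]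
    simp [Complex.norm_exp]
  exact key.comp (Function.hasTemperateGrowth_inner_left ξ)

/-- The time-frequency shifted window `y ↦ exp(-i y·ξ) * conj (g (y - x))`, a Schwartz function. -/
def shiftedWindow {d : ℕ} (g : 𝓢(EuclideanSpace ℝ (Fin d), ℂ))
    (x ξ : EuclideanSpace ℝ (Fin d)) : 𝓢(EuclideanSpace ℝ (Fin d), ℂ) :=
  SchwartzMap.smulLeftCLM ℂ (planeWave ξ)
    (SchwartzMap.compSubConstCLM ℝ x
      (SchwartzMap.postcompCLM (𝕜 := ℝ) (Complex.conjCLE : ℂ →L[ℝ] ℂ) g))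

theorem shiftedWindow_apply {d : ℕ} (g : 𝓢(EuclideanSpace ℝ (Fin d), ℂ))
    (x ξ y : EuclideanSpace ℝ (Fin d)) :
    shiftedWindow g x ξ y =
      Complex.exp (-Complex.I * ((inner ℝ y ξ : ℝ) : ℂ)) * (starRingEnd ℂ) (g (y - x)) := by
  rw [shiftedWindow, SchwartzMap.smulLeftCLM_apply_apply (planeWave_hasTemperateGrowth ξ)]
  rfl

/-- The short-time Fourier transform
`V_g f (x, ξ) = ∫ exp(-i y·ξ) f(y) conj (g (y - x)) dy` of a tempered distribution `f` with values
in `F`, the integral being read as the pairing of `f` with a test function. -/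
def stft {d : ℕ} {F : Type*} [NormedAddCommGroup F] [NormedSpace ℂ F]
    (g : 𝓢(EuclideanSpace ℝ (Fin d), ℂ)) (f : 𝓢'(EuclideanSpace ℝ (Fin d), F))
    (x ξ : EuclideanSpace ℝ (Fin d)) : F :=
  f (shiftedWindow g x ξ)

/-- The norm of the modulation space `M_s^{p,q}(ℝ^d, F)` with window `g`:
the `L^q` norm in `ξ` of `(1 + |ξ|²)^{s/2} ‖V_g f (·, ξ)‖_{L^p}`. It is `∞` exactly when the
tempered distribution `f` does not belong to `M_s^{p,q}`. -/
def modulationNorm {d : ℕ} {F : Type*} [NormedAddCommGroup F] [NormedSpace ℂ F]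
    (g : 𝓢(EuclideanSpace ℝ (Fin d), ℂ)) (p q : ℝ≥0∞) (s : ℝ)
    (f : 𝓢'(EuclideanSpace ℝ (Fin d), F)) : ℝ≥0∞ :=
  eLpNorm (fun ξ : EuclideanSpace ℝ (Fin d) =>
    ENNReal.ofReal ((1 + ‖ξ‖ ^ 2) ^ (s / 2)) * eLpNorm (fun x => stft g f x ξ) p volume) q volume

/-- The tempered distribution `u` is given by integration against the function `f`
(which is then measurable, locally integrable and unique up to null sets). -/
def IsGivenBy {d : ℕ} {F : Type*} [NormedAddCommGroup F] [NormedSpace ℂ F]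
    (u : 𝓢'(EuclideanSpace ℝ (Fin d), F)) (f : EuclideanSpace ℝ (Fin d) → F) : Prop :=
  ∀ φ : 𝓢(EuclideanSpace ℝ (Fin d), ℂ),
    Integrable (fun x => φ x • f x) volume ∧ u φ = ∫ x, φ x • f x

/-- The density `⟨f₁, β f₂⟩`, for `⟨z, w⟩ = ∑ⱼ zⱼ conj wⱼ`
(Mathlib's inner product is conjugate-linear in its first argument, whence the order). -/
def diracDensity {d n : ℕ} (β : Matrix (Fin n) (Fin n) ℂ)
    (f₁ f₂ : EuclideanSpace ℝ (Fin d) → EuclideanSpace ℂ (Fin n))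
    (x : EuclideanSpace ℝ (Fin d)) : ℂ :=
  inner ℂ (Matrix.toEuclideanCLM (𝕜 := ℂ) β (f₂ x)) (f₁ x)

/-- The Coulomb type potential `|x|^{-γ}`. -/
def coulomb (d : ℕ) (γ : ℝ) (x : EuclideanSpace ℝ (Fin d)) : ℝ := ‖x‖ ^ (-γ)

/-- The tempered distribution `w` is the Hartree nonlinearity
`(|·|^{-γ} ∗ ⟨ψ₁, βψ₂⟩) βψ₃`: the `ψⱼ` are functions `fⱼ`, the convolution integral converges
absolutely almost everywhere, and `w` is the function `(|·|^{-γ} ∗ ⟨f₁, βf₂⟩) βf₃`. -/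
def IsHartree {d n : ℕ} (γ : ℝ) (β : Matrix (Fin n) (Fin n) ℂ)
    (ψ₁ ψ₂ ψ₃ w : 𝓢'(EuclideanSpace ℝ (Fin d), EuclideanSpace ℂ (Fin n))) : Prop :=
  ∃ f₁ f₂ f₃ : EuclideanSpace ℝ (Fin d) → EuclideanSpace ℂ (Fin n),
    IsGivenBy ψ₁ f₁ ∧ IsGivenBy ψ₂ f₂ ∧ IsGivenBy ψ₃ f₃ ∧
    (∀ᵐ x ∂volume, ConvolutionExistsAt (coulomb d γ) (diracDensity β f₁ f₂) x
      (ContinuousLinearMap.lsmul ℝ ℝ) volume) ∧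
    IsGivenBy w (fun x =>
      convolution (coulomb d γ) (diracDensity β f₁ f₂) (ContinuousLinearMap.lsmul ℝ ℝ) volume x •
        Matrix.toEuclideanCLM (𝕜 := ℂ) β (f₃ x))

end

/-! The matrix `β` acts boundedly on values, hence on both scales of spaces, so it is enough to
bound `u f₃` with `u = |·|^{-γ} ∗ ⟨f₁, f₂⟩`. The tool is the short-time Fourier transform `V_g`: it
turns products of functions into convolutions in frequency, while convolution operators act on its
space variable.

The basis is the inversion formula `tempered_inversion`, valid for every tempered distribution.
Testing it on a shifted window bounds `V_θ T` by `|V_g T|` convolved with a rapidly decaying weight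
(`exists_stft_le`). This gives independence of the window and the embeddings of `M^{p,q}` into
`M^{r,q₁}` for `p ≤ r`, `q ≤ q₁` (`exists_modulationNorm_le`).

For `p ≤ 2`, `q ≤ 2d/(d+γ)` the space embeds into `M^{2,2} = L²` and into `M^{2,2d/(d+γ)}`. The
Fourier transform of `u` is a multiple of `|ζ|^{-(d-γ)}` times that of the density
(`coulomb_potential_eq`). The latter is at most a correlation of the functions `ξ ↦ ‖V_g
ψⱼ(·,ξ)‖_{L²}`, and the integral of this correlation against `|ζ|^{-(d-γ)}` is a
Hardy-Littlewood-Sobolev form, bounded exactly for the exponent `2d/(d+γ)`. So `u` has an integrable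
Fourier transform, and multiplication by such a function is bounded on every `M^{p,q}`
(`modulationNorm_fourier_smul_le`).

For `M_s^{p,1}` the elements are functions in `L^p ∩ L^∞`. Near the origin the kernel is integrated
against the sup norm, and far away it lies in `L^{p'}` because `p < d/(d-γ)`
(`exists_lintegral_rieszKernel_mul_le`). Applied at each pair of frequencies, this bounds the
windowed transform of `u`, uniformly in `x`, by a correlation in frequency of `sup + L^p` majorants.
That correlation is integrable with the weight, since the weight is submultiplicative up to a
constant. One more convolution estimate handles the factor `f₃` (`modulationNorm_smul_le`). -/

noncomputable section

set_option linter.unusedSectionVars false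

/-! ### Schwartz functions on a product: slices, and functionals that commute with integration over
one variable. -/

/-- A linear functional dominated by the norm of a linear map `J` factors through `J`. -/
theorem exists_clm_comp_eq_of_bound {V B : Type*} [AddCommGroup V] [Module ℂ V]
    [NormedAddCommGroup B] [NormedSpace ℂ B] (J : V →ₗ[ℂ] B) (T : V →ₗ[ℂ] ℂ) (C : ℝ)
    (h : ∀ v, ‖T v‖ ≤ C * ‖J v‖) : ∃ L : B →L[ℂ] ℂ, ∀ v, L (J v) = T v := by
  have hker : LinearMap.ker J ≤ LinearMap.ker T := by
    intro v hv
    rw [LinearMap.mem_ker] at hv ⊢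
    simpa [hv] using h v
  let S : LinearMap.range J →ₗ[ℂ] ℂ :=
    ((LinearMap.ker J).liftQ T hker).comp J.quotKerEquivRange.symm.toLinearMap
  have hS : ∀ v, S ⟨J v, LinearMap.mem_range_self J v⟩ = T v := by
    intro v
    have : J.quotKerEquivRange.symm ⟨J v, LinearMap.mem_range_self J v⟩
        = Submodule.Quotient.mk v := by
      rw [LinearEquiv.symm_apply_eq]; rfl
    simp only [S, LinearMap.comp_apply, LinearEquiv.coe_coe, this]
    exact Submodule.liftQ_apply _ _ _
  let S' : LinearMap.range J →L[ℂ] ℂ := S.mkContinuous C (by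
    rintro ⟨_, v, rfl⟩
    rw [hS]
    exact h v)
  -- Hahn-Banach; the range of `J` need not be closed or dense in `B`.
  obtain ⟨L, hL, -⟩ := exists_extension_norm_eq (LinearMap.range J) S'
  exact ⟨L, fun v => by
    rw [← hS v]; exact hL ⟨J v, LinearMap.mem_range_self J v⟩⟩

section Slice

variable {X E : Type*} [NormedAddCommGroup X] [NormedSpace ℝ X]
  [NormedAddCommGroup E] [NormedSpace ℝ E]

theorem hasTemperateGrowth_prodMk (x : X) :
    (fun y : E => (x, y)).HasTemperateGrowth := by
  have h := (Function.HasTemperateGrowth.const (E := E) ((x, 0) : X × E)).add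
    (ContinuousLinearMap.inr ℝ X E).hasTemperateGrowth
  have e : (fun y : E => (x, y)) = (fun _ => ((x, 0) : X × E)) + ⇑(ContinuousLinearMap.inr ℝ X E) := by
    ext y <;> simp
  rw [e]; exact h

/-- The slice `Ψ(x, ·)` of a Schwartz function on a product. -/
def slice (x : X) : 𝓢(X × E, ℂ) →L[ℂ] 𝓢(E, ℂ) :=
  compCLM ℂ (hasTemperateGrowth_prodMk x) ⟨1, 1, fun y => by
    have : ‖y‖ ≤ ‖((x, y) : X × E)‖ := le_max_right _ _
    simp only [pow_one, one_mul]; linarith⟩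

@[simp] theorem slice_apply (Ψ : 𝓢(X × E, ℂ)) (x : X) (y : E) : slice x Ψ y = Ψ (x, y) := rfl

theorem iteratedFDeriv_slice (Ψ : 𝓢(X × E, ℂ)) (x : X) (l : ℕ) (y : E) :
    iteratedFDeriv ℝ l (slice x Ψ) y = (iteratedFDeriv ℝ l Ψ (x, y)).compContinuousLinearMap
      (fun _ => ContinuousLinearMap.inr ℝ X E) := by
  have e : (slice x Ψ : E → ℂ) =
      (fun z => Ψ ((x, 0) + z)) ∘ ⇑(ContinuousLinearMap.inr ℝ X E) := by
    ext y; simp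
  have hc : ContDiff ℝ l (fun z => Ψ ((x, 0) + z)) := by
    have := Ψ.smooth l
    fun_prop
  rw [e, ContinuousLinearMap.iteratedFDeriv_comp_right _ hc _ le_rfl, iteratedFDeriv_comp_add_left]
  simp

theorem norm_compInr_le {l : ℕ} (A : ContinuousMultilinearMap ℝ (fun _ : Fin l => X × E) ℂ) :
    ‖A.compContinuousLinearMap (fun _ => ContinuousLinearMap.inr ℝ X E)‖ ≤ ‖A‖ := by
  refine (ContinuousMultilinearMap.norm_compContinuousLinearMap_le _ _).trans ?_
  refine mul_le_of_le_one_right (norm_nonneg _) (Finset.prod_le_one (fun _ _ => norm_nonneg _) ?_)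
  intro _ _
  refine ContinuousLinearMap.opNorm_le_bound _ zero_le_one fun y => ?_
  simp

/-- A constant dominating all weighted derivatives of order at most `l`. -/
theorem exists_slice_bound (Ψ : 𝓢(X × E, ℂ)) (k l N : ℕ) : ∃ C, 0 ≤ C ∧ ∀ x y,
    ‖y‖ ^ k * ‖iteratedFDeriv ℝ l (slice x Ψ) y‖ ≤ C * (1 + ‖x‖) ^ (-(N : ℝ)) := by
  refine ⟨2 ^ (k + N) * ((Finset.Iic (k + N, l)).sup fun m => SchwartzMap.seminorm ℝ m.1 m.2) Ψ,
    by positivity, fun x y => ?_⟩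
  -- The single weight of order `k + N` in `(x, y)` pays for `‖y‖ ^ k` and for `(1 + ‖x‖) ^ N`, as
  -- both bases are at most `1 + ‖(x, y)‖`.
  have h := SchwartzMap.one_add_le_sup_seminorm_apply (𝕜 := ℝ) (m := (k + N, l)) (k := k + N)
    (n := l) le_rfl le_rfl Ψ (x, y)
  rw [iteratedFDeriv_slice]
  have hx : 0 < 1 + ‖x‖ := by positivity
  rw [Real.rpow_neg hx.le, Real.rpow_natCast, ← div_eq_mul_inv, le_div_iff₀ (by positivity)]
  refine le_trans ?_ h
  have h1 : ‖y‖ ≤ 1 + ‖((x, y) : X × E)‖ := by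
    have : ‖y‖ ≤ ‖((x, y) : X × E)‖ := le_max_right _ _
    linarith
  have h2 : 1 + ‖x‖ ≤ 1 + ‖((x, y) : X × E)‖ := by
    have : ‖x‖ ≤ ‖((x, y) : X × E)‖ := le_max_left _ _
    linarith
  calc _ ≤ (1 + ‖((x, y) : X × E)‖) ^ k * ‖iteratedFDeriv ℝ l Ψ (x, y)‖ *
        (1 + ‖((x, y) : X × E)‖) ^ N := by
        gcongr
        exact norm_compInr_le _
    _ = _ := by rw [pow_add]; ring

theorem exists_seminorm_slice_le (Ψ : 𝓢(X × E, ℂ)) (k l N : ℕ) : ∃ C, 0 ≤ C ∧ ∀ x,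
    SchwartzMap.seminorm ℂ k l (slice x Ψ) ≤ C * (1 + ‖x‖) ^ (-(N : ℝ)) := by
  obtain ⟨C, hC, h⟩ := exists_slice_bound Ψ k l N
  exact ⟨C, hC, fun x => SchwartzMap.seminorm_le_bound ℂ k l _ (by positivity) (h x)⟩

/-- Mean value inequality in `x`: the derivative in `x` of an `l`-th derivative is part of the full
derivative of order `l + 1`, whose seminorm is therefore a Lipschitz constant. -/
theorem seminorm_slice_sub_le (Ψ : 𝓢(X × E, ℂ)) (k l : ℕ) (x x' : X) :
    SchwartzMap.seminorm ℂ k l (slice x Ψ - slice x' Ψ) ≤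
      SchwartzMap.seminorm ℝ k (l + 1) Ψ * ‖x - x'‖ := by
  refine SchwartzMap.seminorm_le_bound ℂ k l _ (by positivity) fun y => ?_
  have e : iteratedFDeriv ℝ l (slice x Ψ - slice x' Ψ) y =
      (iteratedFDeriv ℝ l Ψ (x, y) - iteratedFDeriv ℝ l Ψ (x', y)).compContinuousLinearMap
      (fun _ => ContinuousLinearMap.inr ℝ X E) := by
    have : ((slice x Ψ - slice x' Ψ : 𝓢(E, ℂ)) : E → ℂ) = ⇑(slice x Ψ) - ⇑(slice x' Ψ) := by
      ext; simp
    rw [this, iteratedFDeriv_sub_apply ((slice x Ψ).smooth l).contDiffAt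
      ((slice x' Ψ).smooth l).contDiffAt, iteratedFDeriv_slice, iteratedFDeriv_slice]
    ext; simp
  rw [e]
  have key : ‖‖y‖ ^ k • iteratedFDeriv ℝ l Ψ (x, y) - ‖y‖ ^ k • iteratedFDeriv ℝ l Ψ (x', y)‖
      ≤ SchwartzMap.seminorm ℝ k (l + 1) Ψ * ‖x - x'‖ := by
    have hd : ∀ z, HasFDerivAt (fun z : X => ‖y‖ ^ k • iteratedFDeriv ℝ l Ψ (z, y))
        (‖y‖ ^ k • (fderiv ℝ (iteratedFDeriv ℝ l Ψ) (z, y)).comp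
          (ContinuousLinearMap.inl ℝ X E)) z := by
      intro z
      have h1 : HasFDerivAt (iteratedFDeriv ℝ l Ψ) (fderiv ℝ (iteratedFDeriv ℝ l Ψ) (z, y))
          (z, y) := by
        refine DifferentiableAt.hasFDerivAt ?_
        have := (Ψ.smooth (l + 1)).differentiable_iteratedFDeriv (m := l)
          (by exact_mod_cast Nat.lt_succ_self l)
        exact this _
      have h2 : HasFDerivAt (fun z : X => (z, y)) (ContinuousLinearMap.inl ℝ X E) z :=
        hasFDerivAt_prodMk_left z y
      have h3 : HasFDerivAt (fun z : X => iteratedFDeriv ℝ l Ψ (z, y)) _ z := h1.comp z h2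
      exact h3.const_smul (‖y‖ ^ k)
    refine Convex.norm_image_sub_le_of_norm_hasFDerivWithin_le (𝕜 := ℝ)
      (fun z _ => (hd z).hasFDerivWithinAt) ?_ convex_univ (Set.mem_univ x') (Set.mem_univ x)
    intro z _
    rw [norm_smul, norm_pow, norm_norm]
    have hle : ‖(fderiv ℝ (iteratedFDeriv ℝ l Ψ) (z, y)).comp (ContinuousLinearMap.inl ℝ X E)‖
        ≤ ‖iteratedFDeriv ℝ (l + 1) Ψ (z, y)‖ := by
      refine (ContinuousLinearMap.opNorm_comp_le _ _).trans ?_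
      rw [norm_fderiv_iteratedFDeriv]
      refine mul_le_of_le_one_right (norm_nonneg _) ?_
      refine ContinuousLinearMap.opNorm_le_bound _ zero_le_one fun y => ?_
      simp
    have hy : ‖y‖ ≤ ‖((z, y) : X × E)‖ := le_max_right _ _
    calc _ ≤ ‖((z, y) : X × E)‖ ^ k * ‖iteratedFDeriv ℝ (l + 1) Ψ (z, y)‖ := by gcongr
      _ ≤ _ := SchwartzMap.le_seminorm ℝ k (l + 1) Ψ (z, y)
  rw [← smul_sub, norm_smul, norm_pow, norm_norm] at key
  refine le_trans ?_ key
  gcongr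
  exact norm_compInr_le _

theorem continuous_slice (Ψ : 𝓢(X × E, ℂ)) : Continuous fun x => slice x Ψ := by
  rw [continuous_iff_continuousAt]
  intro x
  refine ((schwartz_withSeminorms ℂ E ℂ).tendsto_nhds _ _).2 ?_
  rintro ⟨k, l⟩ ε hε
  have hc : Filter.Tendsto (fun x' => SchwartzMap.seminorm ℝ k (l + 1) Ψ * ‖x' - x‖) (nhds x)
      (nhds 0) := by
    have : Continuous (fun x' => SchwartzMap.seminorm ℝ k (l + 1) Ψ * ‖x' - x‖) := by fun_prop
    simpa using this.tendsto x
  filter_upwards [hc.eventually (gt_mem_nhds hε)] with x' hx'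
  exact (seminorm_slice_sub_le Ψ k l x' x).trans_lt hx'

end Slice

section Integral

variable {X E : Type*} [NormedAddCommGroup X] [NormedSpace ℝ X] [FiniteDimensional ℝ X]
  [MeasurableSpace X] [BorelSpace X]
  [NormedAddCommGroup E] [NormedSpace ℝ E]
  (μ : Measure X) [μ.IsAddHaarMeasure]

theorem integrable_of_norm_le_rpow {G : Type*} [NormedAddCommGroup G] {f : X → G}
    (hf : Continuous f) {C : ℝ}
    (h : ∀ x, ‖f x‖ ≤ C * (1 + ‖x‖) ^ (-((Module.finrank ℝ X + 1 : ℕ) : ℝ))) :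
    Integrable f μ :=
  ((integrable_one_add_norm (μ := μ) (r := ((Module.finrank ℝ X + 1 : ℕ) : ℝ))
    (by push_cast; linarith)).const_mul C).mono' hf.aestronglyMeasurable
    (Filter.Eventually.of_forall h)

/-- A functional dominated by finitely many sup norms of linear maps into function spaces commutes
with integrals, as soon as the latter maps do so pointwise. -/
theorem linearMap_integral_of_sup_bound {V Y ι : Type*} [AddCommGroup V] [Module ℂ V]
    [TopologicalSpace Y] [Fintype ι] {G : ι → Type*} [∀ i, NormedAddCommGroup (G i)]
    [∀ i, NormedSpace ℂ (G i)] [∀ i, CompleteSpace (G i)]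
    (D : ∀ i, V →ₗ[ℂ] (Y → G i)) (p : ι → V → ℝ)
    (hcont : ∀ i v, Continuous (D i v)) (hle : ∀ i v y, ‖D i v y‖ ≤ p i v)
    (hleast : ∀ i v M, 0 ≤ M → (∀ y, ‖D i v y‖ ≤ M) → p i v ≤ M)
    (T : V →ₗ[ℂ] ℂ) {C : ℝ}
    (hT : ∀ v M, 0 ≤ M → (∀ i, p i v ≤ M) → ‖T v‖ ≤ C * M)
    (Φ : X → V) (hΦ : ∀ i x, Filter.Tendsto (fun x' => p i (Φ x' - Φ x)) (nhds x) (nhds 0))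
    (K : ι → ℝ)
    (hK : ∀ i x, p i (Φ x) ≤ K i * (1 + ‖x‖) ^ (-((Module.finrank ℝ X + 1 : ℕ) : ℝ)))
    (v : V) (hv : ∀ i y, D i v y = ∫ x, D i (Φ x) y ∂μ) : T v = ∫ x, T (Φ x) ∂μ := by
  have hp : ∀ i v, 0 ≤ max 0 (p i v) := fun _ _ => le_max_left _ _
  -- `V` carries no norm, so the Bochner integral is taken after mapping into a finite product of
  -- Banach spaces of bounded continuous functions. The bound `hT` is what lets `T` factor through
  -- this map.
  let J : V →ₗ[ℂ] (∀ i, BoundedContinuousFunction Y (G i)) := LinearMap.pi fun i =>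
    { toFun := fun v => BoundedContinuousFunction.ofNormedAddCommGroup (D i v) (hcont i v) (p i v)
        (hle i v)
      map_add' := fun v w => by ext1 y; simp
      map_smul' := fun c v => by ext1 y; simp }
  have hJapp : ∀ v i y, J v i y = D i v y := fun _ _ _ => rfl
  have hJle : ∀ v i, ‖J v i‖ ≤ max 0 (p i v) := fun v i =>
    BoundedContinuousFunction.norm_ofNormedAddCommGroup_le _ (hp i v)
      fun y => (hle i v y).trans (le_max_right _ _)
  have hpJ : ∀ v i, p i v ≤ ‖J v i‖ := fun v i =>
    hleast i v _ (norm_nonneg _) fun y => (J v i).norm_coe_le_norm y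
  obtain ⟨L, hL⟩ := exists_clm_comp_eq_of_bound J T C (fun v =>
    hT v _ (norm_nonneg _) fun i => (hpJ v i).trans (norm_le_pi_norm (J v) i))
  have hJcont : Continuous fun x => J (Φ x) := by
    refine continuous_pi fun i => ?_
    rw [continuous_iff_continuousAt]
    intro x
    refine tendsto_iff_norm_sub_tendsto_zero.2 ?_
    have h0 : Filter.Tendsto (fun x' => max 0 (p i (Φ x' - Φ x))) (nhds x) (nhds 0) := by
      simpa using (tendsto_const_nhds (x := (0 : ℝ))).max (hΦ i x)
    refine squeeze_zero (fun _ => norm_nonneg _) (fun x' => ?_) h0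
    rw [← Pi.sub_apply, ← map_sub]
    exact hJle _ i
  have hcompint : ∀ i, Integrable (fun x => J (Φ x) i) μ := by
    intro i
    refine integrable_of_norm_le_rpow μ (C := max 0 (K i)) ((continuous_apply i).comp hJcont)
      fun x => (hJle _ i).trans ?_
    refine max_le (by positivity) ((hK i x).trans ?_)
    gcongr
    exact le_max_right _ _
  have hint : Integrable (fun x => J (Φ x)) μ := Integrable.of_eval hcompint
  -- Point evaluations on each component are continuous and linear, so the identity reduces to the
  -- pointwise hypothesis `hv`.
  have hJ : J v = ∫ x, J (Φ x) ∂μ := by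
    ext1 i
    rw [eval_integral (fun i => hcompint i)]
    ext1 y
    have h1 := (BoundedContinuousFunction.evalCLM (α := Y) (β := G i) ℂ y).integral_comp_comm
      (hcompint i)
    refine Eq.trans ?_ h1
    exact hv i y
  rw [← hL, hJ, ← L.integral_comp_comm hint]
  exact integral_congr_ae (Filter.Eventually.of_forall fun x => hL _)

theorem continuous_iteratedFDeriv_slice (Ψ : 𝓢(X × E, ℂ)) (l : ℕ) (y : E) :
    Continuous fun x => iteratedFDeriv ℝ l (slice x Ψ) y := by
  simp_rw [iteratedFDeriv_slice]
  have h1 : Continuous fun x : X => iteratedFDeriv ℝ l Ψ (x, y) :=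
    ((Ψ.smooth l).continuous_iteratedFDeriv le_rfl).comp (by fun_prop)
  exact (ContinuousMultilinearMap.compContinuousLinearMapL
    (fun _ : Fin l => ContinuousLinearMap.inr ℝ X E)).continuous.comp h1

theorem integrable_iteratedFDeriv_slice (Ψ : 𝓢(X × E, ℂ)) (l : ℕ) (y : E) :
    Integrable (fun x => iteratedFDeriv ℝ l (slice x Ψ) y) μ := by
  obtain ⟨C, _, h⟩ := exists_slice_bound Ψ 0 l (Module.finrank ℝ X + 1)
  exact integrable_of_norm_le_rpow μ (continuous_iteratedFDeriv_slice Ψ l y)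
    (fun x => by simpa using h x y)

theorem linearIsometryEquiv_integral {G H : Type*} [NormedAddCommGroup G] [NormedSpace ℝ G]
    [CompleteSpace G] [NormedAddCommGroup H] [NormedSpace ℝ H] [CompleteSpace H]
    (B : G ≃ₗᵢ[ℝ] H) {f : X → G} (hf : Integrable f μ) : ∫ x, B (f x) ∂μ = B (∫ x, f x ∂μ) :=
  B.toContinuousLinearEquiv.toContinuousLinearMap.integral_comp_comm hf

/-- Differentiation under the integral over the first variable of a Schwartz function. -/
theorem iteratedFDeriv_integral_slice (Ψ : 𝓢(X × E, ℂ)) (l : ℕ) (y : E) :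
    iteratedFDeriv ℝ l (fun y => ∫ x, Ψ (x, y) ∂μ) y =
      ∫ x, iteratedFDeriv ℝ l (slice x Ψ) y ∂μ := by
  induction l generalizing y with
  | zero =>
    have : ∀ x, iteratedFDeriv ℝ 0 (slice x Ψ) y =
        (continuousMultilinearCurryFin0 ℝ E ℂ).symm (Ψ (x, y)) := fun x => by
      rw [iteratedFDeriv_zero_eq_comp]; rfl
    simp_rw [this]
    rw [iteratedFDeriv_zero_eq_comp, Function.comp_apply]
    exact ((continuousMultilinearCurryFin0 ℝ E ℂ).symm.toContinuousLinearEquiv.integral_comp_comm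
      _).symm
  | succ l ih =>
    have hf : ∀ x, iteratedFDeriv ℝ (l + 1) (slice x Ψ) y =
        (continuousMultilinearCurryLeftEquiv ℝ (fun _ : Fin (l + 1) => E) ℂ).symm
          (fderiv ℝ (iteratedFDeriv ℝ l (slice x Ψ)) y) := fun x => by
      rw [iteratedFDeriv_succ_eq_comp_left]; rfl
    simp_rw [hf]
    rw [iteratedFDeriv_succ_eq_comp_left, Function.comp_apply, funext ih]
    obtain ⟨C, _, h⟩ := exists_slice_bound Ψ 0 (l + 1) (Module.finrank ℝ X + 1)
    let B := continuousMultilinearCurryLeftEquiv ℝ (fun _ : Fin (l + 1) => E) ℂ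
    have hB : ∀ x, fderiv ℝ (iteratedFDeriv ℝ l (slice x Ψ)) y =
        B (iteratedFDeriv ℝ (l + 1) (slice x Ψ) y) := fun x => by
      rw [fderiv_iteratedFDeriv]; rfl
    have hbd : ∀ x y, ‖fderiv ℝ (iteratedFDeriv ℝ l (slice x Ψ)) y‖ ≤
        C * (1 + ‖x‖) ^ (-((Module.finrank ℝ X + 1 : ℕ) : ℝ)) := fun x y => by
      rw [norm_fderiv_iteratedFDeriv]
      simpa using h x y
    -- The dominating function does not depend on `y`, and its exponent `finrank + 1` is just enough
    -- for integrability in `x`.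
    have hd : HasFDerivAt (fun y => ∫ x, iteratedFDeriv ℝ l (slice x Ψ) y ∂μ)
        (∫ x, fderiv ℝ (iteratedFDeriv ℝ l (slice x Ψ)) y ∂μ) y := by
      refine hasFDerivAt_integral_of_dominated_of_fderiv_le (𝕜 := ℝ) (s := Set.univ)
        (F' := fun y x => fderiv ℝ (iteratedFDeriv ℝ l (slice x Ψ)) y)
        (bound := fun x => C * (1 + ‖x‖) ^ (-((Module.finrank ℝ X + 1 : ℕ) : ℝ)))
        Filter.univ_mem (Filter.Eventually.of_forall fun y =>
          (continuous_iteratedFDeriv_slice Ψ l y).aestronglyMeasurable)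
        (integrable_iteratedFDeriv_slice μ Ψ l y) (by
          simp_rw [hB]
          exact B.continuous.comp_aestronglyMeasurable
            (integrable_iteratedFDeriv_slice μ Ψ (l + 1) y).aestronglyMeasurable)
        (Filter.Eventually.of_forall fun x y _ => hbd x y) ?_ ?_
      · exact (integrable_one_add_norm (by push_cast; linarith)).const_mul C
      · refine Filter.Eventually.of_forall fun x y _ => ?_
        refine DifferentiableAt.hasFDerivAt ?_
        exact ((slice x Ψ).smooth (l + 1)).differentiable_iteratedFDeriv (m := l)
          (by exact_mod_cast Nat.lt_succ_self l) y
    rw [hd.fderiv]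
    simp_rw [hB]
    change B.symm (∫ x, B _ ∂μ) = ∫ x, B.symm (B _) ∂μ
    have hBint := linearIsometryEquiv_integral
      (G := ContinuousMultilinearMap ℝ (fun _ : Fin (l + 1) => E) ℂ)
      (H := E →L[ℝ] ContinuousMultilinearMap ℝ (fun _ : Fin l => E) ℂ) μ B
      (integrable_iteratedFDeriv_slice μ Ψ (l + 1) y)
    refine (congrArg B.symm hBint).trans ?_
    simp

theorem exists_bound_of_clm {F : Type*} [NormedAddCommGroup F] [NormedSpace ℂ F]
    (T : 𝓢(E, ℂ) →L[ℂ] F) : ∃ (s : Finset (ℕ × ℕ)) (C : ℝ), 0 ≤ C ∧ ∀ φ,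
      ‖T φ‖ ≤ C * (s.sup fun m => SchwartzMap.seminorm ℂ m.1 m.2) φ := by
  obtain ⟨s, C, -, h⟩ := Seminorm.bound_of_continuous (schwartz_withSeminorms ℂ E ℂ)
    ((normSeminorm ℂ F).comp T.toLinearMap) (continuous_norm.comp T.continuous)
  exact ⟨s, C, C.2, fun φ => h φ⟩

theorem integrable_clm_slice {F : Type*} [NormedAddCommGroup F] [NormedSpace ℂ F]
    (T : 𝓢(E, ℂ) →L[ℂ] F) (Ψ : 𝓢(X × E, ℂ)) : Integrable (fun x => T (slice x Ψ)) μ := by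
  obtain ⟨s, C, hC, hT⟩ := exists_bound_of_clm T
  have hs : ∃ D, 0 ≤ D ∧ ∀ x, (s.sup fun m => SchwartzMap.seminorm ℂ m.1 m.2) (slice x Ψ) ≤
      D * (1 + ‖x‖) ^ (-((Module.finrank ℝ X + 1 : ℕ) : ℝ)) := by
    choose D hD h using fun m : ℕ × ℕ =>
      exists_seminorm_slice_le Ψ m.1 m.2 (Module.finrank ℝ X + 1)
    refine ⟨∑ m ∈ s, D m, Finset.sum_nonneg fun m _ => hD m, fun x => ?_⟩
    refine Seminorm.finset_sup_apply_le (by have := Finset.sum_nonneg fun m (_ : m ∈ s) => hD m; positivity) fun m hm => (h m x).trans ?_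
    gcongr
    exact Finset.single_le_sum (fun i _ => hD i) hm
  obtain ⟨D, hD, h⟩ := hs
  refine integrable_of_norm_le_rpow μ (C := C * D) (T.continuous.comp (continuous_slice Ψ)) ?_
  intro x
  refine (hT _).trans ?_
  rw [mul_assoc]
  gcongr
  exact h x

/-- The `l`-th derivative, weighted by `‖y‖ ^ k`. -/
def weightedDeriv (k l : ℕ) :
    𝓢(E, ℂ) →ₗ[ℂ] (E → ContinuousMultilinearMap ℝ (fun _ : Fin l => E) ℂ) where
  toFun φ y := ((‖y‖ ^ k : ℝ) : ℂ) • iteratedFDeriv ℝ l φ y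
  map_add' φ ψ := by
    ext1 y
    have : ((φ + ψ : 𝓢(E, ℂ)) : E → ℂ) = ⇑φ + ⇑ψ := by ext; simp
    simp only [Pi.add_apply]
    rw [this, iteratedFDeriv_add_apply (φ.smooth l).contDiffAt (ψ.smooth l).contDiffAt, smul_add]
  map_smul' c φ := by
    ext1 y
    have : ((c • φ : 𝓢(E, ℂ)) : E → ℂ) = c • ⇑φ := by ext; simp
    simp only [RingHom.id_apply, Pi.smul_apply]
    rw [this, iteratedFDeriv_const_smul_apply (φ.smooth l).contDiffAt, smul_comm]

theorem norm_weightedDeriv (k l : ℕ) (φ : 𝓢(E, ℂ)) (y : E) :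
    ‖weightedDeriv k l φ y‖ = ‖y‖ ^ k * ‖iteratedFDeriv ℝ l φ y‖ := by
  change ‖((‖y‖ ^ k : ℝ) : ℂ) • iteratedFDeriv ℝ l φ y‖ = _
  rw [norm_smul, Complex.norm_real, norm_pow, norm_norm]

theorem clm_integral_slice_complex (T : 𝓢(E, ℂ) →L[ℂ] ℂ) (Ψ : 𝓢(X × E, ℂ)) (φ : 𝓢(E, ℂ))
    (hφ : ∀ y, φ y = ∫ x, Ψ (x, y) ∂μ) : T φ = ∫ x, T (slice x Ψ) ∂μ := by
  obtain ⟨s, C, hC, hT⟩ := exists_bound_of_clm T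
  choose K hK0 hK using fun m : s =>
    exists_seminorm_slice_le Ψ m.1.1 m.1.2 (Module.finrank ℝ X + 1)
  refine linearMap_integral_of_sup_bound μ (ι := s)
    (G := fun m => ContinuousMultilinearMap ℝ (fun _ : Fin m.1.2 => E) ℂ)
    (fun m => weightedDeriv m.1.1 m.1.2) (fun m => SchwartzMap.seminorm ℂ m.1.1 m.1.2)
    (fun m φ => ?_) (fun m φ y => ?_) (fun m φ M hM h => ?_) T.toLinearMap
    (C := C) (fun φ M hM h => ?_) (fun x => slice x Ψ) (fun m x => ?_) K hK φ (fun m y => ?_)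
  · exact (Complex.continuous_ofReal.comp (continuous_norm.pow _)).smul
      ((φ.smooth m.1.2).continuous_iteratedFDeriv le_rfl)
  · rw [norm_weightedDeriv]
    exact SchwartzMap.le_seminorm ℂ _ _ φ y
  · refine SchwartzMap.seminorm_le_bound ℂ _ _ φ hM fun y => ?_
    rw [← norm_weightedDeriv]
    exact h y
  · refine (hT φ).trans ?_
    gcongr
    exact Seminorm.finset_sup_apply_le hM fun m hm => h ⟨m, hm⟩
  · have hc : Filter.Tendsto (fun x' => SchwartzMap.seminorm ℝ m.1.1 (m.1.2 + 1) Ψ * ‖x' - x‖)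
        (nhds x) (nhds 0) := by
      have : Continuous (fun x' => SchwartzMap.seminorm ℝ m.1.1 (m.1.2 + 1) Ψ * ‖x' - x‖) := by
        fun_prop
      simpa using this.tendsto x
    exact squeeze_zero (fun _ => apply_nonneg _ _)
      (fun x' => seminorm_slice_sub_le Ψ m.1.1 m.1.2 x' x) hc
  · change ((‖y‖ ^ m.1.1 : ℝ) : ℂ) • iteratedFDeriv ℝ m.1.2 φ y = ∫ x,
      ((‖y‖ ^ m.1.1 : ℝ) : ℂ) • iteratedFDeriv ℝ m.1.2 (slice x Ψ) y ∂μ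
    rw [integral_smul, ← iteratedFDeriv_integral_slice]
    congr 2
    exact funext hφ

/-- A continuous linear map on Schwartz space commutes with integration over the first variable of
a Schwartz function on a product. -/
theorem clm_integral_slice {F : Type*} [NormedAddCommGroup F] [NormedSpace ℂ F] [CompleteSpace F]
    (T : 𝓢(E, ℂ) →L[ℂ] F) (Ψ : 𝓢(X × E, ℂ)) (φ : 𝓢(E, ℂ))
    (hφ : ∀ y, φ y = ∫ x, Ψ (x, y) ∂μ) : T φ = ∫ x, T (slice x Ψ) ∂μ := by
  -- Continuous functionals separate the points of `F`, which leaves the scalar case.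
  rw [SeparatingDual.eq_iff_forall_dual_eq (R := ℂ)]
  intro g
  rw [← g.integral_comp_comm (integrable_clm_slice μ T Ψ)]
  exact clm_integral_slice_complex μ (g.comp T) Ψ φ hφ

end Integral
end

noncomputable section

set_option linter.unusedSectionVars false

/-! ### Tensor products and the shear that produces translated windows. -/

section Tensor

variable {X E : Type*} [NormedAddCommGroup X] [NormedSpace ℝ X]
  [NormedAddCommGroup E] [NormedSpace ℝ E]

theorem norm_iteratedFDeriv_comp_fst_le (φ : 𝓢(X, ℂ)) (n : ℕ) (z : X × E) :
    ‖iteratedFDeriv ℝ n (fun z : X × E => φ z.1) z‖ ≤ ‖iteratedFDeriv ℝ n φ z.1‖ := by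
  have e : (fun z : X × E => φ z.1) = φ ∘ ⇑(ContinuousLinearMap.fst ℝ X E) := rfl
  rw [e, ContinuousLinearMap.iteratedFDeriv_comp_right _ (φ.smooth n) _ le_rfl]
  refine (ContinuousMultilinearMap.norm_compContinuousLinearMap_le _ _).trans ?_
  exact mul_le_of_le_one_right (norm_nonneg _) (Finset.prod_le_one (fun _ _ => norm_nonneg _)
    fun _ _ => ContinuousLinearMap.norm_fst_le ℝ X E)

theorem norm_iteratedFDeriv_comp_snd_le (φ : 𝓢(E, ℂ)) (n : ℕ) (z : X × E) :
    ‖iteratedFDeriv ℝ n (fun z : X × E => φ z.2) z‖ ≤ ‖iteratedFDeriv ℝ n φ z.2‖ := by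
  have e : (fun z : X × E => φ z.2) = φ ∘ ⇑(ContinuousLinearMap.snd ℝ X E) := rfl
  rw [e, ContinuousLinearMap.iteratedFDeriv_comp_right _ (φ.smooth n) _ le_rfl]
  refine (ContinuousMultilinearMap.norm_compContinuousLinearMap_le _ _).trans ?_
  exact mul_le_of_le_one_right (norm_nonneg _) (Finset.prod_le_one (fun _ _ => norm_nonneg _)
    fun _ _ => ContinuousLinearMap.norm_snd_le ℝ X E)

/-- The tensor product of two Schwartz functions. -/
def schwartzTensor (φ : 𝓢(X, ℂ)) (ψ : 𝓢(E, ℂ)) : 𝓢(X × E, ℂ) where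
  toFun z := φ z.1 * ψ z.2
  smooth' := (φ.smooth ⊤).fst'.mul (ψ.smooth ⊤).snd'
  decay' := by
    intro k n
    refine ⟨∑ i ∈ Finset.range (n + 1), (n.choose i : ℝ) *
      (SchwartzMap.seminorm ℝ k i φ * SchwartzMap.seminorm ℝ 0 (n - i) ψ +
        SchwartzMap.seminorm ℝ 0 i φ * SchwartzMap.seminorm ℝ k (n - i) ψ), fun z => ?_⟩
    have h := norm_iteratedFDeriv_mul_le (𝕜 := ℝ) (N := n) (n := n)
      (f := fun z : X × E => φ z.1) (g := fun z : X × E => ψ z.2)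
      (φ.smooth n).fst' (ψ.smooth n).snd' z le_rfl
    have hz : ‖z‖ ^ k ≤ ‖z.1‖ ^ k + ‖z.2‖ ^ k := by
      rw [Prod.norm_def]
      rcases max_cases ‖z.1‖ ‖z.2‖ with ⟨h, -⟩ | ⟨h, -⟩ <;> rw [h]
      · exact le_add_of_nonneg_right (by positivity)
      · exact le_add_of_nonneg_left (by positivity)
    refine (mul_le_mul_of_nonneg_left h (by positivity)).trans ?_
    rw [Finset.mul_sum]
    refine Finset.sum_le_sum fun i _ => ?_
    have h1 := norm_iteratedFDeriv_comp_fst_le (E := E) φ i z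
    have h2 := norm_iteratedFDeriv_comp_snd_le (X := X) ψ (n - i) z
    have a1 := SchwartzMap.le_seminorm ℝ k i φ z.1
    have a2 := SchwartzMap.norm_iteratedFDeriv_le_seminorm ℝ φ i z.1
    have b1 := SchwartzMap.le_seminorm ℝ k (n - i) ψ z.2
    have b2 := SchwartzMap.norm_iteratedFDeriv_le_seminorm ℝ ψ (n - i) z.2
    calc _ ≤ (‖z.1‖ ^ k + ‖z.2‖ ^ k) * ((n.choose i : ℝ) * ‖iteratedFDeriv ℝ i φ z.1‖ *
          ‖iteratedFDeriv ℝ (n - i) ψ z.2‖) := by gcongr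
      _ = (n.choose i : ℝ) * ((‖z.1‖ ^ k * ‖iteratedFDeriv ℝ i φ z.1‖) *
          ‖iteratedFDeriv ℝ (n - i) ψ z.2‖ + ‖iteratedFDeriv ℝ i φ z.1‖ *
          (‖z.2‖ ^ k * ‖iteratedFDeriv ℝ (n - i) ψ z.2‖)) := by ring
      _ ≤ _ := by gcongr

@[simp] theorem schwartzTensor_apply (φ : 𝓢(X, ℂ)) (ψ : 𝓢(E, ℂ)) (z : X × E) :
    schwartzTensor φ ψ z = φ z.1 * ψ z.2 := rfl

/-- The shear `(x, y) ↦ (y - x, y)`. -/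
def shear : (E × E) ≃L[ℝ] (E × E) where
  toFun z := (z.2 - z.1, z.2)
  invFun z := (z.2 - z.1, z.2)
  map_add' a b := by ext <;> simp; abel
  map_smul' c a := by ext <;> simp [smul_sub]
  left_inv a := by ext <;> simp
  right_inv a := by ext <;> simp
  continuous_toFun := by fun_prop
  continuous_invFun := by fun_prop

/-- `(x, y) ↦ φ (y - x) * ψ y`. -/
def shearTensor (φ ψ : 𝓢(E, ℂ)) : 𝓢(E × E, ℂ) :=
  compCLMOfContinuousLinearEquiv ℂ shear (schwartzTensor φ ψ)

@[simp] theorem shearTensor_apply (φ ψ : 𝓢(E, ℂ)) (x y : E) :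
    shearTensor φ ψ (x, y) = φ (y - x) * ψ y := rfl

/-- Decay in `x` survives any continuous operation on the slice. With a Schwartz seminorm composed
with the Fourier transform, it yields simultaneous decay in `x` and in frequency. -/
theorem exists_seminorm_slice_le_of_continuous (q : Seminorm ℂ 𝓢(E, ℂ)) (hq : Continuous q)
    (Ψ : 𝓢(X × E, ℂ)) (N : ℕ) :
    ∃ C, 0 ≤ C ∧ ∀ x, q (slice x Ψ) ≤ C * (1 + ‖x‖) ^ (-(N : ℝ)) := by
  obtain ⟨s, C, -, h⟩ := Seminorm.bound_of_continuous (schwartz_withSeminorms ℂ E ℂ) q hq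
  choose D hD hs using fun m : ℕ × ℕ => exists_seminorm_slice_le Ψ m.1 m.2 N
  have hD' : 0 ≤ ∑ m ∈ s, D m := Finset.sum_nonneg fun m _ => hD m
  refine ⟨C * ∑ m ∈ s, D m, by positivity, fun x => (h _).trans ?_⟩
  rw [mul_assoc]
  refine mul_le_mul_of_nonneg_left ?_ C.2
  refine Seminorm.finset_sup_apply_le (by positivity) fun m hm => (hs m x).trans ?_
  gcongr
  exact Finset.single_le_sum (fun i _ => hD i) hm

end Tensor

/-- Complex conjugation on Schwartz functions. -/
def schwartzConj {E : Type*} [NormedAddCommGroup E] [NormedSpace ℝ E] (g : 𝓢(E, ℂ)) : 𝓢(E, ℂ) :=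
  SchwartzMap.postcompCLM (𝕜 := ℝ) (Complex.conjCLE : ℂ →L[ℝ] ℂ) g

@[simp] theorem schwartzConj_apply {E : Type*} [NormedAddCommGroup E] [NormedSpace ℝ E]
    (g : 𝓢(E, ℂ)) (y : E) : schwartzConj g y = (starRingEnd ℂ) (g y) := rfl

/-- The product of two Schwartz functions. -/
def schwartzMul {E : Type*} [NormedAddCommGroup E] [NormedSpace ℝ E] (g h : 𝓢(E, ℂ)) : 𝓢(E, ℂ) :=
  SchwartzMap.smulLeftCLM ℂ g h

@[simp] theorem schwartzMul_apply {E : Type*} [NormedAddCommGroup E] [NormedSpace ℝ E]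
    (g h : 𝓢(E, ℂ)) (y : E) : schwartzMul g h y = g y * h y :=
  SchwartzMap.smulLeftCLM_apply_apply g.hasTemperateGrowth h y

/-! ### Plane waves and Fourier inversion without normalization. -/

/-- The Euclidean space `ℝ^d`. -/
abbrev Rn (d : ℕ) := EuclideanSpace ℝ (Fin d)

variable {d : ℕ}

/-- Restriction of the plane wave of unit frequency on `ℝ¹` to the line `t ↦ t e₀`. -/
theorem hasTemperateGrowth_exp_neg_I :
    (fun t : ℝ => Complex.exp (-Complex.I * (t : ℂ))).HasTemperateGrowth := by
  have h : (fun t : ℝ => t • (EuclideanSpace.single 0 1 : Rn 1)).HasTemperateGrowth :=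
    ((ContinuousLinearMap.id ℝ ℝ).smulRight
      (EuclideanSpace.single 0 1 : Rn 1)).hasTemperateGrowth
  have := (planeWave_hasTemperateGrowth (EuclideanSpace.single 0 1 : Rn 1)).comp h
  convert this using 1
  funext t
  simp [planeWave, inner_smul_left]

/-- The phase is a quadratic expression in `z`, so the growth of `exp(-it)` along a bilinear form is
what counts. This makes `(ξ, y) ↦ exp(-i y·ξ)` an admissible multiplier for Schwartz functions of
both variables jointly. -/
theorem hasTemperateGrowth_planeWave_comp {D : Type*} [NormedAddCommGroup D] [NormedSpace ℝ D]
    (a b : D →L[ℝ] Rn d) : (fun z => planeWave (a z) (b z)).HasTemperateGrowth := by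
  have h : (fun z => innerSL ℝ (b z) (a z)).HasTemperateGrowth :=
    ContinuousLinearMap.bilinear_hasTemperateGrowth (𝕜 := ℝ) (innerSL ℝ) b.hasTemperateGrowth
      a.hasTemperateGrowth
  have h2 := hasTemperateGrowth_exp_neg_I.comp h
  have e : (fun z => planeWave (a z) (b z)) = (fun t : ℝ => Complex.exp (-Complex.I * (t : ℂ))) ∘
      (fun z => innerSL ℝ (b z) (a z)) := by
    funext z; simp only [Function.comp_apply, planeWave, innerSL_apply_apply]
  rw [e]; exact h2

theorem norm_planeWave (ξ y : Rn d) : ‖planeWave ξ y‖ = 1 := by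
  simp [planeWave, Complex.norm_exp]

theorem continuous_planeWave : Continuous fun z : Rn d × Rn d => planeWave z.1 z.2 := by
  unfold planeWave
  fun_prop

theorem planeWave_add (ξ η y : Rn d) : planeWave (ξ + η) y = planeWave ξ y * planeWave η y := by
  simp [planeWave, inner_add_right, mul_add, Complex.exp_add]

theorem planeWave_add_right (ξ y z : Rn d) :
    planeWave ξ (y + z) = planeWave ξ y * planeWave ξ z := by
  simp [planeWave, inner_add_left, mul_add, Complex.exp_add]

theorem planeWave_neg (ξ y : Rn d) : planeWave (-ξ) y = (starRingEnd ℂ) (planeWave ξ y) := by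
  simp [planeWave, ← Complex.exp_conj]

theorem planeWave_zero (y : Rn d) : planeWave 0 y = 1 := by simp [planeWave]

/-- The inverse Fourier transform without normalization: `ξ ↦ ∫ exp(i y·ξ) φ(y) dy`. -/
def waveTransform : 𝓢(Rn d, ℂ) →L[ℂ] 𝓢(Rn d, ℂ) :=
  (compCLMOfContinuousLinearEquiv ℂ (ContinuousLinearEquiv.smulLeft
    (Units.mk0 (2 * Real.pi)⁻¹ (by positivity) : ℝˣ) : Rn d ≃L[ℝ] Rn d)).comp
    (FourierTransform.fourierInvCLM ℂ 𝓢(Rn d, ℂ))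

theorem waveTransform_apply_eq (φ : 𝓢(Rn d, ℂ)) (ξ : Rn d) :
    waveTransform φ ξ = FourierTransformInv.fourierInv φ ((2 * Real.pi)⁻¹ • ξ) := rfl

theorem waveTransform_apply (φ : 𝓢(Rn d, ℂ)) (ξ : Rn d) :
    waveTransform φ ξ = ∫ y, planeWave (-ξ) y * φ y := by
  rw [waveTransform_apply_eq, SchwartzMap.fourierInv_coe, Real.fourierInv_eq']
  refine integral_congr_ae (Filter.Eventually.of_forall fun y => ?_)
  simp only [planeWave, smul_eq_mul]
  congr 2
  rw [inner_neg_right, inner_smul_right]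
  push_cast
  field_simp

/-- The inversion theorem for the transform with `2π` in the exponent; `(2π)^d` is the Jacobian of
the dilation `ξ ↦ 2πξ`. -/
theorem integral_planeWave_mul_waveTransform (φ : 𝓢(Rn d, ℂ)) (y : Rn d) :
    ∫ ξ, planeWave ξ y * waveTransform φ ξ = (2 * Real.pi) ^ d * φ y := by
  have h1 := Measure.integral_comp_smul (volume : Measure (Rn d))
    (fun ξ => planeWave ξ y * waveTransform φ ξ) (2 * Real.pi)
  have h2 : ∫ ξ : Rn d, planeWave ((2 * Real.pi) • ξ) y * waveTransform φ ((2 * Real.pi) • ξ) =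
      φ y := by
    have h3 : φ y = FourierTransform.fourier (FourierTransformInv.fourierInv φ) y := by
      rw [FourierTransform.fourier_fourierInv_eq]
    rw [h3, SchwartzMap.fourier_coe, Real.fourier_eq']
    refine integral_congr_ae (Filter.Eventually.of_forall fun ξ => ?_)
    simp only [waveTransform_apply_eq, smul_smul, smul_eq_mul]
    rw [inv_mul_cancel₀ (by positivity), one_smul]
    congr 1
    simp only [planeWave]
    congr 1
    rw [inner_smul_right, real_inner_comm]
    push_cast
    ring
  rw [h2, finrank_euclideanSpace_fin, abs_of_pos (by positivity)] at h1
  rw [h1, Complex.real_smul]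
  push_cast
  field_simp

end

noncomputable section

set_option linter.unusedSectionVars false

/-! ### Inversion formula, change of window and continuity for the short-time Fourier transform. -/

variable {d : ℕ} {F : Type*} [NormedAddCommGroup F] [NormedSpace ℂ F]

/-- Translation `φ(· - x)` on Schwartz functions. -/
def schwartzTranslate (x : Rn d) (φ : 𝓢(Rn d, ℂ)) : 𝓢(Rn d, ℂ) := compSubConstCLM ℝ x φ

@[simp] theorem schwartzTranslate_apply (x : Rn d) (φ : 𝓢(Rn d, ℂ)) (y : Rn d) :
    schwartzTranslate x φ y = φ (y - x) := rfl

/-- Modulation `y ↦ exp(-i y·ξ) φ y` on Schwartz functions. -/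
def schwartzModulate (ξ : Rn d) (φ : 𝓢(Rn d, ℂ)) : 𝓢(Rn d, ℂ) :=
  smulLeftCLM ℂ (planeWave ξ) φ

@[simp] theorem schwartzModulate_apply (ξ : Rn d) (φ : 𝓢(Rn d, ℂ)) (y : Rn d) :
    schwartzModulate ξ φ y = planeWave ξ y * φ y :=
  smulLeftCLM_apply_apply (planeWave_hasTemperateGrowth ξ) φ y

theorem shiftedWindow_apply' (g : 𝓢(Rn d, ℂ)) (x ξ y : Rn d) :
    shiftedWindow g x ξ y = planeWave ξ y * (starRingEnd ℂ) (g (y - x)) :=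
  shiftedWindow_apply g x ξ y

/-- Fourier inversion inside a tempered distribution. -/
theorem tempered_schwartzMul [CompleteSpace F] (T : 𝓢'(Rn d, F)) (G φ : 𝓢(Rn d, ℂ)) :
    Integrable (fun ξ => waveTransform φ ξ • T (schwartzModulate ξ G)) ∧
    ((2 * Real.pi : ℂ) ^ d) • T (schwartzMul G φ) =
      ∫ ξ, waveTransform φ ξ • T (schwartzModulate ξ G) := by
  -- The slices of `Ψ` are multiples of modulations of `G`, and integrating `Ψ` over the frequency
  -- gives `(2π)^d G φ`. Applying `T` under that integral is the claim.
  let Ψ : 𝓢(Rn d × Rn d, ℂ) := smulLeftCLM ℂ (fun z : Rn d × Rn d => planeWave z.1 z.2)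
    (schwartzTensor (waveTransform φ) G)
  have hgrow := hasTemperateGrowth_planeWave_comp (ContinuousLinearMap.fst ℝ (Rn d) (Rn d))
    (ContinuousLinearMap.snd ℝ (Rn d) (Rn d))
  have hΨ : ∀ ξ y, Ψ (ξ, y) = planeWave ξ y * (waveTransform φ ξ * G y) := fun ξ y =>
    smulLeftCLM_apply_apply hgrow _ _
  have hs : ∀ ξ, slice ξ Ψ = waveTransform φ ξ • schwartzModulate ξ G := by
    intro ξ
    ext y
    rw [slice_apply, hΨ, smul_apply, schwartzModulate_apply, smul_eq_mul]
    ring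
  have hT : ∀ ξ, T (slice ξ Ψ) = waveTransform φ ξ • T (schwartzModulate ξ G) := fun ξ => by
    rw [hs, map_smul]
  have h1 := integrable_clm_slice volume (T : 𝓢(Rn d, ℂ) →L[ℂ] F) Ψ
  have h2 := clm_integral_slice volume (T : 𝓢(Rn d, ℂ) →L[ℂ] F) Ψ
    (((2 * Real.pi : ℂ) ^ d) • schwartzMul G φ) (fun y => by
      rw [smul_apply, schwartzMul_apply, smul_eq_mul]
      have : ∀ ξ, Ψ (ξ, y) = G y * (planeWave ξ y * waveTransform φ ξ) := fun ξ => by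
        rw [hΨ]; ring
      simp_rw [this]
      rw [integral_const_mul, integral_planeWave_mul_waveTransform]
      ring)
  refine ⟨?_, ?_⟩
  · exact h1.congr (Filter.Eventually.of_forall fun ξ => hT ξ)
  · rw [← map_smul]
    refine h2.trans (integral_congr_ae (Filter.Eventually.of_forall fun ξ => hT ξ))

/-- `W_φ(x, ·)`, where `W_φ(x, ξ) = ∫ exp(i y·ξ) g(y - x) φ(y) dy`. -/
def dualStft (g φ : 𝓢(Rn d, ℂ)) (x : Rn d) : 𝓢(Rn d, ℂ) :=
  waveTransform (schwartzMul (schwartzTranslate x g) φ)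

theorem dualStft_apply (g φ : 𝓢(Rn d, ℂ)) (x ξ : Rn d) :
    dualStft g φ x ξ = ∫ y, planeWave (-ξ) y * (g (y - x) * φ y) := by
  rw [dualStft, waveTransform_apply]
  simp

/-- Fourier inversion under `T` for the product of the conjugated window at `x` with `g(· - x) φ`;
thus `T` is tested on `|g(· - x)|² φ`. -/
theorem tempered_windowed [CompleteSpace F] (T : 𝓢'(Rn d, F)) (g φ : 𝓢(Rn d, ℂ)) (x : Rn d) :
    Integrable (fun ξ => dualStft g φ x ξ • stft g T x ξ) ∧
    ((2 * Real.pi : ℂ) ^ d) • T (schwartzMul (schwartzTranslate x (schwartzConj g))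
      (schwartzMul (schwartzTranslate x g) φ)) = ∫ ξ, dualStft g φ x ξ • stft g T x ξ :=
  tempered_schwartzMul T (schwartzTranslate x (schwartzConj g))
    (schwartzMul (schwartzTranslate x g) φ)

/-- The functions `|g(· - x)|²` form a continuous partition of unity: for each `y` they integrate in
`x` to `‖g‖²_{L²}`. -/
theorem tempered_partition [CompleteSpace F] (T : 𝓢'(Rn d, F)) (g φ : 𝓢(Rn d, ℂ)) :
    Integrable (fun x => T (schwartzMul (schwartzTranslate x (schwartzConj g))
      (schwartzMul (schwartzTranslate x g) φ))) ∧
    ((∫ y, ‖g y‖ ^ 2 : ℝ) : ℂ) • T φ = ∫ x, T (schwartzMul (schwartzTranslate x (schwartzConj g))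
      (schwartzMul (schwartzTranslate x g) φ)) := by
  let Ψ : 𝓢(Rn d × Rn d, ℂ) := shearTensor (schwartzMul (schwartzConj g) g) φ
  have hs : ∀ x, slice x Ψ = schwartzMul (schwartzTranslate x (schwartzConj g))
      (schwartzMul (schwartzTranslate x g) φ) := by
    intro x; ext y
    simp only [slice_apply, Ψ, shearTensor_apply, schwartzMul_apply, schwartzTranslate_apply]
    ring
  have h1 := integrable_clm_slice volume (T : 𝓢(Rn d, ℂ) →L[ℂ] F) Ψ
  have h2 := clm_integral_slice volume (T : 𝓢(Rn d, ℂ) →L[ℂ] F) Ψ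
    (((∫ y, ‖g y‖ ^ 2 : ℝ) : ℂ) • φ) (fun y => by
      simp only [smul_apply, Ψ, shearTensor_apply, schwartzMul_apply,
        schwartzConj_apply, smul_eq_mul]
      rw [integral_mul_const, integral_sub_left_eq_self (fun z => (starRingEnd ℂ) (g z) * g z),
        ← integral_complex_ofReal]
      congr 1
      refine integral_congr_ae (Filter.Eventually.of_forall fun z => ?_)
      simp [Complex.conj_mul'])
  simp_rw [hs] at h1 h2
  exact ⟨h1, by rw [← map_smul]; exact h2⟩

/-- Inversion formula for the short-time Fourier transform of a tempered distribution. -/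
theorem tempered_inversion [CompleteSpace F] (T : 𝓢'(Rn d, F)) (g φ : 𝓢(Rn d, ℂ)) :
    ((2 * Real.pi : ℂ) ^ d * ((∫ y, ‖g y‖ ^ 2 : ℝ) : ℂ)) • T φ =
      ∫ x, ∫ ξ, dualStft g φ x ξ • stft g T x ξ := by
  rw [mul_smul, (tempered_partition T g φ).2, ← integral_smul]
  exact integral_congr_ae (Filter.Eventually.of_forall fun x => (tempered_windowed T g φ x).2)

theorem integral_norm_sq_pos {g : 𝓢(Rn d, ℂ)} (hg : g ≠ 0) : 0 < ∫ y, ‖g y‖ ^ 2 := by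
  obtain ⟨y, hy⟩ : ∃ y, g y ≠ 0 := by
    by_contra! h
    exact hg (SchwartzMap.ext h)
  have hc : Continuous fun y => ‖g y‖ ^ 2 := by fun_prop
  refine integral_pos_of_integrable_nonneg_nonzero (x := y) hc ?_ (fun y => by positivity)
    (by simpa using hy)
  exact (g.memLp 2).integrable_norm_pow (by norm_num)

/-- The decay of the short-time Fourier transform of Schwartz functions. -/
theorem exists_dualStft_decay (g φ : 𝓢(Rn d, ℂ)) (N : ℕ) : ∃ C, 0 ≤ C ∧ ∀ x ξ,
    ‖dualStft g φ x ξ‖ ≤ C * ((1 + ‖x‖) ^ (-(N : ℝ)) * (1 + ‖ξ‖) ^ (-(N : ℝ))) := by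
  let q : Seminorm ℂ 𝓢(Rn d, ℂ) :=
    ((Finset.Iic (N, 0)).sup fun m => SchwartzMap.seminorm ℂ m.1 m.2).comp
      (waveTransform (d := d)).toLinearMap
  have hq : Continuous q := by
    have h1 : Continuous ((Finset.Iic (N, 0)).sup (fun m : ℕ × ℕ =>
        SchwartzMap.seminorm ℂ m.1 m.2) : Seminorm ℂ 𝓢(Rn d, ℂ)) :=
      Seminorm.continuous_finsetSup fun m _ =>
        (schwartz_withSeminorms ℂ (Rn d) ℂ).continuous_seminorm m
    exact h1.comp (waveTransform (d := d)).continuous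
  obtain ⟨C, hC, h⟩ := exists_seminorm_slice_le_of_continuous q hq (shearTensor g φ) N
  refine ⟨2 ^ N * C, by positivity, fun x ξ => ?_⟩
  have hs : dualStft g φ x = waveTransform (slice x (shearTensor g φ)) := by
    rw [dualStft]
    congr 1
    ext y
    simp
  have h1 := SchwartzMap.one_add_le_sup_seminorm_apply (𝕜 := ℂ) (m := (N, 0)) (k := N)
    (n := 0) le_rfl le_rfl (dualStft g φ x) ξ
  rw [norm_iteratedFDeriv_zero] at h1
  have h2 := h x
  have hξ : 0 < 1 + ‖ξ‖ := by positivity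
  rw [Real.rpow_neg hξ.le, Real.rpow_natCast, ← mul_assoc, ← div_eq_mul_inv,
    le_div_iff₀ (by positivity), mul_comm, mul_assoc (2 ^ N : ℝ)]
  refine h1.trans ?_
  gcongr
  rw [hs]
  exact h2

/-- The weight `(1 + |z|)^{-N}`. -/
def decayWeight (N : ℕ) (z : Rn d) : ℝ≥0∞ := ENNReal.ofReal ((1 + ‖z‖) ^ (-(N : ℝ)))

theorem measurable_decayWeight (N : ℕ) : Measurable (decayWeight N : Rn d → ℝ≥0∞) := by
  unfold decayWeight; fun_prop

/-- Covariance: a time-frequency shift of the test function shifts its transform in the phase space,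
up to a phase of modulus one. The decay of one fixed transform thus becomes decay off the diagonal.
-/
theorem dualStft_shiftedWindow (g θ : 𝓢(Rn d, ℂ)) (x ξ x' ξ' : Rn d) :
    dualStft g (shiftedWindow θ x' ξ') x ξ =
      planeWave (ξ' - ξ) x' * dualStft g (schwartzConj θ) (x - x') (ξ - ξ') := by
  rw [dualStft_apply, dualStft_apply, ← integral_const_mul,
    ← integral_sub_right_eq_self (fun y => planeWave (ξ' - ξ) x' * (planeWave (-(ξ - ξ')) y *
      (g (y - (x - x')) * schwartzConj θ y))) x']
  refine integral_congr_ae (Filter.Eventually.of_forall fun y => ?_)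
  simp only [shiftedWindow_apply', schwartzConj_apply]
  have h1 : planeWave (-ξ) y * planeWave ξ' y = planeWave (ξ' - ξ) x' *
      planeWave (-(ξ - ξ')) (y - x') := by
    rw [neg_sub, ← planeWave_add_right, ← planeWave_add]
    congr 1 <;> abel
  have h2 : y - x' - (x - x') = y - x := by abel
  rw [h2]
  linear_combination (g (y - x) * (starRingEnd ℂ) (θ (y - x'))) * h1

/-- Change of window for the short-time Fourier transform. -/
theorem exists_stft_le {g : 𝓢(Rn d, ℂ)} (hg : g ≠ 0) (θ : 𝓢(Rn d, ℂ)) (N : ℕ) : ∃ C : ℝ≥0,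
    ∀ {F : Type} [NormedAddCommGroup F] [NormedSpace ℂ F] [CompleteSpace F] (T : 𝓢'(Rn d, F))
      (x' ξ' : Rn d), ‖stft θ T x' ξ'‖ₑ ≤ C * ∫⁻ x, ∫⁻ ξ, ‖stft g T x ξ‖ₑ *
        (decayWeight N (x' - x) * decayWeight N (ξ' - ξ)) := by
  obtain ⟨C, hC, h⟩ := exists_dualStft_decay g (schwartzConj θ) N
  have hpos := integral_norm_sq_pos hg
  set A : ℂ := (2 * Real.pi : ℂ) ^ d * ((∫ y, ‖g y‖ ^ 2 : ℝ) : ℂ) with hA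
  have hA0 : A ≠ 0 := by
    refine mul_ne_zero (pow_ne_zero _ ?_) (by exact_mod_cast hpos.ne')
    exact_mod_cast (by positivity : (2 * Real.pi : ℝ) ≠ 0)
  refine ⟨‖A⁻¹‖₊ * C.toNNReal, fun {F} _ _ _ T x' ξ' => ?_⟩
  -- The value `V_θ T (x', ξ')` is `T` on a shifted window, so the inversion formula expresses it
  -- through `V_g T`.
  have h1 := tempered_inversion T g (shiftedWindow θ x' ξ')
  have h2 : stft θ T x' ξ' = A⁻¹ • ∫ x, ∫ ξ, dualStft g (shiftedWindow θ x' ξ') x ξ •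
      stft g T x ξ := by
    rw [← h1, smul_smul, inv_mul_cancel₀ hA0, one_smul]; rfl
  rw [h2, enorm_smul]
  have h3 : ‖∫ x, ∫ ξ, dualStft g (shiftedWindow θ x' ξ') x ξ • stft g T x ξ‖ₑ ≤
      ∫⁻ x, ∫⁻ ξ, C.toNNReal * (‖stft g T x ξ‖ₑ *
        (decayWeight N (x' - x) * decayWeight N (ξ' - ξ))) := by
    refine (enorm_integral_le_lintegral_enorm _).trans (lintegral_mono fun x => ?_)
    refine (enorm_integral_le_lintegral_enorm _).trans (lintegral_mono fun ξ => ?_)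
    rw [enorm_smul, dualStft_shiftedWindow, enorm_mul]
    have h4 : ‖planeWave (ξ' - ξ) x'‖ₑ = 1 := by
      rw [← ofReal_norm, norm_planeWave, ENNReal.ofReal_one]
    have h5 : ‖dualStft g (schwartzConj θ) (x - x') (ξ - ξ')‖ₑ ≤
        C.toNNReal * (decayWeight N (x' - x) * decayWeight N (ξ' - ξ)) := by
      rw [← ofReal_norm]
      refine (ENNReal.ofReal_le_ofReal (h _ _)).trans (le_of_eq ?_)
      rw [ENNReal.ofReal_mul hC, ENNReal.ofReal_mul (by positivity), norm_sub_rev x,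
        norm_sub_rev ξ]
      rfl
    rw [h4, one_mul]
    calc _ ≤ (C.toNNReal * (decayWeight N (x' - x) * decayWeight N (ξ' - ξ))) *
          ‖stft g T x ξ‖ₑ := by gcongr
      _ = _ := by ring
  have h6 : ∫⁻ x, ∫⁻ ξ, C.toNNReal * (‖stft g T x ξ‖ₑ *
        (decayWeight N (x' - x) * decayWeight N (ξ' - ξ))) = C.toNNReal * ∫⁻ x, ∫⁻ ξ,
        (‖stft g T x ξ‖ₑ * (decayWeight N (x' - x) * decayWeight N (ξ' - ξ))) := by
    simp_rw [lintegral_const_mul' (C.toNNReal : ℝ≥0∞) _ ENNReal.coe_ne_top]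
  rw [h6] at h3
  push_cast
  rw [mul_assoc]
  gcongr
  exact le_of_eq (enorm_eq_nnnorm _)

/-- The shear `(z, y) ↦ (z, y - z.1)`. -/
def windowShear : ((Rn d × Rn d) × Rn d) ≃L[ℝ] ((Rn d × Rn d) × Rn d) where
  toFun w := (w.1, w.2 - w.1.1)
  invFun w := (w.1, w.2 + w.1.1)
  map_add' a b := by ext <;> simp; ring
  map_smul' c a := by ext <;> simp [mul_sub]
  left_inv a := by ext <;> simp
  right_inv a := by ext <;> simp
  continuous_toFun := by fun_prop
  continuous_invFun := by fun_prop

/-- Continuity is local. After multiplication by a bump function in `z = (x, ξ)`, equal to one near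
`z₀`, the family of shifted windows is the family of slices of a single Schwartz function, and
slices depend continuously on the parameter. -/
theorem continuous_stft (g : 𝓢(Rn d, ℂ)) (T : 𝓢'(Rn d, F)) :
    Continuous fun z : Rn d × Rn d => stft g T z.1 z.2 := by
  rw [continuous_iff_continuousAt]
  intro z₀
  let b : ContDiffBump z₀ := ⟨1, 2, by norm_num, by norm_num⟩
  have hb1 : HasCompactSupport fun z => (b z : ℂ) :=
    b.hasCompactSupport.comp_left (g := fun t : ℝ => (t : ℂ)) (by simp)
  have hb2 : ContDiff ℝ (⊤ : ℕ∞) fun z => (b z : ℂ) :=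
    Complex.ofRealCLM.contDiff.comp b.contDiff
  let χ : 𝓢(Rn d × Rn d, ℂ) := hb1.toSchwartzMap hb2
  have hgrow := hasTemperateGrowth_planeWave_comp
    ((ContinuousLinearMap.snd ℝ (Rn d) (Rn d)).comp
      (ContinuousLinearMap.fst ℝ (Rn d × Rn d) (Rn d)))
    (ContinuousLinearMap.snd ℝ (Rn d × Rn d) (Rn d))
  let Ψ : 𝓢((Rn d × Rn d) × Rn d, ℂ) := smulLeftCLM ℂ
    (fun w : (Rn d × Rn d) × Rn d => planeWave w.1.2 w.2)
    (compCLMOfContinuousLinearEquiv ℂ windowShear (schwartzTensor χ (schwartzConj g)))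
  have hΨ : ∀ z y, Ψ (z, y) = planeWave z.2 y * (χ z * (starRingEnd ℂ) (g (y - z.1))) :=
    fun z y => smulLeftCLM_apply_apply hgrow _ _
  have hs : ∀ z, slice z Ψ = χ z • shiftedWindow g z.1 z.2 := by
    intro z
    ext y
    rw [slice_apply, hΨ, smul_apply, shiftedWindow_apply', smul_eq_mul]
    ring
  have hc : Continuous fun z => T (slice z Ψ) := (map_continuous T).comp (continuous_slice Ψ)
  refine (hc.continuousAt (x := z₀)).congr ?_
  filter_upwards [b.eventuallyEq_one] with z hz
  have : χ z = 1 := by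
    change ((b z : ℝ) : ℂ) = 1
    rw [hz]; simp
  rw [hs, map_smul, this, one_smul]
  rfl

end

noncomputable section

set_option linter.unusedSectionVars false

/-! ### Norms of `[0, ∞]`-valued functions: Jensen, Minkowski and Young inequalities. -/

section Lintegral

variable {α β : Type*} [MeasurableSpace α] [MeasurableSpace β] {μ : Measure α} {ν : Measure β}

/-- The `L^p` norm of a function with values in `[0, ∞]`, for real `p`. -/
def lnorm (μ : Measure α) (p : ℝ) (f : α → ℝ≥0∞) : ℝ≥0∞ := (∫⁻ x, f x ^ p ∂μ) ^ (1 / p)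

theorem lnorm_rpow {p : ℝ} (hp : 0 < p) (f : α → ℝ≥0∞) :
    lnorm μ p f ^ p = ∫⁻ x, f x ^ p ∂μ := by
  rw [lnorm, ← ENNReal.rpow_mul, one_div_mul_cancel hp.ne', ENNReal.rpow_one]

theorem lnorm_le_iff {p : ℝ} (hp : 0 < p) (f : α → ℝ≥0∞) (A : ℝ≥0∞) :
    lnorm μ p f ≤ A ↔ ∫⁻ x, f x ^ p ∂μ ≤ A ^ p := by
  rw [← lnorm_rpow hp, ENNReal.rpow_le_rpow_iff hp]

theorem lnorm_mono_ae {p : ℝ} (hp : 0 < p) {f g : α → ℝ≥0∞} (h : ∀ᵐ x ∂μ, f x ≤ g x) :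
    lnorm μ p f ≤ lnorm μ p g := by
  unfold lnorm
  gcongr 1
  refine lintegral_mono_ae ?_
  filter_upwards [h] with x hx
  gcongr

theorem lnorm_mono {p : ℝ} (hp : 0 < p) {f g : α → ℝ≥0∞} (h : ∀ x, f x ≤ g x) :
    lnorm μ p f ≤ lnorm μ p g :=
  lnorm_mono_ae hp (Filter.Eventually.of_forall h)

theorem lnorm_one (f : α → ℝ≥0∞) : lnorm μ 1 f = ∫⁻ x, f x ∂μ := by simp [lnorm]

theorem lnorm_const_mul {p : ℝ} (hp : 0 < p) {c : ℝ≥0∞} (hc : c ≠ ∞) (f : α → ℝ≥0∞) :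
    lnorm μ p (fun x => c * f x) = c * lnorm μ p f := by
  unfold lnorm
  simp_rw [ENNReal.mul_rpow_of_nonneg _ _ hp.le]
  rw [lintegral_const_mul' _ _ (ENNReal.rpow_ne_top_of_nonneg hp.le hc),
    ENNReal.mul_rpow_of_nonneg _ _ (by positivity), ← ENNReal.rpow_mul, mul_one_div_cancel hp.ne',
    ENNReal.rpow_one]

theorem lnorm_eq_eLpNorm {E : Type*} [NormedAddCommGroup E] {p : ℝ} (hp : 0 < p) (f : α → E) :
    eLpNorm f (ENNReal.ofReal p) μ = lnorm μ p fun x => ‖f x‖ₑ := by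
  rw [eLpNorm_eq_lintegral_rpow_enorm_toReal (by simpa using hp) ENNReal.ofReal_ne_top,
    ENNReal.toReal_ofReal hp.le, lnorm]

theorem lnorm_eq_eLpNorm' {p : ℝ} (hp : 0 < p) (f : α → ℝ≥0∞) :
    eLpNorm f (ENNReal.ofReal p) μ = lnorm μ p f := by
  rw [eLpNorm_eq_lintegral_rpow_enorm_toReal (by simpa using hp) ENNReal.ofReal_ne_top,
    ENNReal.toReal_ofReal hp.le, lnorm]
  simp

/-- Jensen's inequality for the measure with density `w`, without normalization. -/
theorem rpow_lintegral_mul_le {p : ℝ} (hp : 1 ≤ p) {f w : α → ℝ≥0∞} (hf : AEMeasurable f μ)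
    (hw : AEMeasurable w μ) :
    (∫⁻ x, f x * w x ∂μ) ^ p ≤ (∫⁻ x, f x ^ p * w x ∂μ) * (∫⁻ x, w x ∂μ) ^ (p - 1) := by
  rcases hp.eq_or_lt with rfl | hp1
  · simp
  have hp0 : 0 < p := by linarith
  have hpq : p.HolderConjugate (Real.conjExponent p) := Real.HolderConjugate.conjExponent hp1
  set q := Real.conjExponent p
  have hq0 : 0 < q := hpq.symm.pos
  have hsum : 1 / p + 1 / q = 1 := by simpa [one_div] using hpq.inv_add_inv_eq_one
  -- Hölder's inequality with `w` split as `w^{1/p} w^{1/q}`.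
  have h := ENNReal.lintegral_mul_le_Lp_mul_Lq μ hpq (f := fun x => f x * w x ^ (1 / p))
    (g := fun x => w x ^ (1 / q)) (hf.mul (hw.pow_const _)) (hw.pow_const _)
  have e1 : ∀ x, (f x * w x ^ (1 / p)) * w x ^ (1 / q) = f x * w x := fun x => by
    rw [mul_assoc, ← ENNReal.rpow_add_of_nonneg _ _ (by positivity) (by positivity), hsum,
      ENNReal.rpow_one]
  have e2 : ∀ x, (f x * w x ^ (1 / p)) ^ p = f x ^ p * w x := fun x => by
    rw [ENNReal.mul_rpow_of_nonneg _ _ hp0.le, ← ENNReal.rpow_mul, one_div_mul_cancel hp0.ne',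
      ENNReal.rpow_one]
  have e3 : ∀ x, (w x ^ (1 / q)) ^ q = w x := fun x => by
    rw [← ENNReal.rpow_mul, one_div_mul_cancel hq0.ne', ENNReal.rpow_one]
  simp only [Pi.mul_apply, e1, e2, e3] at h
  calc _ ≤ ((∫⁻ x, f x ^ p * w x ∂μ) ^ (1 / p) * (∫⁻ x, w x ∂μ) ^ (1 / q)) ^ p := by gcongr
    _ = _ := by
      rw [ENNReal.mul_rpow_of_nonneg _ _ hp0.le, ← ENNReal.rpow_mul, ← ENNReal.rpow_mul,
        one_div_mul_cancel hp0.ne', ENNReal.rpow_one]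
      congr 2
      field_simp at hsum ⊢
      linarith

/-- Minkowski's integral inequality. -/
theorem lnorm_lintegral_le [SFinite μ] [SFinite ν] {p : ℝ} (hp : 1 ≤ p) {a : α → β → ℝ≥0∞}
    (ha : Measurable (Function.uncurry a)) :
    lnorm μ p (fun x => ∫⁻ y, a x y ∂ν) ≤ ∫⁻ y, lnorm μ p (fun x => a x y) ∂ν := by
  have hp0 : 0 < p := by linarith
  set N : β → ℝ≥0∞ := fun y => lnorm μ p (fun x => a x y) with hN
  have hNm : Measurable N := by
    have : Measurable fun y => ∫⁻ x, a x y ^ p ∂μ :=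
      Measurable.lintegral_prod_left' (f := fun z : α × β => a z.1 z.2 ^ p) (ha.pow_const p)
    exact this.pow_const _
  set S := ∫⁻ y, N y ∂ν with hS
  rcases eq_or_ne S ∞ with hST | hST
  · rw [hST]; exact le_top
  have hNfin : ∀ᵐ y ∂ν, N y < ∞ := ae_lt_top hNm hST
  have hbm : Measurable (Function.uncurry fun x y => a x y / N y) :=
    ha.div (hNm.comp measurable_snd)
  -- The proof applies Jensen's inequality with density `N` to `a / N`. Values `N y = ∞` occur only
  -- on a null set, and where `N y = 0` the function `a · y` vanishes almost everywhere, so the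
  -- factorization holds off null sets.
  have hab : ∀ᵐ x ∂μ, ∀ᵐ y ∂ν, a x y = a x y / N y * N y := by
    have hset : MeasurableSet {z : α × β | a z.1 z.2 = a z.1 z.2 / N z.2 * N z.2} :=
      measurableSet_eq_fun ha (hbm.mul (hNm.comp measurable_snd))
    rw [Measure.ae_ae_comm hset]
    filter_upwards [hNfin] with y hy
    rcases eq_or_ne (N y) 0 with h0 | h0
    · have h1 : ∫⁻ x, a x y ^ p ∂μ = 0 := by
        rw [← lnorm_rpow hp0, show lnorm μ p (fun x => a x y) = 0 from h0,
          ENNReal.zero_rpow_of_pos hp0]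
      have hm : Measurable fun x => a x y ^ p :=
        (ha.comp (measurable_id.prodMk measurable_const)).pow_const p
      rw [lintegral_eq_zero_iff hm] at h1
      filter_upwards [h1] with x hx
      have : a x y = 0 := by
        simpa [hp0, hp0.le, not_lt.2 hp0.le] using hx
      simp [this]
    · exact Filter.Eventually.of_forall fun x => (ENNReal.div_mul_cancel h0 hy.ne).symm
  rw [lnorm_le_iff hp0]
  have hbN : ∀ᵐ y ∂ν, (∫⁻ x, (a x y / N y) ^ p ∂μ) * N y ≤ N y := by
    filter_upwards [hNfin] with y hy
    rcases eq_or_ne (N y) 0 with h0 | h0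
    · simp [h0]
    · refine mul_le_of_le_one_left' ?_
      simp_rw [ENNReal.div_rpow_of_nonneg _ _ hp0.le, div_eq_mul_inv]
      rw [lintegral_mul_const', ← lnorm_rpow hp0]
      · exact le_of_eq (ENNReal.mul_inv_cancel (by simpa [hp0, hp0.le, not_lt.2 hp0.le] using h0)
          (ENNReal.rpow_ne_top_of_nonneg hp0.le hy.ne))
      · simpa [hp0, hp0.le, not_lt.2 hp0.le, hy.ne] using h0
  calc ∫⁻ x, (∫⁻ y, a x y ∂ν) ^ p ∂μ
      ≤ ∫⁻ x, (∫⁻ y, (a x y / N y) ^ p * N y ∂ν) * S ^ (p - 1) ∂μ := by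
        refine lintegral_mono_ae ?_
        filter_upwards [hab] with x hx
        rw [lintegral_congr_ae hx]
        refine rpow_lintegral_mul_le hp ?_ hNm.aemeasurable
        exact (hbm.comp (measurable_const.prodMk measurable_id)).aemeasurable
    _ = (∫⁻ y, (∫⁻ x, (a x y / N y) ^ p ∂μ) * N y ∂ν) * S ^ (p - 1) := by
        rw [lintegral_mul_const', lintegral_lintegral_swap]
        · congr 1
          refine lintegral_congr fun y => ?_
          rw [lintegral_mul_const]
          exact (hbm.comp (measurable_id.prodMk measurable_const)).pow_const p
        · exact ((hbm.pow_const p).mul (hNm.comp measurable_snd)).aemeasurable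
        · exact ENNReal.rpow_ne_top_of_nonneg (by linarith) hST
    _ ≤ S * S ^ (p - 1) := by
        gcongr ?_ * _
        exact lintegral_mono_ae hbN
    _ = S ^ p := by
        conv_lhs => rw [← ENNReal.rpow_one S, ← ENNReal.rpow_mul]
        rw [← ENNReal.rpow_add_of_nonneg _ _ (by norm_num) (by linarith)]
        congr 1; ring

end Lintegral

section Convolution

variable {G : Type*} [NormedAddCommGroup G] [MeasurableSpace G] [BorelSpace G]
  [SecondCountableTopology G] {μ : Measure G} [SFinite μ] [μ.IsAddHaarMeasure]
  [μ.IsNegInvariant]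

theorem lintegral_sub_swap (B : G → ℝ≥0∞) (x : G) : ∫⁻ y, B (x - y) ∂μ = ∫⁻ y, B y ∂μ :=
  lintegral_sub_left_eq_self B x

theorem measurable_lconv {f B : G → ℝ≥0∞} (hf : Measurable f) (hB : Measurable B) :
    Measurable fun x => ∫⁻ y, f y * B (x - y) ∂μ :=
  Measurable.lintegral_prod_right' (f := fun z : G × G => f z.2 * B (z.1 - z.2))
    ((hf.comp measurable_snd).mul (hB.comp (measurable_fst.sub measurable_snd)))

/-- Convolution with a bounded integrable weight maps `L^p` into `L^∞`. -/
theorem lconv_le {p : ℝ} (hp : 1 ≤ p) {f B : G → ℝ≥0∞} (hf : Measurable f) (hB : Measurable B)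
    (hB1 : ∀ x, B x ≤ 1) (x : G) :
    ∫⁻ y, f y * B (x - y) ∂μ ≤ max 1 (∫⁻ y, B y ∂μ) * lnorm μ p f := by
  have hp0 : 0 < p := by linarith
  rw [← ENNReal.rpow_le_rpow_iff hp0, ENNReal.mul_rpow_of_nonneg _ _ hp0.le, lnorm_rpow hp0]
  have hBm : Measurable fun y => B (x - y) := hB.comp (measurable_const.sub measurable_id)
  refine (rpow_lintegral_mul_le hp hf.aemeasurable hBm.aemeasurable).trans ?_
  rw [lintegral_sub_swap, mul_comm]
  gcongr ?_ * ?_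
  · calc _ ≤ max 1 (∫⁻ y, B y ∂μ) ^ (p - 1) :=
        ENNReal.rpow_le_rpow (le_max_right _ _) (by linarith)
      _ ≤ _ := ENNReal.rpow_le_rpow_of_exponent_le (le_max_left _ _) (by linarith)
  · refine lintegral_mono fun y => ?_
    exact mul_le_of_le_one_right' (hB1 _)

/-- Convolution with a bounded integrable weight maps `L^p` into `L^r` for `r ≥ p`. -/
theorem lnorm_lconv_le {p r : ℝ} (hp : 1 ≤ p) (hpr : p ≤ r) {f B : G → ℝ≥0∞} (hf : Measurable f)
    (hB : Measurable B) (hB1 : ∀ x, B x ≤ 1) :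
    lnorm μ r (fun x => ∫⁻ y, f y * B (x - y) ∂μ) ≤ max 1 (∫⁻ y, B y ∂μ) * lnorm μ p f := by
  have hp0 : 0 < p := by linarith
  set D := max 1 (∫⁻ y, B y ∂μ) with hD
  have hD1 : 1 ≤ D := le_max_left _ _
  have hconv : ∫⁻ x, (∫⁻ y, f y * B (x - y) ∂μ) ^ p ∂μ ≤ (D * lnorm μ p f) ^ p := by
    rw [ENNReal.mul_rpow_of_nonneg _ _ hp0.le, lnorm_rpow hp0]
    have hm : Measurable fun z : G × G => f z.2 ^ p * B (z.1 - z.2) :=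
      ((hf.pow_const p).comp measurable_snd).mul (hB.comp (measurable_fst.sub measurable_snd))
    calc _ ≤ ∫⁻ x, (∫⁻ y, f y ^ p * B (x - y) ∂μ) * (∫⁻ y, B y ∂μ) ^ (p - 1) ∂μ := by
          refine lintegral_mono fun x => ?_
          have hBm : Measurable fun y => B (x - y) := hB.comp (measurable_const.sub measurable_id)
          refine (rpow_lintegral_mul_le hp hf.aemeasurable hBm.aemeasurable).trans ?_
          rw [lintegral_sub_swap]
      _ = (∫⁻ y, f y ^ p * ∫⁻ x, B x ∂μ ∂μ) * (∫⁻ y, B y ∂μ) ^ (p - 1) := by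
          rw [lintegral_mul_const _ hm.lintegral_prod_right', lintegral_lintegral_swap
            hm.aemeasurable]
          congr 1
          refine lintegral_congr fun y => ?_
          change ∫⁻ x, f y ^ p * B (x - y) ∂μ = _
          have hBm : Measurable fun x => B (x - y) := hB.comp (measurable_id.sub measurable_const)
          rw [lintegral_const_mul _ hBm, lintegral_sub_right_eq_self B y]
      _ = (∫⁻ y, f y ^ p ∂μ) * ((∫⁻ y, B y ∂μ) ^ (1 : ℝ) * (∫⁻ y, B y ∂μ) ^ (p - 1)) := by
          rw [lintegral_mul_const _ (hf.pow_const p), mul_assoc, ENNReal.rpow_one]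
      _ ≤ _ := by
          rw [← ENNReal.rpow_add_of_nonneg _ _ (by norm_num) (by linarith), mul_comm]
          gcongr
          rw [add_sub_cancel]
          exact ENNReal.rpow_le_rpow (le_max_right _ _) hp0.le
  rw [lnorm_le_iff (by linarith)]
  -- Interpolation by hand: `r - p` of the powers are estimated by the sup bound `lconv_le`, the
  -- other `p` by the `L^p` bound `hconv`.
  calc ∫⁻ x, (∫⁻ y, f y * B (x - y) ∂μ) ^ r ∂μ
      = ∫⁻ x, (∫⁻ y, f y * B (x - y) ∂μ) ^ (r - p) * (∫⁻ y, f y * B (x - y) ∂μ) ^ p ∂μ := by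
        refine lintegral_congr fun x => ?_
        rw [← ENNReal.rpow_add_of_nonneg _ _ (by linarith) hp0.le, sub_add_cancel]
    _ ≤ ∫⁻ x, (D * lnorm μ p f) ^ (r - p) * (∫⁻ y, f y * B (x - y) ∂μ) ^ p ∂μ := by
        refine lintegral_mono fun x => ?_
        exact mul_le_mul' (ENNReal.rpow_le_rpow (lconv_le hp hf hB hB1 x) (by linarith)) le_rfl
    _ = (D * lnorm μ p f) ^ (r - p) * ∫⁻ x, (∫⁻ y, f y * B (x - y) ∂μ) ^ p ∂μ :=
        lintegral_const_mul _ ((measurable_lconv hf hB).pow_const p)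
    _ ≤ (D * lnorm μ p f) ^ (r - p) * (D * lnorm μ p f) ^ p := by gcongr
    _ = _ := by
        rw [← ENNReal.rpow_add_of_nonneg _ _ (by linarith) hp0.le, sub_add_cancel]

end Convolution

end

noncomputable section

set_option linter.unusedSectionVars false

/-! ### Riesz kernels and the Hardy-Littlewood-Sobolev inequality. -/

section RieszPotential

variable {d : ℕ}

/-- The kernel `|z|^{-a}` with values in `[0, ∞]`. -/
def rieszKernel (a : ℝ) (z : Rn d) : ℝ≥0∞ := ENNReal.ofReal (‖z‖ ^ (-a))

theorem measurable_rieszKernel (a : ℝ) : Measurable (rieszKernel a : Rn d → ℝ≥0∞) := by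
  unfold rieszKernel; fun_prop

theorem rieszKernel_neg (a : ℝ) (z : Rn d) : rieszKernel a (-z) = rieszKernel a z := by
  simp [rieszKernel]

theorem rieszKernel_smul (a : ℝ) {r : ℝ} (hr : 0 < r) (z : Rn d) :
    rieszKernel a (r • z) = ENNReal.ofReal (r ^ (-a)) * rieszKernel a z := by
  rw [rieszKernel, norm_smul, Real.norm_of_nonneg hr.le, Real.mul_rpow hr.le (norm_nonneg _),
    ENNReal.ofReal_mul (by positivity)]
  rfl

theorem rieszKernel_rpow (a : ℝ) {b : ℝ} (hb : 0 ≤ b) (z : Rn d) :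
    rieszKernel a z ^ b = rieszKernel (a * b) z := by
  rw [rieszKernel, rieszKernel, ENNReal.ofReal_rpow_of_nonneg (by positivity) hb,
    ← Real.rpow_mul (norm_nonneg _), neg_mul]

theorem lintegral_eq_ofReal_mul_lintegral_smul {r : ℝ} (hr : 0 < r) {φ : Rn d → ℝ≥0∞}
    (hφ : Measurable φ) :
    ∫⁻ z, φ z = ENNReal.ofReal (r ^ (d : ℝ)) * ∫⁻ z, φ (r • z) := by
  have h := Measure.map_addHaar_smul (volume : Measure (Rn d)) hr.ne'
  have h2 : ∫⁻ z, φ (r • z) = ENNReal.ofReal |(r ^ d)⁻¹| * ∫⁻ z, φ z := by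
    rw [← lintegral_map hφ (measurable_const_smul r), h, lintegral_smul_measure]
    simp
  rw [h2, ← mul_assoc, ← ENNReal.ofReal_mul (by positivity), abs_of_pos (by positivity),
    Real.rpow_natCast, mul_inv_cancel₀ (by positivity), ENNReal.ofReal_one, one_mul]

/-- Homogeneity of the kernel under the dilation `z ↦ r z` reduces every radius to radius one. -/
theorem setLIntegral_rieszKernel_closedBall (a : ℝ) {r : ℝ} (hr : 0 < r) :
    ∫⁻ z in {z : Rn d | ‖z‖ ≤ r}, rieszKernel a z =
      ENNReal.ofReal (r ^ (d - a)) * ∫⁻ z in {z : Rn d | ‖z‖ ≤ 1}, rieszKernel a z := by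
  have hm : ∀ r : ℝ, MeasurableSet {z : Rn d | ‖z‖ ≤ r} := fun r =>
    measurableSet_le measurable_norm measurable_const
  rw [← lintegral_indicator (hm r), ← lintegral_indicator (hm 1),
    lintegral_eq_ofReal_mul_lintegral_smul hr ((measurable_rieszKernel a).indicator (hm r)),
    sub_eq_add_neg, Real.rpow_add hr, ENNReal.ofReal_mul (by positivity), mul_assoc]
  congr 1
  rw [← lintegral_const_mul' _ _ ENNReal.ofReal_ne_top]
  refine lintegral_congr fun z => ?_
  simp only [Set.indicator_apply, Set.mem_ofPred_eq, norm_smul, Real.norm_of_nonneg hr.le]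
  have : r * ‖z‖ ≤ r ↔ ‖z‖ ≤ 1 := by
    rw [mul_le_iff_le_one_right hr]
  simp only [this]
  split_ifs
  · exact rieszKernel_smul a hr z
  · simp

theorem setLIntegral_rieszKernel_compl (a : ℝ) {r : ℝ} (hr : 0 < r) :
    ∫⁻ z in {z : Rn d | r < ‖z‖}, rieszKernel a z =
      ENNReal.ofReal (r ^ (d - a)) * ∫⁻ z in {z : Rn d | 1 < ‖z‖}, rieszKernel a z := by
  have hm : ∀ r : ℝ, MeasurableSet {z : Rn d | r < ‖z‖} := fun r =>
    measurableSet_lt measurable_const measurable_norm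
  rw [← lintegral_indicator (hm r), ← lintegral_indicator (hm 1),
    lintegral_eq_ofReal_mul_lintegral_smul hr ((measurable_rieszKernel a).indicator (hm r)),
    sub_eq_add_neg, Real.rpow_add hr, ENNReal.ofReal_mul (by positivity), mul_assoc]
  congr 1
  rw [← lintegral_const_mul' _ _ ENNReal.ofReal_ne_top]
  refine lintegral_congr fun z => ?_
  simp only [Set.indicator_apply, Set.mem_ofPred_eq, norm_smul, Real.norm_of_nonneg hr.le]
  have : r < r * ‖z‖ ↔ 1 < ‖z‖ := by
    rw [lt_mul_iff_one_lt_right hr]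
  simp only [this]
  split_ifs
  · exact rieszKernel_smul a hr z
  · simp

/-- In polar coordinates the integrand is `t^{d-1-a}`, integrable at zero since `a < d`. Positivity
of `d` is needed for the natural number exponent `d - 1`. -/
theorem setLIntegral_rieszKernel_near_lt_top {a : ℝ} (hd : 0 < d) (ha : a < d) :
    ∫⁻ z in {z : Rn d | ‖z‖ ≤ 1}, rieszKernel a z < ∞ := by
  have : Nonempty (Fin d) := ⟨⟨0, hd⟩⟩
  have h : IntegrableOn (fun z : Rn d => ‖z‖ ^ (-a)) (Metric.ball 0 2) := by
    rw [integrableOn_fun_norm_addHaar volume (f := fun t => t ^ (-a))]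
    have h1 : IntegrableOn (fun y : ℝ => y ^ ((d : ℝ) - 1 - a)) (Set.Ioo 0 2) := by
      have := (intervalIntegral.intervalIntegrable_rpow' (a := 0) (b := 2)
        (by linarith : -1 < (d : ℝ) - 1 - a)).1
      exact this.mono_set Set.Ioo_subset_Ioc_self
    refine h1.congr_fun (fun y hy => ?_) measurableSet_Ioo
    have hy0 : 0 < y := hy.1
    simp only [finrank_euclideanSpace, Fintype.card_fin, smul_eq_mul]
    rw [← Real.rpow_natCast, ← Real.rpow_add hy0, Nat.cast_sub (by omega)]
    congr 1
    push_cast; ring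
  have hs : {z : Rn d | ‖z‖ ≤ 1} ⊆ Metric.ball 0 2 := fun z hz => by
    simp only [Set.mem_ofPred_eq, mem_ball_zero_iff] at *; linarith
  exact (h.mono_set hs).lintegral_lt_top

theorem setLIntegral_rieszKernel_far_lt_top {a : ℝ} (ha : d < a) :
    ∫⁻ z in {z : Rn d | 1 < ‖z‖}, rieszKernel a z < ∞ := by
  have hm : MeasurableSet {z : Rn d | 1 < ‖z‖} := measurableSet_lt measurable_const measurable_norm
  have h : Integrable fun z : Rn d => (1 + ‖z‖) ^ (-a) :=
    integrable_one_add_norm (by simpa using ha)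
  have ha0 : 0 < a := lt_of_le_of_lt (Nat.cast_nonneg d) ha
  refine lt_of_le_of_lt (setLIntegral_mono' hm (g := fun z => ENNReal.ofReal (2 ^ a *
    (1 + ‖z‖) ^ (-a))) fun z hz => ENNReal.ofReal_le_ofReal ?_)
    (lt_of_le_of_lt (setLIntegral_le_lintegral _ _) (h.const_mul _).lintegral_lt_top)
  have hz1 : 1 < ‖z‖ := hz
  rw [Real.rpow_neg (by positivity), Real.rpow_neg (by positivity), ← div_eq_mul_inv,
    ← Real.div_rpow (by positivity) (by positivity), ← Real.inv_rpow (by positivity)]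
  refine Real.rpow_le_rpow (by positivity) ?_ ha0.le
  rw [inv_eq_one_div, div_le_div_iff₀ (by positivity) (by positivity)]
  linarith


/-- The diagonal part of the Hardy-Littlewood-Sobolev inequality. -/
theorem exists_lintegral_rieszKernel_le {γ : ℝ} (hγ : 0 < γ) (hγd : γ < d) : ∃ C : ℝ≥0,
    ∀ f : Rn d → ℝ≥0∞, Measurable f → ∫⁻ x, f x ^ (2 * d / (d + γ)) ≤ 2 →
      ∀ t : ℝ≥0∞, t ≠ 0 → t ≠ ∞ → ∀ x,
        ∫⁻ y, (if f y ≤ t then f y * rieszKernel (d - γ) (x - y) else 0) ≤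
          C * t ^ (2 * d / (d + γ) - 1) := by
  have hd : (0 : ℝ) < d := hγ.trans hγd
  have hdγ : (0 : ℝ) < d + γ := by positivity
  have hdγ' : (0 : ℝ) < d - γ := by linarith
  set q : ℝ := 2 * d / (d + γ) with hq
  set q' : ℝ := 2 * d / (d - γ) with hq'
  have hq0 : 0 < q := by positivity
  have hq'0 : 0 < q' := by positivity
  have hconj : q.HolderConjugate q' := by
    rw [Real.holderConjugate_iff]
    refine ⟨?_, ?_⟩
    · rw [hq, lt_div_iff₀ hdγ]; linarith
    · rw [hq, hq']; field_simp; ring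
  set c1 := ∫⁻ z in {z : Rn d | ‖z‖ ≤ 1}, rieszKernel (d - γ) z with hc1
  have hc1T : c1 < ∞ := setLIntegral_rieszKernel_near_lt_top (by exact_mod_cast hd) (by linarith)
  set c2 := ∫⁻ z in {z : Rn d | 1 < ‖z‖}, rieszKernel (2 * d) z with hc2
  have hc2T : c2 < ∞ := setLIntegral_rieszKernel_far_lt_top (by linarith)
  have hCT : c1 + 2 ^ (1 / q) * c2 ^ (1 / q') ≠ ∞ :=
    ENNReal.add_ne_top.2 ⟨hc1T.ne, ENNReal.mul_ne_top (ENNReal.rpow_ne_top_of_nonneg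
      (by positivity) (by simp)) (ENNReal.rpow_ne_top_of_nonneg (by positivity) hc2T.ne)⟩
  refine ⟨(c1 + 2 ^ (1 / q) * c2 ^ (1 / q')).toNNReal, fun f hf hfq t ht0 htT x => ?_⟩
  rw [ENNReal.coe_toNNReal hCT]
  obtain ⟨τ, hτ, rfl⟩ : ∃ τ : ℝ, 0 < τ ∧ t = ENNReal.ofReal τ :=
    ⟨t.toReal, ENNReal.toReal_pos ht0 htT, (ENNReal.ofReal_toReal htT).symm⟩
  -- This radius balances the two parts. Near, `f ≤ τ` gives a multiple of `τ r^γ`. Far, Hölder's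
  -- inequality with `(d - γ) q' = 2d` gives a multiple of `r^{-d/q'}`. Both powers equal `τ^{q-1}`.
  set r : ℝ := τ ^ (-q / d) with hr
  have hr0 : 0 < r := by positivity
  have hmn : MeasurableSet {z : Rn d | ‖z‖ ≤ r} := measurableSet_le measurable_norm measurable_const
  have hmf : MeasurableSet {z : Rn d | r < ‖z‖} := measurableSet_lt measurable_const measurable_norm
  set kn : Rn d → ℝ≥0∞ := {z : Rn d | ‖z‖ ≤ r}.indicator (rieszKernel (d - γ)) with hkn
  set kf : Rn d → ℝ≥0∞ := {z : Rn d | r < ‖z‖}.indicator (rieszKernel (d - γ)) with hkf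
  have hknm : Measurable kn := (measurable_rieszKernel _).indicator hmn
  have hkfm : Measurable kf := (measurable_rieszKernel _).indicator hmf
  have hsub : ∀ k : Rn d → ℝ≥0∞, Measurable k → Measurable fun y => k (x - y) := fun k hk =>
    hk.comp (measurable_const.sub measurable_id)
  have hpt : ∀ y, (if f y ≤ ENNReal.ofReal τ then f y * rieszKernel (d - γ) (x - y) else 0) ≤
      ENNReal.ofReal τ * kn (x - y) + f y * kf (x - y) := by
    intro y
    split_ifs with h
    · by_cases hz : ‖x - y‖ ≤ r
      · refine le_add_right ?_
        simp only [hkn, Set.indicator_apply, Set.mem_ofPred_eq, hz, if_true]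
        gcongr
      · refine le_add_left ?_
        simp only [hkf, Set.indicator_apply, Set.mem_ofPred_eq, not_le.1 hz, if_true]
        exact le_rfl
    · exact zero_le
  have hnear : ∫⁻ y, ENNReal.ofReal τ * kn (x - y) = c1 * ENNReal.ofReal τ ^ (q - 1) := by
    rw [lintegral_const_mul' _ _ ENNReal.ofReal_ne_top, lintegral_sub_left_eq_self kn x,
      hkn, lintegral_indicator hmn, setLIntegral_rieszKernel_closedBall _ hr0, ← hc1, ← mul_assoc,
      ← ENNReal.ofReal_mul hτ.le, mul_comm, ENNReal.ofReal_rpow_of_pos hτ, hr, ← Real.rpow_mul hτ.le]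
    congr 2
    conv_lhs => rw [← Real.rpow_one τ, ← Real.rpow_mul hτ.le]
    rw [← Real.rpow_add hτ]
    congr 1
    rw [hq]; field_simp; ring
  have hfar : ∫⁻ y, f y * kf (x - y) ≤
      (2 ^ (1 / q) * c2 ^ (1 / q')) * ENNReal.ofReal τ ^ (q - 1) := by
    refine (ENNReal.lintegral_mul_le_Lp_mul_Lq volume hconj hf.aemeasurable
      (hsub _ hkfm).aemeasurable).trans ?_
    have e1 : ∫⁻ y, kf (x - y) ^ q' = ENNReal.ofReal (r ^ (-(d : ℝ))) * c2 := by
      rw [lintegral_sub_left_eq_self (fun z => kf z ^ q') x]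
      have : (fun z => kf z ^ q') = {z : Rn d | r < ‖z‖}.indicator (rieszKernel (2 * d)) := by
        funext z
        simp only [hkf, Set.indicator_apply]
        split_ifs
        · rw [rieszKernel_rpow _ hq'0.le]
          congr 1
          rw [hq']; field_simp
        · exact ENNReal.zero_rpow_of_pos hq'0
      rw [this, lintegral_indicator hmf, setLIntegral_rieszKernel_compl _ hr0]
      congr 3; ring
    rw [e1, ENNReal.mul_rpow_of_nonneg _ _ (by positivity : 0 ≤ 1 / q'), mul_assoc,
      mul_comm (c2 ^ (1 / q'))]
    have e2 : ENNReal.ofReal (r ^ (-(d : ℝ))) ^ (1 / q') = ENNReal.ofReal τ ^ (q - 1) := by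
      rw [ENNReal.ofReal_rpow_of_pos (by positivity), ENNReal.ofReal_rpow_of_pos hτ, hr,
        ← Real.rpow_mul hτ.le, ← Real.rpow_mul hτ.le]
      congr 2
      rw [hq, hq']; field_simp; ring
    rw [e2]
    gcongr
  refine (lintegral_mono hpt).trans ?_
  rw [lintegral_add_left ((hsub _ hknm).const_mul _), hnear, add_mul]
  gcongr

/-- The Hardy-Littlewood-Sobolev inequality, with equal exponents. -/
theorem exists_hardy_littlewood_sobolev {γ : ℝ} (hγ : 0 < γ) (hγd : γ < d) : ∃ C : ℝ≥0,
    ∀ f h : Rn d → ℝ≥0∞, Measurable f → Measurable h →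
      ∫⁻ x, ∫⁻ y, f x * (h y * rieszKernel (d - γ) (x - y)) ≤
        C * (lnorm volume (2 * d / (d + γ)) f * lnorm volume (2 * d / (d + γ)) h) := by
  have hd : (0 : ℝ) < d := hγ.trans hγd
  have hdγ : (0 : ℝ) < d + γ := by positivity
  obtain ⟨C, hC⟩ := exists_lintegral_rieszKernel_le hγ hγd
  set q : ℝ := 2 * d / (d + γ) with hq
  have hq0 : 0 < q := by positivity
  have hq1 : 1 < q := by rw [hq, lt_div_iff₀ hdγ]; linarith
  have hKm : Measurable fun z : Rn d × Rn d => rieszKernel (d - γ) (z.1 - z.2) :=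
    (measurable_rieszKernel _).comp (measurable_fst.sub measurable_snd)
  have hdiag : ∀ f : Rn d → ℝ≥0∞, Measurable f → ∫⁻ x, f x ^ q ≤ 2 →
      ∫⁻ x, ∫⁻ y, f x * (f y * rieszKernel (d - γ) (x - y)) ≤ 4 * C := by
    intro f hf hfq
    have hfin : ∀ᵐ x, f x ≠ ∞ := by
      have := ae_lt_top (hf.pow_const q) (ne_of_lt (lt_of_le_of_lt hfq (by simp)))
      filter_upwards [this] with x hx h
      rw [h, ENNReal.top_rpow_of_pos hq0] at hx
      exact lt_irrefl _ hx
    -- By symmetry only pairs with `f y ≤ f x` matter. There the truncated estimate at height `f x`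
    -- bounds the inner integral by `C (f x)^{q-1}`, and what is left is the integral of `f^q`.
    set J : Rn d → Rn d → ℝ≥0∞ := fun x y =>
      if f y ≤ f x then f y * rieszKernel (d - γ) (x - y) else 0 with hJ
    have hJm : Measurable (Function.uncurry J) := by
      refine Measurable.ite (measurableSet_le (hf.comp measurable_snd) (hf.comp measurable_fst))
        ((hf.comp measurable_snd).mul hKm) measurable_const
    have hfJm : Measurable fun z : Rn d × Rn d => f z.1 * J z.1 z.2 :=
      (hf.comp measurable_fst).mul hJm
    have hhalf : ∫⁻ x, ∫⁻ y, f x * J x y ≤ 2 * C := by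
      calc ∫⁻ x, ∫⁻ y, f x * J x y ≤ ∫⁻ x, C * f x ^ q := by
            refine lintegral_mono_ae ?_
            filter_upwards [hfin] with x hx
            rw [lintegral_const_mul' _ _ hx]
            rcases eq_or_ne (f x) 0 with h0 | h0
            · simp [h0]
            · calc _ ≤ f x * (C * f x ^ (q - 1)) := by
                    gcongr; exact hC f hf hfq (f x) h0 hx x
                _ = C * (f x ^ (1 : ℝ) * f x ^ (q - 1)) := by rw [ENNReal.rpow_one]; ring
                _ = _ := by rw [← ENNReal.rpow_add _ _ h0 hx]; congr 2; ring
        _ = C * ∫⁻ x, f x ^ q := lintegral_const_mul' _ _ ENNReal.coe_ne_top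
        _ ≤ _ := by rw [mul_comm]; gcongr
    calc ∫⁻ x, ∫⁻ y, f x * (f y * rieszKernel (d - γ) (x - y))
        ≤ ∫⁻ x, ∫⁻ y, (f x * J x y + f y * J y x) := by
          refine lintegral_mono fun x => lintegral_mono fun y => ?_
          rcases le_total (f y) (f x) with h | h
          · refine le_add_right ?_
            simp [hJ, h]
          · refine le_add_left ?_
            simp only [hJ, h, if_true]
            rw [← rieszKernel_neg, neg_sub]
            exact le_of_eq (by ring)
      _ = (∫⁻ x, ∫⁻ y, f x * J x y) + ∫⁻ x, ∫⁻ y, f y * J y x := by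
          rw [← lintegral_add_left hfJm.lintegral_prod_right']
          refine lintegral_congr fun x => ?_
          exact lintegral_add_left (hfJm.comp (measurable_const.prodMk measurable_id)) _
      _ ≤ 2 * C + 2 * C := by
          gcongr
          rw [lintegral_lintegral_swap (f := fun x y => f y * J y x) (hfJm.comp measurable_swap).aemeasurable]
          exact hhalf
      _ = _ := by ring
  -- The added one keeps the constant non-zero, so that the right side is `∞` when one norm is
  -- infinite and the other does not vanish.
  refine ⟨4 * C + 1, fun f h hf hh => ?_⟩
  have hzero : ∀ f : Rn d → ℝ≥0∞, Measurable f → lnorm volume q f = 0 → ∀ᵐ x, f x = 0 := by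
    intro f hf h0
    have h1 : ∫⁻ x, f x ^ q = 0 := by
      rw [← lnorm_rpow hq0, h0, ENNReal.zero_rpow_of_pos hq0]
    rw [lintegral_eq_zero_iff (hf.pow_const q)] at h1
    filter_upwards [h1] with x hx
    simpa [hq0, hq0.le, not_lt.2 hq0.le] using hx
  set a := lnorm volume q f with ha
  set b := lnorm volume q h with hb
  rcases eq_or_ne a 0 with ha0 | ha0
  · refine le_of_eq_of_le (lintegral_eq_zero_of_ae_eq_zero ?_) zero_le
    filter_upwards [hzero f hf ha0] with x hx
    simp [hx]
  rcases eq_or_ne b 0 with hb0 | hb0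
  · refine le_of_eq_of_le (lintegral_eq_zero_of_ae_eq_zero ?_) zero_le
    refine Filter.Eventually.of_forall fun x => lintegral_eq_zero_of_ae_eq_zero ?_
    filter_upwards [hzero h hh hb0] with y hy
    simp [hy]
  have hC0 : ((4 * C + 1 : ℝ≥0) : ℝ≥0∞) ≠ 0 := by
    exact_mod_cast (by positivity : (4 * C + 1 : ℝ≥0) ≠ 0)
  rcases eq_or_ne a ∞ with haT | haT
  · rw [haT, ENNReal.top_mul hb0, ENNReal.mul_top hC0]; exact le_top
  rcases eq_or_ne b ∞ with hbT | hbT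
  · rw [hbT, ENNReal.mul_top ha0, ENNReal.mul_top hC0]; exact le_top
  -- The maximum of the normalized functions dominates both and reduces the bilinear bound to the
  -- diagonal one. Its `q`-th power integrates to at most `1 + 1`, hence the bound `2` in the
  -- diagonal estimate.
  set m : Rn d → ℝ≥0∞ := fun x => max (f x / a) (h x / b) with hm
  have hmm : Measurable m := (hf.div_const a).max (hh.div_const b)
  have hnorm : ∀ {f : Rn d → ℝ≥0∞}, lnorm volume q f ≠ 0 → lnorm volume q f ≠ ∞ →
      ∫⁻ x, (f x / lnorm volume q f) ^ q = 1 := by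
    intro f h0 hT
    simp_rw [ENNReal.div_rpow_of_nonneg _ _ hq0.le, div_eq_mul_inv]
    rw [lintegral_mul_const', ← lnorm_rpow hq0]
    · exact ENNReal.mul_inv_cancel (by simpa [hq0, hq0.le, not_lt.2 hq0.le] using h0)
        (ENNReal.rpow_ne_top_of_nonneg hq0.le hT)
    · simpa [hq0, hq0.le, not_lt.2 hq0.le, hT] using h0
  have hmq : ∫⁻ x, m x ^ q ≤ 2 := by
    calc ∫⁻ x, m x ^ q ≤ ∫⁻ x, ((f x / a) ^ q + (h x / b) ^ q) := by
          refine lintegral_mono fun x => ?_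
          rcases le_total (f x / a) (h x / b) with hx | hx
          · simp only [hm, max_eq_right hx]; exact le_add_left le_rfl
          · simp only [hm, max_eq_left hx]; exact le_add_right le_rfl
      _ = 1 + 1 := by
          rw [lintegral_add_left ((hf.div_const a).pow_const q), hnorm ha0 haT, hnorm hb0 hbT]
      _ = 2 := by norm_num
  calc ∫⁻ x, ∫⁻ y, f x * (h y * rieszKernel (d - γ) (x - y))
      ≤ ∫⁻ x, ∫⁻ y, (a * b) * (m x * (m y * rieszKernel (d - γ) (x - y))) := by
        refine lintegral_mono fun x => lintegral_mono fun y => ?_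
        calc f x * (h y * rieszKernel (d - γ) (x - y))
            = (f x / a * a) * ((h y / b * b) * rieszKernel (d - γ) (x - y)) := by
              rw [ENNReal.div_mul_cancel ha0 haT, ENNReal.div_mul_cancel hb0 hbT]
          _ ≤ (m x * a) * ((m y * b) * rieszKernel (d - γ) (x - y)) := by
              gcongr
              · exact le_max_left _ _
              · exact le_max_right _ _
          _ = _ := by ring
    _ = (a * b) * ∫⁻ x, ∫⁻ y, m x * (m y * rieszKernel (d - γ) (x - y)) := by
        simp_rw [lintegral_const_mul' _ _ (ENNReal.mul_ne_top haT hbT)]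
    _ ≤ (a * b) * (4 * C) := by gcongr; exact hdiag m hmm hmq
    _ ≤ _ := by
        rw [mul_comm]
        gcongr
        push_cast
        exact le_self_add

end RieszPotential

end

noncomputable section

set_option linter.unusedSectionVars false

/-! ### Embeddings of modulation spaces and independence of the window. -/

section Embedding

variable {d : ℕ}

/-- The weight `(1 + |ξ|²)^{s/2}`. -/
def japanese (s : ℝ) (ξ : Rn d) : ℝ≥0∞ := ENNReal.ofReal ((1 + ‖ξ‖ ^ 2) ^ (s / 2))

theorem measurable_japanese (s : ℝ) : Measurable (japanese s : Rn d → ℝ≥0∞) := by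
  unfold japanese; fun_prop

theorem japanese_ne_top (s : ℝ) (ξ : Rn d) : japanese s ξ ≠ ∞ := ENNReal.ofReal_ne_top

theorem japanese_zero (ξ : Rn d) : japanese 0 ξ = 1 := by simp [japanese]

theorem one_le_japanese {s : ℝ} (hs : 0 ≤ s) (ξ : Rn d) : 1 ≤ japanese s ξ := by
  rw [japanese, ← ENNReal.ofReal_one]
  refine ENNReal.ofReal_le_ofReal (Real.one_le_rpow ?_ (by positivity))
  nlinarith [sq_nonneg ‖ξ‖]

/-- Peetre's inequality; the constant comes from `1 + |a + b|² ≤ 2 (1 + |a|²)(1 + |b|²)`. -/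
theorem japanese_add_le {s : ℝ} (hs : 0 ≤ s) (a b : Rn d) :
    japanese s (a + b) ≤ ENNReal.ofReal (2 ^ (s / 2)) * (japanese s a * japanese s b) := by
  rw [japanese, japanese, japanese, ← ENNReal.ofReal_mul (by positivity),
    ← ENNReal.ofReal_mul (by positivity), ← Real.mul_rpow (by positivity) (by positivity),
    ← Real.mul_rpow (by positivity) (by positivity)]
  refine ENNReal.ofReal_le_ofReal (Real.rpow_le_rpow (by positivity) ?_ (by positivity))
  have h := norm_add_le a b
  have h2 : ‖a + b‖ ^ 2 ≤ (‖a‖ + ‖b‖) ^ 2 := by gcongr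
  nlinarith [sq_nonneg (‖a‖ - ‖b‖), sq_nonneg (‖a‖ * ‖b‖)]

theorem japanese_mul_decayWeight_le {s : ℝ} (hs : 0 ≤ s) (N : ℕ) (z : Rn d) :
    japanese s z * decayWeight (N + ⌈s⌉₊) z ≤ decayWeight N z := by
  rw [japanese, decayWeight, decayWeight, ← ENNReal.ofReal_mul (by positivity)]
  refine ENNReal.ofReal_le_ofReal ?_
  have h1 : (1 + ‖z‖ ^ 2) ^ (s / 2) ≤ (1 + ‖z‖) ^ s := by
    calc (1 + ‖z‖ ^ 2) ^ (s / 2) ≤ ((1 + ‖z‖) ^ (2 : ℝ)) ^ (s / 2) := by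
          refine Real.rpow_le_rpow (by positivity) ?_ (by positivity)
          rw [Real.rpow_two]; nlinarith [norm_nonneg z]
      _ = _ := by rw [← Real.rpow_mul (by positivity)]; congr 1; ring
  calc _ ≤ (1 + ‖z‖) ^ s * (1 + ‖z‖) ^ (-((N + ⌈s⌉₊ : ℕ) : ℝ)) := by gcongr
    _ = (1 + ‖z‖) ^ (s + -((N + ⌈s⌉₊ : ℕ) : ℝ)) := by rw [← Real.rpow_add (by positivity)]
    _ ≤ _ := by
      refine Real.rpow_le_rpow_of_exponent_le (by linarith [norm_nonneg z]) ?_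
      push_cast
      linarith [Nat.le_ceil s]

theorem decayWeight_le_one (N : ℕ) (z : Rn d) : decayWeight N z ≤ 1 := by
  rw [decayWeight, ← ENNReal.ofReal_one]
  exact ENNReal.ofReal_le_ofReal (Real.rpow_le_one_of_one_le_of_nonpos
    (by linarith [norm_nonneg z]) (by simp))

theorem lintegral_decayWeight_lt_top {N : ℕ} (hN : d < N) :
    ∫⁻ z : Rn d, decayWeight N z < ∞ := by
  have h : Integrable fun z : Rn d => (1 + ‖z‖) ^ (-(N : ℝ)) :=
    integrable_one_add_norm (by simpa using hN)
  exact h.lintegral_lt_top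

theorem japanese_mul_decayWeight_sub_le {s : ℝ} (hs : 0 ≤ s) (N : ℕ) (ξ η : Rn d) :
    japanese s ξ * decayWeight (N + ⌈s⌉₊) (ξ - η) ≤
      ENNReal.ofReal (2 ^ (s / 2)) * (japanese s η * decayWeight N (ξ - η)) := by
  calc japanese s ξ * decayWeight (N + ⌈s⌉₊) (ξ - η)
      = japanese s (η + (ξ - η)) * decayWeight (N + ⌈s⌉₊) (ξ - η) := by rw [add_sub_cancel]
    _ ≤ (ENNReal.ofReal (2 ^ (s / 2)) * (japanese s η * japanese s (ξ - η))) *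
        decayWeight (N + ⌈s⌉₊) (ξ - η) := by gcongr; exact japanese_add_le hs _ _
    _ = ENNReal.ofReal (2 ^ (s / 2)) * (japanese s η * (japanese s (ξ - η) *
        decayWeight (N + ⌈s⌉₊) (ξ - η))) := by ring
    _ ≤ _ := by gcongr; exact japanese_mul_decayWeight_le hs _ _

variable {F : Type} [NormedAddCommGroup F] [NormedSpace ℂ F]

theorem measurable_stft (g : 𝓢(Rn d, ℂ)) (T : 𝓢'(Rn d, F)) :
    Measurable fun z : Rn d × Rn d => ‖stft g T z.1 z.2‖ₑ :=
  (continuous_stft g T).enorm.measurable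

theorem measurable_lnorm_stft (p : ℝ) (g : 𝓢(Rn d, ℂ)) (T : 𝓢'(Rn d, F)) :
    Measurable fun ξ => lnorm volume p fun x => ‖stft g T x ξ‖ₑ := by
  have : Measurable fun ξ => ∫⁻ x, ‖stft g T x ξ‖ₑ ^ p :=
    Measurable.lintegral_prod_left' (f := fun z : Rn d × Rn d => ‖stft g T z.1 z.2‖ₑ ^ p)
      ((measurable_stft g T).pow_const p)
  exact this.pow_const _

theorem modulationNorm_eq {p q : ℝ} (hp : 0 < p) (hq : 0 < q) (s : ℝ) (g : 𝓢(Rn d, ℂ))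
    (T : 𝓢'(Rn d, F)) : modulationNorm g (ENNReal.ofReal p) (ENNReal.ofReal q) s T =
      lnorm volume q fun ξ => japanese s ξ * lnorm volume p fun x => ‖stft g T x ξ‖ₑ := by
  rw [modulationNorm, lnorm_eq_eLpNorm' hq]
  simp_rw [lnorm_eq_eLpNorm hp]
  rfl

theorem decayWeight_ne_top (N : ℕ) (z : Rn d) : decayWeight N z ≠ ∞ := ENNReal.ofReal_ne_top

theorem japanese_mul_lconv_le {s : ℝ} (hs : 0 ≤ s) (N : ℕ) (n : Rn d → ℝ≥0∞) (ξ : Rn d) :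
    japanese s ξ * ∫⁻ η, n η * decayWeight (N + ⌈s⌉₊) (ξ - η) ≤
      ENNReal.ofReal (2 ^ (s / 2)) * ∫⁻ η, (japanese s η * n η) * decayWeight N (ξ - η) := by
  rw [← lintegral_const_mul' _ _ (japanese_ne_top _ _),
    ← lintegral_const_mul' _ _ ENNReal.ofReal_ne_top]
  refine lintegral_mono fun η => ?_
  calc _ = n η * (japanese s ξ * decayWeight (N + ⌈s⌉₊) (ξ - η)) := by ring
    _ ≤ n η * (ENNReal.ofReal (2 ^ (s / 2)) * (japanese s η * decayWeight N (ξ - η))) :=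
        mul_le_mul_right (japanese_mul_decayWeight_sub_le hs N ξ η) _
    _ = _ := by ring

/-- A double convolution with decaying weights, estimated in the first variable. -/
theorem lconv_section_le {A : Rn d × Rn d → ℝ≥0∞} (hA : Measurable A) {N : ℕ}
    {p : ℝ} (hp : 1 ≤ p) (ξ' : Rn d) :
    (∀ x', ∫⁻ x, ∫⁻ ξ, A (x, ξ) * (decayWeight N (x' - x) * decayWeight N (ξ' - ξ)) ≤
      max 1 (∫⁻ z : Rn d, decayWeight N z) *
        ∫⁻ ξ, (lnorm volume p fun x => A (x, ξ)) * decayWeight N (ξ' - ξ)) ∧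
    ∀ r, p ≤ r → lnorm volume r (fun x' => ∫⁻ x, ∫⁻ ξ, A (x, ξ) *
        (decayWeight N (x' - x) * decayWeight N (ξ' - ξ))) ≤
      max 1 (∫⁻ z : Rn d, decayWeight N z) *
        ∫⁻ ξ, (lnorm volume p fun x => A (x, ξ)) * decayWeight N (ξ' - ξ) := by
  have hBm : Measurable (decayWeight N : Rn d → ℝ≥0∞) := measurable_decayWeight N
  have hsec : ∀ ξ, Measurable fun x => A (x, ξ) := fun ξ =>
    hA.comp (measurable_id.prodMk measurable_const)
  have hnm : Measurable fun ξ => lnorm volume p fun x => A (x, ξ) := by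
    have : Measurable fun ξ => ∫⁻ x, A (x, ξ) ^ p :=
      Measurable.lintegral_prod_left' (f := fun z : Rn d × Rn d => A (z.1, z.2) ^ p)
        (hA.pow_const p)
    exact this.pow_const _
  have hint : ∀ x', ∫⁻ x, ∫⁻ ξ, A (x, ξ) * (decayWeight N (x' - x) * decayWeight N (ξ' - ξ)) =
      ∫⁻ ξ, (∫⁻ x, A (x, ξ) * decayWeight N (x' - x)) * decayWeight N (ξ' - ξ) := by
    intro x'
    rw [lintegral_lintegral_swap]
    · refine lintegral_congr fun ξ => ?_
      rw [← lintegral_mul_const' _ _ (decayWeight_ne_top N _)]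
      refine lintegral_congr fun x => ?_
      ring
    · exact (hA.mul ((hBm.comp (measurable_const.sub measurable_fst)).mul
        (hBm.comp (measurable_const.sub measurable_snd)))).aemeasurable
  have hpull : max 1 (∫⁻ z : Rn d, decayWeight N z) *
        ∫⁻ ξ, (lnorm volume p fun x => A (x, ξ)) * decayWeight N (ξ' - ξ) =
      ∫⁻ ξ, (max 1 (∫⁻ z : Rn d, decayWeight N z) * lnorm volume p fun x => A (x, ξ)) *
        decayWeight N (ξ' - ξ) := by
    have hm : Measurable fun ξ => (lnorm volume p fun x => A (x, ξ)) * decayWeight N (ξ' - ξ) :=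
      hnm.mul (hBm.comp (measurable_const.sub measurable_id))
    rw [← lintegral_const_mul _ hm]
    refine lintegral_congr fun ξ => ?_
    ring
  refine ⟨fun x' => ?_, fun r hr => ?_⟩
  · rw [hint, hpull]
    exact lintegral_mono fun ξ => mul_le_mul_left
      (lconv_le hp (hsec ξ) hBm (decayWeight_le_one N) x') _
  · simp_rw [hint]
    rw [hpull]
    have hr0 : 0 < r := by linarith
    refine (lnorm_lintegral_le (hp.trans hr) ?_).trans (lintegral_mono fun ξ => ?_)
    · refine Measurable.mul ?_ (hBm.comp (measurable_const.sub measurable_snd))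
      exact Measurable.lintegral_prod_right' (f := fun w : (Rn d × Rn d) × Rn d =>
        A (w.2, w.1.2) * decayWeight N (w.1.1 - w.2))
        ((hA.comp (measurable_snd.prodMk (measurable_snd.comp measurable_fst))).mul
          (hBm.comp ((measurable_fst.comp measurable_fst).sub measurable_snd)))
    · simp_rw [mul_comm _ (decayWeight N (ξ' - ξ))]
      rw [lnorm_const_mul hr0 (decayWeight_ne_top N _)]
      exact mul_le_mul_right (lnorm_lconv_le hp hr (hsec ξ) hBm (decayWeight_le_one N)) _

/-- Change of window, at fixed frequency. -/
theorem exists_stft_section_le {g : 𝓢(Rn d, ℂ)} (hg : g ≠ 0) (θ : 𝓢(Rn d, ℂ)) {p s : ℝ}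
    (hp : 1 ≤ p) (hs : 0 ≤ s) : ∃ C : ℝ≥0, ∀ {F : Type} [NormedAddCommGroup F] [NormedSpace ℂ F]
      [CompleteSpace F] (T : 𝓢'(Rn d, F)) (ξ' : Rn d),
      (∀ x', japanese s ξ' * ‖stft θ T x' ξ'‖ₑ ≤ C * ∫⁻ ξ, (japanese s ξ * lnorm volume p
        fun x => ‖stft g T x ξ‖ₑ) * decayWeight (d + 1) (ξ' - ξ)) ∧
      ∀ r, p ≤ r → japanese s ξ' * lnorm volume r (fun x' => ‖stft θ T x' ξ'‖ₑ) ≤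
        C * ∫⁻ ξ, (japanese s ξ * lnorm volume p fun x => ‖stft g T x ξ‖ₑ) *
          decayWeight (d + 1) (ξ' - ξ) := by
  -- Decay of order `d + 1` makes the weights integrable; the surplus `⌈s⌉₊` absorbs the frequency
  -- weight of order `s`.
  set N := d + 1 + ⌈s⌉₊ with hN
  obtain ⟨C, hC⟩ := exists_stft_le hg θ N
  set D : ℝ≥0∞ := max 1 (∫⁻ z : Rn d, decayWeight N z) with hD
  have hDT : D ≠ ∞ := (max_lt (by simp) (lintegral_decayWeight_lt_top (by omega))).ne
  refine ⟨C * D.toNNReal * (2 ^ (s / 2) : ℝ).toNNReal, fun {F} _ _ _ T ξ' => ?_⟩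
  obtain ⟨hsup, hnorm⟩ := lconv_section_le (measurable_stft g T) (N := N) hp ξ'
  have hkey : ∀ L : ℝ≥0∞, L ≤ C * (D * ∫⁻ ξ, (lnorm volume p fun x => ‖stft g T x ξ‖ₑ) *
      decayWeight N (ξ' - ξ)) → japanese s ξ' * L ≤
      ((C * D.toNNReal * (2 ^ (s / 2) : ℝ).toNNReal : ℝ≥0) : ℝ≥0∞) *
      ∫⁻ ξ, (japanese s ξ * lnorm volume p fun x => ‖stft g T x ξ‖ₑ) *
          decayWeight (d + 1) (ξ' - ξ) := by
    intro L hL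
    push_cast
    rw [ENNReal.coe_toNNReal hDT, mul_assoc]
    refine (mul_le_mul_right hL _).trans ?_
    rw [← mul_assoc (C : ℝ≥0∞), mul_left_comm]
    exact mul_le_mul_right (japanese_mul_lconv_le hs (d + 1) _ ξ') _
  refine ⟨fun x' => hkey _ ((hC T x' ξ').trans (mul_le_mul_right (hsup x') _)),
    fun r hr => hkey _ ?_⟩
  have hr0 : 0 < r := by linarith
  calc _ ≤ _ := lnorm_mono hr0 fun x' => hC T x' ξ'
    _ = _ := lnorm_const_mul hr0 ENNReal.coe_ne_top _
    _ ≤ _ := mul_le_mul_right (hnorm r hr) _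

/-- Embeddings between modulation spaces, together with independence of the window. -/
theorem exists_modulationNorm_le {g : 𝓢(Rn d, ℂ)} (hg : g ≠ 0) (θ : 𝓢(Rn d, ℂ))
    {p q r q₁ s : ℝ} (hp : 1 ≤ p) (hq : 1 ≤ q) (hpr : p ≤ r) (hqq : q ≤ q₁) (hs : 0 ≤ s) :
    ∃ C : ℝ≥0, ∀ {F : Type} [NormedAddCommGroup F] [NormedSpace ℂ F] [CompleteSpace F]
      (T : 𝓢'(Rn d, F)),
      modulationNorm θ (ENNReal.ofReal r) (ENNReal.ofReal q₁) s T ≤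
        C * modulationNorm g (ENNReal.ofReal p) (ENNReal.ofReal q) s T := by
  obtain ⟨C, hC⟩ := exists_stft_section_le hg θ hp hs
  set D : ℝ≥0∞ := max 1 (∫⁻ z : Rn d, decayWeight (d + 1) z) with hD
  have hDT : D ≠ ∞ := (max_lt (by simp) (lintegral_decayWeight_lt_top (by omega))).ne
  refine ⟨C * D.toNNReal, fun {F} _ _ _ T => ?_⟩
  rw [modulationNorm_eq (by linarith) (by linarith), modulationNorm_eq (by linarith) (by linarith)]
  push_cast
  rw [ENNReal.coe_toNNReal hDT, mul_assoc]
  have hm : Measurable fun ξ => japanese s ξ * lnorm volume p fun x => ‖stft g T x ξ‖ₑ :=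
    (measurable_japanese s).mul (measurable_lnorm_stft p g T)
  calc _ ≤ _ := lnorm_mono (by linarith) fun ξ' => (hC T ξ').2 r hpr
    _ = _ := lnorm_const_mul (by linarith) ENNReal.coe_ne_top _
    _ ≤ _ := by
      gcongr
      exact lnorm_lconv_le hq hqq hm (measurable_decayWeight _) (decayWeight_le_one _)

/-- An uncountable supremum of continuous functions is lower semicontinuous, hence measurable. -/
theorem measurable_iSup_stft (g : 𝓢(Rn d, ℂ)) (T : 𝓢'(Rn d, F)) :
    Measurable fun ξ => ⨆ x, ‖stft g T x ξ‖ₑ :=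
  (lowerSemicontinuous_iSup fun _ => ((continuous_stft g T).comp
    (continuous_const.prodMk continuous_id)).enorm.lowerSemicontinuous).measurable

/-- The modulation spaces with `q = 1` embed into the one with `p = ∞`. -/
theorem exists_lintegral_iSup_stft_le {g : 𝓢(Rn d, ℂ)} (hg : g ≠ 0) (θ : 𝓢(Rn d, ℂ))
    {p s : ℝ} (hp : 1 ≤ p) (hs : 0 ≤ s) :
    ∃ C : ℝ≥0, ∀ {F : Type} [NormedAddCommGroup F] [NormedSpace ℂ F] [CompleteSpace F]
      (T : 𝓢'(Rn d, F)),
      ∫⁻ ξ, japanese s ξ * (⨆ x, ‖stft θ T x ξ‖ₑ) ≤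
        C * modulationNorm g (ENNReal.ofReal p) (ENNReal.ofReal 1) s T := by
  obtain ⟨C, hC⟩ := exists_stft_section_le hg θ hp hs
  set D : ℝ≥0∞ := max 1 (∫⁻ z : Rn d, decayWeight (d + 1) z) with hD
  have hDT : D ≠ ∞ := (max_lt (by simp) (lintegral_decayWeight_lt_top (by omega))).ne
  refine ⟨C * D.toNNReal, fun {F} _ _ _ T => ?_⟩
  rw [modulationNorm_eq (by linarith) (by linarith)]
  push_cast
  rw [ENNReal.coe_toNNReal hDT, mul_assoc, ← lnorm_one]
  have hm : Measurable fun ξ => japanese s ξ * lnorm volume p fun x => ‖stft g T x ξ‖ₑ :=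
    (measurable_japanese s).mul (measurable_lnorm_stft p g T)
  calc _ ≤ _ := lnorm_mono (by linarith) fun ξ' => by
          rw [ENNReal.mul_iSup]
          exact iSup_le fun _ => (hC T ξ').1 _
    _ = _ := lnorm_const_mul (by linarith) ENNReal.coe_ne_top _
    _ ≤ _ := by
      gcongr
      exact lnorm_lconv_le le_rfl le_rfl hm (measurable_decayWeight _) (decayWeight_le_one _)

end Embedding

end

noncomputable section

set_option linter.unusedSectionVars false

/-! ### Tempered distributions given by functions. -/

section FunctionDistribution

variable {d : ℕ} {F G : Type*} [NormedAddCommGroup F] [NormedSpace ℂ F]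
  [NormedAddCommGroup G] [NormedSpace ℂ G]

/-- A smooth compactly supported real function, as a complex Schwartz function. -/
def schwartzOfReal {b : Rn d → ℝ} (hb : ContDiff ℝ (⊤ : ℕ∞) b) (hc : HasCompactSupport b) :
    𝓢(Rn d, ℂ) :=
  HasCompactSupport.toSchwartzMap (f := fun z => (b z : ℂ))
    (hc.comp_left (g := fun t : ℝ => (t : ℂ)) (by simp)) (Complex.ofRealCLM.contDiff.comp hb)

theorem schwartzOfReal_apply {b : Rn d → ℝ} (hb : ContDiff ℝ (⊤ : ℕ∞) b)
    (hc : HasCompactSupport b) (z : Rn d) : schwartzOfReal hb hc z = (b z : ℂ) := rfl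

/-- Pairing with a bump function equal to one on a ball gives integrability on that ball. -/
theorem IsGivenBy.locallyIntegrable {T : 𝓢'(Rn d, F)} {f : Rn d → F} (h : IsGivenBy T f) :
    LocallyIntegrable f := by
  intro z
  let b : ContDiffBump z := ⟨1, 2, by norm_num, by norm_num⟩
  have hi := (h (schwartzOfReal b.contDiff b.hasCompactSupport)).1
  refine ⟨Metric.closedBall z 1, Metric.closedBall_mem_nhds z one_pos, ?_⟩
  refine (hi.integrableOn (s := Metric.closedBall z 1)).congr_fun (fun x hx => ?_)
    Metric.isClosed_closedBall.measurableSet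
  have : b x = 1 := b.one_of_mem_closedBall hx
  simp [schwartzOfReal_apply, this]

theorem IsGivenBy.aestronglyMeasurable {T : 𝓢'(Rn d, F)} {f : Rn d → F} (h : IsGivenBy T f) :
    AEStronglyMeasurable f := h.locallyIntegrable.aestronglyMeasurable

theorem ae_eq_of_forall_schwartz [CompleteSpace F] {f f' : Rn d → F} (hf : LocallyIntegrable f)
    (hf' : LocallyIntegrable f')
    (h : ∀ φ : 𝓢(Rn d, ℂ), ∫ x, φ x • f x = ∫ x, φ x • f' x) : f =ᵐ[volume] f' := by
  refine ae_eq_of_integral_contDiff_smul_eq hf hf' fun b hb hc => ?_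
  have := h (schwartzOfReal hb hc)
  simpa [schwartzOfReal_apply] using this

theorem IsGivenBy.ae_eq [CompleteSpace F] {T : 𝓢'(Rn d, F)} {f f' : Rn d → F}
    (h : IsGivenBy T f) (h' : IsGivenBy T f') : f =ᵐ[volume] f' :=
  ae_eq_of_forall_schwartz h.locallyIntegrable h'.locallyIntegrable
    fun φ => ((h φ).2.symm.trans (h' φ).2)

theorem IsGivenBy.congr {T : 𝓢'(Rn d, F)} {f f' : Rn d → F} (h : IsGivenBy T f)
    (hff : f =ᵐ[volume] f') : IsGivenBy T f' := fun φ => by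
  have he : (fun x => φ x • f x) =ᵐ[volume] fun x => φ x • f' x := by
    filter_upwards [hff] with x hx
    rw [hx]
  exact ⟨(h φ).1.congr he, (h φ).2.trans (integral_congr_ae he)⟩

theorem IsGivenBy.stft_eq {T : 𝓢'(Rn d, F)} {f : Rn d → F} (h : IsGivenBy T f)
    (g : 𝓢(Rn d, ℂ)) (x ξ : Rn d) :
    stft g T x ξ = ∫ y, planeWave ξ y • ((starRingEnd ℂ) (g (y - x)) • f y) := by
  rw [stft, (h _).2]
  refine integral_congr_ae (Filter.Eventually.of_forall fun y => ?_)
  simp only [shiftedWindow_apply', mul_smul]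

theorem IsGivenBy.integrable_window {T : 𝓢'(Rn d, F)} {f : Rn d → F} (h : IsGivenBy T f)
    (g : 𝓢(Rn d, ℂ)) (x : Rn d) : Integrable fun y => (starRingEnd ℂ) (g (y - x)) • f y :=
  (h (schwartzTranslate x (schwartzConj g))).1

/-- Composition of a vector-valued tempered distribution with a linear map. -/
def temperedComp (L : F →L[ℂ] G) (T : 𝓢'(Rn d, F)) : 𝓢'(Rn d, G) :=
  PointwiseConvergenceCLM.postcomp _ L T

theorem temperedComp_apply (L : F →L[ℂ] G) (T : 𝓢'(Rn d, F)) (φ : 𝓢(Rn d, ℂ)) :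
    temperedComp L T φ = L (T φ) := rfl

theorem stft_temperedComp (L : F →L[ℂ] G) (g : 𝓢(Rn d, ℂ)) (T : 𝓢'(Rn d, F)) (x ξ : Rn d) :
    stft g (temperedComp L T) x ξ = L (stft g T x ξ) := rfl

theorem IsGivenBy.temperedComp [CompleteSpace F] [CompleteSpace G] {T : 𝓢'(Rn d, F)}
    {f : Rn d → F} (h : IsGivenBy T f) (L : F →L[ℂ] G) :
    IsGivenBy (temperedComp L T) fun x => L (f x) := fun φ => by
  simp_rw [← map_smul]
  refine ⟨L.integrable_comp (h φ).1, ?_⟩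
  rw [L.integral_comp_comm (h φ).1, temperedComp_apply, (h φ).2]

theorem exists_isGivenBy_of_memLp [CompleteSpace F] {p : ℝ≥0∞} (hp : 1 ≤ p) {f : Rn d → F}
    (hf : MemLp f p) : ∃ T : 𝓢'(Rn d, F), IsGivenBy T f := by
  have : Fact (1 ≤ p) := ⟨hp⟩
  have hq := ENNReal.HolderConjugate.inv_one_sub_inv' hp
  refine ⟨Lp.toTemperedDistribution (hf.toLp f), fun φ => ⟨?_, ?_⟩⟩
  · have h1 := MemLp.smul (r := 1) hf (φ.memLp ((1 - p⁻¹)⁻¹) volume)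
    exact memLp_one_iff_integrable.1 h1
  · rw [Lp.toTemperedDistribution_apply]
    refine integral_congr_ae ?_
    filter_upwards [hf.coeFn_toLp] with x hx
    rw [hx]

end FunctionDistribution

/-! ### The Fourier transform of a product as a convolution. -/

section Product

variable {d : ℕ} {E₁ E₂ F : Type*} [NormedAddCommGroup E₁] [NormedSpace ℂ E₁] [CompleteSpace E₁]
  [NormedAddCommGroup E₂] [NormedSpace ℂ E₂] [CompleteSpace E₂]
  [NormedAddCommGroup F] [NormedSpace ℂ F] [CompleteSpace F]

/-- The Fourier transform of a product is a convolution, when one of the factors is the inverse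
Fourier transform of an integrable function. -/
theorem integral_planeWave_mul_eq (L : E₁ →L[ℂ] E₂ →L[ℂ] F) {A : Rn d → E₁} {b : Rn d → E₂}
    (hA : Integrable A) (hb : Integrable b) (ξ : Rn d) :
    ∫ y, planeWave ξ y • L (∫ η, planeWave (-η) y • A η) (b y) =
      ∫ η, L (A η) (∫ y, planeWave (ξ - η) y • b y) := by
  have hpw : ∀ ξ y : Rn d, ‖planeWave ξ y‖ = 1 := fun ξ y => norm_planeWave ξ y
  have hmeas : AEStronglyMeasurable (fun z : Rn d × Rn d =>
      planeWave (ξ - z.2) z.1 • L (A z.2) (b z.1)) (volume.prod volume) := by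
    refine AEStronglyMeasurable.smul ?_ ?_
    · exact (continuous_planeWave.comp ((continuous_const.sub continuous_snd).prodMk
        continuous_fst)).aestronglyMeasurable
    · exact L.aestronglyMeasurable_comp₂ hA.aestronglyMeasurable.comp_snd
        hb.aestronglyMeasurable.comp_fst
  have hint : Integrable (fun z : Rn d × Rn d =>
      planeWave (ξ - z.2) z.1 • L (A z.2) (b z.1)) (volume.prod volume) := by
    have h1 : Integrable (fun z : Rn d × Rn d => ‖L‖ * (‖b z.1‖ * ‖A z.2‖))
        (volume.prod volume) := (hb.norm.mul_prod hA.norm).const_mul _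
    refine h1.mono' hmeas (Filter.Eventually.of_forall fun z => ?_)
    rw [norm_smul, hpw, one_mul]
    refine (L.le_opNorm₂ _ _).trans (le_of_eq (by ring))
  have hpA : ∀ y : Rn d, Integrable fun η => planeWave (-η) y • A η := fun y => by
    refine (integrable_norm_iff ?_).1 ?_
    · exact (continuous_planeWave.comp (continuous_neg.prodMk
        continuous_const)).aestronglyMeasurable.smul hA.aestronglyMeasurable
    · simpa [norm_smul, hpw] using hA.norm
  have hpb : ∀ ζ : Rn d, Integrable fun y => planeWave ζ y • b y := fun ζ => by
    refine (integrable_norm_iff ?_).1 ?_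
    · exact (continuous_planeWave.comp (continuous_const.prodMk
        continuous_id)).aestronglyMeasurable.smul hb.aestronglyMeasurable
    · simpa [norm_smul, hpw] using hb.norm
  calc ∫ y, planeWave ξ y • L (∫ η, planeWave (-η) y • A η) (b y)
      = ∫ y, ∫ η, planeWave (ξ - η) y • L (A η) (b y) := by
        refine integral_congr_ae (Filter.Eventually.of_forall fun y => ?_)
        change planeWave ξ y • L (∫ η, planeWave (-η) y • A η) (b y) = _
        have h2 := ((L.flip (b y)).integral_comp_comm (hpA y))
        simp only [ContinuousLinearMap.flip_apply] at h2
        rw [← h2, ← integral_smul]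
        refine integral_congr_ae (Filter.Eventually.of_forall fun η => ?_)
        simp only [map_smul, smul_smul, _root_.smul_apply]
        rw [sub_eq_add_neg, planeWave_add]
    _ = ∫ η, ∫ y, planeWave (ξ - η) y • L (A η) (b y) := integral_integral_swap hint
    _ = _ := by
        refine integral_congr_ae (Filter.Eventually.of_forall fun η => ?_)
        have h2 := (L (A η)).integral_comp_comm (hpb (ξ - η))
        simp only [map_smul] at h2
        exact h2

end Product

/-! ### Bounds and measurability for the Coulomb potential. -/

section KernelBound

variable {d : ℕ}

theorem enorm_coulomb (γ : ℝ) (x : Rn d) : ‖coulomb d γ x‖ₑ = rieszKernel γ x := by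
  rw [coulomb, rieszKernel, Real.enorm_of_nonneg (by positivity)]

/-- The potential of a bounded function in `L^p`. -/
theorem exists_lintegral_rieszKernel_mul_le {γ : ℝ} (hγ : 0 < γ) (hγd : γ < d) {p : ℝ}
    (hp1 : 1 < p) (hp : p < d / (d - γ)) : ∃ C : ℝ≥0, ∀ (A : Rn d → ℝ≥0∞) (S : ℝ≥0∞),
      AEMeasurable A → (∀ᵐ y, A y ≤ S) → ∀ x,
      ∫⁻ t, rieszKernel γ t * A (x - t) ≤ C * (S + lnorm volume p A) := by
  have hd : (0 : ℝ) < d := hγ.trans hγd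
  have hpq : p.HolderConjugate (Real.conjExponent p) := Real.HolderConjugate.conjExponent hp1
  set q := Real.conjExponent p with hq
  have hq0 : 0 < q := hpq.symm.pos
  -- The hypothesis `p < d / (d - γ)` says precisely that `γ p' > d`, that is, `|z|^{-γ}` lies in
  -- `L^{p'}` away from the origin.
  have hγq : d < γ * q := by
    rw [hq, Real.conjExponent, ← mul_div_assoc, lt_div_iff₀ (by linarith)]
    rw [lt_div_iff₀ (by linarith)] at hp
    nlinarith
  set c1 := ∫⁻ z in {z : Rn d | ‖z‖ ≤ 1}, rieszKernel γ z with hc1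
  have hc1T : c1 < ∞ := setLIntegral_rieszKernel_near_lt_top (by exact_mod_cast hd) hγd
  set c2 := ∫⁻ z in {z : Rn d | 1 < ‖z‖}, rieszKernel (γ * q) z with hc2
  have hc2T : c2 < ∞ := setLIntegral_rieszKernel_far_lt_top hγq
  have hc2q : c2 ^ (1 / q) ≠ ∞ := ENNReal.rpow_ne_top_of_nonneg (by positivity) hc2T.ne
  refine ⟨c1.toNNReal + (c2 ^ (1 / q)).toNNReal, fun A S hA hAS x => ?_⟩
  have hmn : MeasurableSet {z : Rn d | ‖z‖ ≤ 1} := measurableSet_le measurable_norm measurable_const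
  have hcompl : {z : Rn d | ‖z‖ ≤ 1}ᶜ = {z : Rn d | 1 < ‖z‖} := by ext z; simp
  push_cast
  rw [ENNReal.coe_toNNReal hc1T.ne, ENNReal.coe_toNNReal hc2q, ← lintegral_add_compl _ hmn, hcompl]
  have hqmp : Measure.QuasiMeasurePreserving (fun t : Rn d => x - t) volume volume :=
    (Measure.measurePreserving_sub_left volume x).quasiMeasurePreserving
  have hnear : ∫⁻ t in {z : Rn d | ‖z‖ ≤ 1}, rieszKernel γ t * A (x - t) ≤ c1 * S := by
    rw [hc1, ← lintegral_mul_const _ (measurable_rieszKernel γ)]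
    refine lintegral_mono_ae (ae_restrict_of_ae ?_)
    filter_upwards [hqmp.ae hAS] with t ht
    gcongr
  have hfar : ∫⁻ t in {z : Rn d | 1 < ‖z‖}, rieszKernel γ t * A (x - t) ≤
      c2 ^ (1 / q) * lnorm volume p A := by
    refine (ENNReal.lintegral_mul_le_Lp_mul_Lq _ hpq.symm (measurable_rieszKernel γ).aemeasurable
      (hA.comp_quasiMeasurePreserving hqmp).restrict).trans ?_
    simp_rw [rieszKernel_rpow γ hq0.le]
    refine mul_le_mul' le_rfl ?_
    rw [lnorm]
    have hp0 : 0 < p := by linarith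
    gcongr 1
    refine (setLIntegral_le_lintegral _ _).trans (le_of_eq ?_)
    exact lintegral_sub_left_eq_self (fun y => A y ^ p) x
  calc _ ≤ c1 * S + c2 ^ (1 / q) * lnorm volume p A := add_le_add hnear hfar
    _ ≤ (c1 + c2 ^ (1 / q)) * S + (c1 + c2 ^ (1 / q)) * lnorm volume p A := by
        gcongr
        · exact le_self_add
        · exact le_add_self
    _ = _ := by ring

theorem convolutionExistsAt_coulomb {γ : ℝ} {ρ : Rn d → ℂ} (hρ : AEStronglyMeasurable ρ)
    {x : Rn d} (h : ∫⁻ t, rieszKernel γ t * ‖ρ (x - t)‖ₑ < ∞) :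
    ConvolutionExistsAt (coulomb d γ) ρ x (ContinuousLinearMap.lsmul ℝ ℝ) volume := by
  have hc : Measurable (coulomb d γ) := by unfold coulomb; fun_prop
  have hqmp : Measure.QuasiMeasurePreserving (fun t : Rn d => x - t) volume volume :=
    (Measure.measurePreserving_sub_left volume x).quasiMeasurePreserving
  refine ⟨?_, ?_⟩
  · exact hc.aestronglyMeasurable.smul (hρ.comp_quasiMeasurePreserving hqmp)
  · refine lt_of_le_of_lt (le_of_eq ?_) h
    refine lintegral_congr fun t => ?_
    change ‖coulomb d γ t • ρ (x - t)‖ₑ = _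
    rw [enorm_smul, enorm_coulomb]

theorem aestronglyMeasurable_coulomb_potential (γ : ℝ) {ρ : Rn d → ℂ}
    (hρ : AEStronglyMeasurable ρ) :
    AEStronglyMeasurable fun x => ∫ t, coulomb d γ t • ρ (x - t) := by
  have hc : Measurable (coulomb d γ) := by unfold coulomb; fun_prop
  have hm : AEStronglyMeasurable (fun z : Rn d × Rn d => coulomb d γ z.2 • ρ (z.1 - z.2))
      (volume.prod volume) :=
    (hc.comp measurable_snd).aestronglyMeasurable.smul
      (hρ.comp_quasiMeasurePreserving (quasiMeasurePreserving_sub_of_right_invariant _ _))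
  exact hm.integral_prod_right'

theorem enorm_coulomb_potential_le (γ : ℝ) (ρ : Rn d → ℂ) (x : Rn d) :
    ‖∫ t, coulomb d γ t • ρ (x - t)‖ₑ ≤ ∫⁻ t, rieszKernel γ t * ‖ρ (x - t)‖ₑ := by
  refine (enorm_integral_le_lintegral_enorm _).trans (lintegral_mono fun t => le_of_eq ?_)
  rw [enorm_smul, enorm_coulomb]

end KernelBound

end

noncomputable section

set_option linter.unusedSectionVars false

/-! ### Convolution in weighted `L¹` of the frequency. -/

section WeightedYoung

variable {d : ℕ}

theorem japanese_neg (s : ℝ) (ξ : Rn d) : japanese s (-ξ) = japanese s ξ := by simp [japanese]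

theorem lnorm_const_mul_of_measurable {α : Type*} [MeasurableSpace α] {μ : Measure α} {p : ℝ}
    (hp : 0 < p) (c : ℝ≥0∞) {f : α → ℝ≥0∞} (hf : Measurable f) :
    lnorm μ p (fun x => c * f x) = c * lnorm μ p f := by
  unfold lnorm
  simp_rw [ENNReal.mul_rpow_of_nonneg _ _ hp.le]
  rw [lintegral_const_mul _ (hf.pow_const p),
    ENNReal.mul_rpow_of_nonneg _ _ (by positivity), ← ENNReal.rpow_mul, mul_one_div_cancel hp.ne',
    ENNReal.rpow_one]

theorem lintegral_japanese_conv_le {s : ℝ} (hs : 0 ≤ s) {a b : Rn d → ℝ≥0∞} (ha : Measurable a)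
    (hb : Measurable b) :
    ∫⁻ ξ, japanese s ξ * ∫⁻ η, a η * b (ξ - η) ≤ ENNReal.ofReal (2 ^ (s / 2)) *
      ((∫⁻ η, japanese s η * a η) * ∫⁻ η, japanese s η * b η) := by
  have hJ := measurable_japanese (d := d) s
  have hm : Measurable fun z : Rn d × Rn d =>
      (japanese s z.2 * a z.2) * (japanese s (z.1 - z.2) * b (z.1 - z.2)) :=
    ((hJ.mul ha).comp measurable_snd).mul ((hJ.mul hb).comp (measurable_fst.sub measurable_snd))
  calc ∫⁻ ξ, japanese s ξ * ∫⁻ η, a η * b (ξ - η)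
      ≤ ∫⁻ ξ, ENNReal.ofReal (2 ^ (s / 2)) * ∫⁻ η, (japanese s η * a η) *
        (japanese s (ξ - η) * b (ξ - η)) := by
        refine lintegral_mono fun ξ => ?_
        rw [← lintegral_const_mul' _ _ (japanese_ne_top _ _),
          ← lintegral_const_mul' _ _ ENNReal.ofReal_ne_top]
        refine lintegral_mono fun η => ?_
        calc japanese s ξ * (a η * b (ξ - η))
            = japanese s (η + (ξ - η)) * (a η * b (ξ - η)) := by rw [add_sub_cancel]
          _ ≤ (ENNReal.ofReal (2 ^ (s / 2)) * (japanese s η * japanese s (ξ - η))) *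
              (a η * b (ξ - η)) := mul_le_mul_left (japanese_add_le hs _ _) _
          _ = _ := by ring
    _ = ENNReal.ofReal (2 ^ (s / 2)) * ∫⁻ ξ, ∫⁻ η, (japanese s η * a η) *
        (japanese s (ξ - η) * b (ξ - η)) := lintegral_const_mul' _ _ ENNReal.ofReal_ne_top
    _ = _ := by
        congr 1
        have hJa : Measurable fun η => japanese s η * a η := hJ.mul ha
        rw [lintegral_lintegral_swap hm.aemeasurable, ← lintegral_mul_const _ hJa]
        refine lintegral_congr fun η => ?_
        have h1 : Measurable fun ξ => japanese s (ξ - η) * b (ξ - η) :=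
          (hJ.mul hb).comp (measurable_id.sub measurable_const)
        rw [lintegral_const_mul _ h1,
          lintegral_sub_right_eq_self (fun ξ => japanese s ξ * b ξ) η]

/-- A correlation is a convolution with the reflected second function, and the weight is even. -/
theorem lintegral_japanese_correlation_le {s : ℝ} (hs : 0 ≤ s) {a b : Rn d → ℝ≥0∞}
    (ha : Measurable a) (hb : Measurable b) :
    ∫⁻ ζ, japanese s ζ * ∫⁻ η, a η * b (η - ζ) ≤ ENNReal.ofReal (2 ^ (s / 2)) *
      ((∫⁻ η, japanese s η * a η) * ∫⁻ η, japanese s η * b η) := by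
  have h := lintegral_japanese_conv_le hs ha (hb.comp measurable_neg)
  have e : ∫⁻ η : Rn d, japanese s η * (b ∘ Neg.neg) η = ∫⁻ η, japanese s η * b η := by
    rw [← lintegral_neg_eq_self (fun η => japanese s η * b η)]
    refine lintegral_congr fun η => ?_
    rw [japanese_neg]; rfl
  rw [e] at h
  simpa only [Function.comp_apply, neg_sub] using h

end WeightedYoung

/-! ### Distributions in `M^{p,1}` as bounded functions in `L^p`. -/

section Synthesis

variable {d : ℕ} {F : Type} [NormedAddCommGroup F] [NormedSpace ℂ F] [CompleteSpace F]

/-- The function reconstructed from an integrable short-time Fourier transform. -/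
def stftSynthesis (g : 𝓢(Rn d, ℂ)) (T : 𝓢'(Rn d, F)) (y : Rn d) : F :=
  ((2 * Real.pi : ℂ) ^ d * ((∫ y, ‖g y‖ ^ 2 : ℝ) : ℂ))⁻¹ •
    ∫ z : Rn d × Rn d, (planeWave (-z.2) y * g (y - z.1)) • stft g T z.1 z.2

theorem continuous_synthesis_kernel (g : 𝓢(Rn d, ℂ)) (T : 𝓢'(Rn d, F)) :
    Continuous fun w : Rn d × (Rn d × Rn d) =>
      (planeWave (-w.2.2) w.1 * g (w.1 - w.2.1)) • stft g T w.2.1 w.2.2 := by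
  have h1 : Continuous fun w : Rn d × (Rn d × Rn d) => planeWave (-w.2.2) w.1 :=
    continuous_planeWave.comp (by fun_prop : Continuous fun w : Rn d × (Rn d × Rn d) =>
      ((-w.2.2, w.1) : Rn d × Rn d))
  have h2 : Continuous fun w : Rn d × (Rn d × Rn d) => g (w.1 - w.2.1) :=
    g.continuous.comp (by fun_prop)
  exact (h1.mul h2).smul ((continuous_stft g T).comp continuous_snd)

theorem enorm_planeWave (ξ y : Rn d) : ‖planeWave ξ y‖ₑ = 1 := by
  rw [← ofReal_norm, norm_planeWave, ENNReal.ofReal_one]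

theorem isGivenBy_stftSynthesis {g : 𝓢(Rn d, ℂ)} (hg : g ≠ 0) {T : 𝓢'(Rn d, F)}
    (hT : ∫⁻ ξ, (⨆ x, ‖stft g T x ξ‖ₑ) < ∞) : IsGivenBy T (stftSynthesis g T) := by
  intro φ
  set c : ℂ := (2 * Real.pi : ℂ) ^ d * ((∫ y, ‖g y‖ ^ 2 : ℝ) : ℂ) with hc
  have hc0 : c ≠ 0 := by
    refine mul_ne_zero (pow_ne_zero _ ?_) (by exact_mod_cast (integral_norm_sq_pos hg).ne')
    exact_mod_cast (by positivity : (2 * Real.pi : ℝ) ≠ 0)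
  set Θ : Rn d × (Rn d × Rn d) → F := fun w =>
    φ w.1 • ((planeWave (-w.2.2) w.1 * g (w.1 - w.2.1)) • stft g T w.2.1 w.2.2) with hΘ
  have hΘc : Continuous Θ :=
    (φ.continuous.comp continuous_fst).smul (continuous_synthesis_kernel g T)
  have hNm := measurable_iSup_stft g T
  have hgm : Measurable fun y => ‖g y‖ₑ := g.continuous.enorm.measurable
  -- Each variable has its own integrable factor: `φ` in `y`, the translated window in `x`, the
  -- supremum of `V_g T` over space in `ξ`. No integrability of `V_g T` in `x` is required.
  have hΘi : Integrable Θ (volume.prod (volume.prod volume)) := by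
    refine ⟨hΘc.aestronglyMeasurable, ?_⟩
    have hb : ∀ w, ‖Θ w‖ₑ ≤ ‖φ w.1‖ₑ * (‖g (w.1 - w.2.1)‖ₑ * ⨆ x, ‖stft g T x w.2.2‖ₑ) := by
      intro w
      rw [hΘ, enorm_smul, enorm_smul, enorm_mul, enorm_planeWave, one_mul]
      gcongr
      exact le_iSup (fun x => ‖stft g T x w.2.2‖ₑ) w.2.1
    refine lt_of_le_of_lt (lintegral_mono hb) ?_
    have hφm : Measurable fun y => ‖φ y‖ₑ := φ.continuous.enorm.measurable
    have hm : Measurable fun w : Rn d × (Rn d × Rn d) =>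
        ‖φ w.1‖ₑ * (‖g (w.1 - w.2.1)‖ₑ * ⨆ x, ‖stft g T x w.2.2‖ₑ) :=
      (hφm.comp measurable_fst).mul
        ((hgm.comp (measurable_fst.sub (measurable_fst.comp measurable_snd))).mul
          (hNm.comp (measurable_snd.comp measurable_snd)))
    rw [lintegral_prod _ hm.aemeasurable]
    have h1 : ∀ y : Rn d, ∫⁻ z : Rn d × Rn d, ‖φ y‖ₑ * (‖g (y - z.1)‖ₑ *
        ⨆ x, ‖stft g T x z.2‖ₑ) ∂(volume.prod volume) =
        ‖φ y‖ₑ * ((∫⁻ x, ‖g x‖ₑ) * ∫⁻ ξ, (⨆ x, ‖stft g T x ξ‖ₑ)) := by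
      intro y
      have hgy : Measurable fun x => ‖g (y - x)‖ₑ := hgm.comp (measurable_const.sub measurable_id)
      rw [lintegral_const_mul' _ _ enorm_ne_top,
        lintegral_prod_mul hgy.aemeasurable hNm.aemeasurable,
        lintegral_sub_left_eq_self (fun x => ‖g x‖ₑ) y]
    simp only [h1]
    rw [lintegral_mul_const _ hφm]
    exact ENNReal.mul_lt_top φ.integrable.2 (ENNReal.mul_lt_top g.integrable.2 hT)
  have hsyn : ∀ y, φ y • stftSynthesis g T y = c⁻¹ • ∫ z, Θ (y, z) ∂(volume.prod volume) := by
    intro y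
    rw [stftSynthesis, smul_comm, ← integral_smul]
    rfl
  refine ⟨?_, ?_⟩
  · simp_rw [hsyn]
    exact hΘi.integral_prod_left.smul _
  · simp_rw [hsyn]
    rw [integral_smul, integral_integral_swap (f := fun y z => Θ (y, z)) hΘi, eq_inv_smul_iff₀ hc0,
      hc, tempered_inversion T g φ]
    have h2 : Integrable (fun z : Rn d × Rn d => ∫ y, Θ (y, z)) (volume.prod volume) :=
      hΘi.integral_prod_right
    rw [integral_prod _ h2]
    refine integral_congr_ae (Filter.Eventually.of_forall fun x => integral_congr_ae
      (Filter.Eventually.of_forall fun ξ => ?_))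
    simp only [hΘ, dualStft_apply]
    rw [← integral_smul_const]
    refine integral_congr_ae (Filter.Eventually.of_forall fun y => ?_)
    simp only [smul_smul]
    congr 1
    ring

theorem exists_enorm_le_decayWeight (g : 𝓢(Rn d, ℂ)) (N : ℕ) : ∃ C : ℝ≥0, ∀ y,
    ‖g y‖ₑ ≤ C * decayWeight N y := by
  have h := fun y => SchwartzMap.one_add_le_sup_seminorm_apply (𝕜 := ℂ) (m := (N, 0)) (k := N)
    (n := 0) le_rfl le_rfl g y
  simp only [norm_iteratedFDeriv_zero] at h
  set C := 2 ^ N * ((Finset.Iic (N, 0)).sup fun m => SchwartzMap.seminorm ℂ m.1 m.2) g with hC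
  have hC0 : 0 ≤ C := by positivity
  refine ⟨C.toNNReal, fun y => ?_⟩
  rw [← ofReal_norm, decayWeight]
  change _ ≤ ENNReal.ofReal C * _
  rw [← ENNReal.ofReal_mul hC0]
  refine ENNReal.ofReal_le_ofReal ?_
  have hy : 0 < 1 + ‖y‖ := by positivity
  rw [Real.rpow_neg hy.le, Real.rpow_natCast, ← div_eq_mul_inv, le_div_iff₀ (by positivity),
    mul_comm]
  exact h y

theorem enorm_stftSynthesis_le {g : 𝓢(Rn d, ℂ)} {C : ℝ≥0} {N : ℕ}
    (hC : ∀ y, ‖g y‖ₑ ≤ C * decayWeight N y) (T : 𝓢'(Rn d, F)) (y : Rn d) :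
    ‖stftSynthesis g T y‖ₑ ≤ (‖((2 * Real.pi : ℂ) ^ d * ((∫ y, ‖g y‖ ^ 2 : ℝ) : ℂ))⁻¹‖ₑ * C) *
      ∫⁻ ξ, ∫⁻ x, ‖stft g T x ξ‖ₑ * decayWeight N (y - x) := by
  have hkm : Measurable fun z : Rn d × Rn d => ‖stft g T z.1 z.2‖ₑ * decayWeight N (y - z.1) :=
    (measurable_stft g T).mul ((measurable_decayWeight N).comp
      (measurable_const.sub measurable_fst))
  rw [stftSynthesis, enorm_smul, mul_assoc]
  refine mul_le_mul_right ?_ _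
  refine (enorm_integral_le_lintegral_enorm _).trans ?_
  have h1 : ∫⁻ ξ, ∫⁻ x, ‖stft g T x ξ‖ₑ * decayWeight N (y - x) =
      ∫⁻ z : Rn d × Rn d, ‖stft g T z.1 z.2‖ₑ * decayWeight N (y - z.1) :=
    (lintegral_prod_symm _ hkm.aemeasurable).symm
  rw [h1, ← lintegral_const_mul' _ _ ENNReal.coe_ne_top]
  refine lintegral_mono fun z => ?_
  rw [enorm_smul, enorm_mul, enorm_planeWave, one_mul]
  calc _ ≤ (C * decayWeight N (y - z.1)) * ‖stft g T z.1 z.2‖ₑ := mul_le_mul_left (hC _) _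
    _ = _ := by ring

theorem lintegral_lintegral_stft_le_iSup (g : 𝓢(Rn d, ℂ)) (T : 𝓢'(Rn d, F)) (N : ℕ) (y : Rn d) :
    ∫⁻ ξ, ∫⁻ x, ‖stft g T x ξ‖ₑ * decayWeight N (y - x) ≤
      max 1 (∫⁻ z : Rn d, decayWeight N z) * ∫⁻ ξ, (⨆ x, ‖stft g T x ξ‖ₑ) := by
  rw [← lintegral_const_mul _ (measurable_iSup_stft g T)]
  refine lintegral_mono fun ξ => ?_
  calc ∫⁻ x, ‖stft g T x ξ‖ₑ * decayWeight N (y - x)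
      ≤ ∫⁻ x, (⨆ x, ‖stft g T x ξ‖ₑ) * decayWeight N (y - x) :=
        lintegral_mono fun x => mul_le_mul_left (le_iSup (fun x => ‖stft g T x ξ‖ₑ) x) _
    _ = (⨆ x, ‖stft g T x ξ‖ₑ) * ∫⁻ z : Rn d, decayWeight N z := by
        have hm : Measurable fun x => (decayWeight N (y - x) : ℝ≥0∞) :=
          (measurable_decayWeight N).comp (measurable_const.sub measurable_id)
        rw [lintegral_const_mul _ hm, lintegral_sub_left_eq_self (decayWeight N) y]
    _ ≤ _ := by
        rw [mul_comm]
        exact mul_le_mul_left (le_max_right _ _) _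

theorem lnorm_lintegral_lconv_le {A : Rn d × Rn d → ℝ≥0∞} (hA : Measurable A) {B : Rn d → ℝ≥0∞}
    (hB : Measurable B) (hB1 : ∀ x, B x ≤ 1) {p : ℝ} (hp : 1 ≤ p) :
    lnorm volume p (fun y => ∫⁻ ξ, ∫⁻ x, A (x, ξ) * B (y - x)) ≤
      max 1 (∫⁻ z : Rn d, B z) * ∫⁻ ξ, lnorm volume p fun x => A (x, ξ) := by
  have hm : Measurable fun w : (Rn d × Rn d) × Rn d => A (w.2, w.1.2) * B (w.1.1 - w.2) :=
    (hA.comp (measurable_snd.prodMk (measurable_snd.comp measurable_fst))).mul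
      (hB.comp ((measurable_fst.comp measurable_fst).sub measurable_snd))
  have huc : Measurable (Function.uncurry fun y ξ : Rn d => ∫⁻ x, A (x, ξ) * B (y - x)) :=
    Measurable.lintegral_prod_right' hm
  have hnm : Measurable fun ξ => lnorm volume p fun x => A (x, ξ) := by
    have : Measurable fun ξ => ∫⁻ x, A (x, ξ) ^ p :=
      Measurable.lintegral_prod_left' (f := fun z : Rn d × Rn d => A (z.1, z.2) ^ p)
        (hA.pow_const p)
    exact this.pow_const _
  rw [← lintegral_const_mul _ hnm]
  refine (lnorm_lintegral_le hp huc).trans (lintegral_mono fun ξ => ?_)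
  have hsec : Measurable fun x => A (x, ξ) := hA.comp (measurable_id.prodMk measurable_const)
  exact lnorm_lconv_le hp le_rfl hsec hB hB1

/-- The distributions in `M^{p,1}` are functions in `L^p ∩ L^∞`. -/
theorem exists_stftSynthesis_le (g : 𝓢(Rn d, ℂ)) {p : ℝ} (hp : 1 ≤ p) :
    ∃ C : ℝ≥0, ∀ {F : Type} [NormedAddCommGroup F] [NormedSpace ℂ F] [CompleteSpace F]
      (T : 𝓢'(Rn d, F)),
      (∀ y, ‖stftSynthesis g T y‖ₑ ≤ C * ∫⁻ ξ, (⨆ x, ‖stft g T x ξ‖ₑ)) ∧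
      lnorm volume p (fun y => ‖stftSynthesis g T y‖ₑ) ≤
        C * ∫⁻ ξ, lnorm volume p fun x => ‖stft g T x ξ‖ₑ := by
  obtain ⟨C, hC⟩ := exists_enorm_le_decayWeight g (d + 1)
  have hDT : max 1 (∫⁻ z : Rn d, decayWeight (d + 1) z) ≠ ∞ :=
    (max_lt (by simp) (lintegral_decayWeight_lt_top (by omega))).ne
  set c : ℂ := ((2 * Real.pi : ℂ) ^ d * ((∫ y, ‖g y‖ ^ 2 : ℝ) : ℂ))⁻¹ with hc
  have hp0 : 0 < p := by linarith
  refine ⟨‖c‖₊ * C * (max 1 (∫⁻ z : Rn d, decayWeight (d + 1) z)).toNNReal,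
    fun {F} _ _ _ T => ?_⟩
  rw [ENNReal.coe_mul, ENNReal.coe_mul, ENNReal.coe_toNNReal hDT, ← enorm_eq_nnnorm,
    mul_assoc (‖c‖ₑ * (C : ℝ≥0∞)), mul_assoc (‖c‖ₑ * (C : ℝ≥0∞))]
  refine ⟨fun y => ?_, ?_⟩
  · refine (enorm_stftSynthesis_le hC T y).trans ?_
    exact mul_le_mul_right (lintegral_lintegral_stft_le_iSup g T (d + 1) y) _
  · refine (lnorm_mono hp0 (enorm_stftSynthesis_le hC T)).trans ?_
    rw [lnorm_const_mul hp0 (ENNReal.mul_ne_top enorm_ne_top ENNReal.coe_ne_top)]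
    exact mul_le_mul_right (lnorm_lintegral_lconv_le (measurable_stft g T) (measurable_decayWeight _)
      (decayWeight_le_one _) hp) _

/-- A windowed distribution is the inverse Fourier transform of its short-time Fourier
transform. -/
theorem IsGivenBy.window_ae_eq {T : 𝓢'(Rn d, F)} {f : Rn d → F} (h : IsGivenBy T f)
    (g : 𝓢(Rn d, ℂ)) (x : Rn d) (hV : Integrable fun ξ => stft g T x ξ) :
    (fun y => (starRingEnd ℂ) (g (y - x)) • f y) =ᵐ[volume] fun y =>
      ((2 * Real.pi : ℂ) ^ d)⁻¹ • ∫ ξ, planeWave (-ξ) y • stft g T x ξ := by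
  have hc0 : ((2 * Real.pi : ℂ) ^ d) ≠ 0 := by
    refine pow_ne_zero _ ?_
    exact_mod_cast (by positivity : (2 * Real.pi : ℝ) ≠ 0)
  have hcont : Continuous fun y => ∫ ξ, planeWave (-ξ) y • stft g T x ξ := by
    refine continuous_of_dominated (bound := fun ξ => ‖stft g T x ξ‖) (fun y => ?_) (fun y => ?_)
      hV.norm (Filter.Eventually.of_forall fun ξ => ?_)
    · exact (continuous_planeWave.comp (continuous_neg.prodMk
        continuous_const)).aestronglyMeasurable.smul hV.aestronglyMeasurable
    · exact Filter.Eventually.of_forall fun ξ => by rw [norm_smul, norm_planeWave, one_mul]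
    · exact (continuous_planeWave.comp (continuous_const.prodMk continuous_id)).smul
        continuous_const
  refine ae_eq_of_forall_schwartz (h.integrable_window g x).locallyIntegrable
    (hcont.const_smul _).locallyIntegrable fun φ => ?_
  -- Both sides have the same pairing with each Schwartz function, by Fourier inversion under `T`;
  -- this determines them almost everywhere.
  have h1 := (tempered_schwartzMul T (schwartzTranslate x (schwartzConj g)) φ).2
  rw [(h _).2] at h1
  have h2 : ∫ y, φ y • ((starRingEnd ℂ) (g (y - x)) • f y) =
      ∫ y, schwartzMul (schwartzTranslate x (schwartzConj g)) φ y • f y := by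
    refine integral_congr_ae (Filter.Eventually.of_forall fun y => ?_)
    simp only [schwartzMul_apply, schwartzTranslate_apply, schwartzConj_apply, smul_smul]
    rw [mul_comm]
  have hint : Integrable (fun z : Rn d × Rn d => φ z.1 • (planeWave (-z.2) z.1 • stft g T x z.2))
      (volume.prod volume) := by
    have h3 : Integrable (fun z : Rn d × Rn d => ‖φ z.1‖ * ‖stft g T x z.2‖)
      (volume.prod volume) := φ.integrable.norm.mul_prod hV.norm
    refine h3.mono' ?_ (Filter.Eventually.of_forall fun z => ?_)
    · exact (φ.continuous.comp continuous_fst).aestronglyMeasurable.smul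
        ((continuous_planeWave.comp ((continuous_neg.comp continuous_snd).prodMk
          continuous_fst)).aestronglyMeasurable.smul hV.aestronglyMeasurable.comp_snd)
    · rw [norm_smul, norm_smul, norm_planeWave, one_mul]
  have h4 : ∫ y, φ y • (((2 * Real.pi : ℂ) ^ d)⁻¹ • ∫ ξ, planeWave (-ξ) y • stft g T x ξ) =
      ((2 * Real.pi : ℂ) ^ d)⁻¹ • ∫ y, ∫ ξ, φ y • (planeWave (-ξ) y • stft g T x ξ) := by
    rw [← integral_smul]
    refine integral_congr_ae (Filter.Eventually.of_forall fun y => ?_)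
    simp only [integral_smul]
    rw [smul_comm]
  rw [h2, h4, eq_inv_smul_iff₀ hc0, h1, integral_integral_swap hint]
  refine integral_congr_ae (Filter.Eventually.of_forall fun ξ => ?_)
  simp only []
  rw [waveTransform_apply, ← integral_smul_const]
  refine integral_congr_ae (Filter.Eventually.of_forall fun y => ?_)
  simp only [smul_smul]
  congr 1
  ring

end Synthesis

end

noncomputable section

set_option linter.unusedSectionVars false

/-! ### Windowed Fourier transforms of densities, potentials and products. -/

section WindowedProducts

variable {d : ℕ} {E : Type} [NormedAddCommGroup E] [InnerProductSpace ℂ E] [CompleteSpace E]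

/-- The inner product is conjugate-linear in its first slot, which reverses the frequency. This is
why densities lead to correlations and not to convolutions. -/
theorem integral_planeWave_smul_innerSL {v : Rn d → E} (hv : Integrable v) (ζ : Rn d) :
    ∫ y, planeWave ζ y • innerSL ℂ (v y) = innerSL ℂ (∫ y, planeWave (-ζ) y • v y) := by
  have hpb : ∀ ζ : Rn d, AEStronglyMeasurable (planeWave ζ) volume := fun ζ =>
    (continuous_planeWave.comp (continuous_const.prodMk
        continuous_id)).aestronglyMeasurable
  have h1 : Integrable fun y => planeWave ζ y • innerSL ℂ (v y) := by
    refine hv.norm.mono' ((hpb ζ).smul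
      ((innerSL ℂ).continuous.comp_aestronglyMeasurable hv.aestronglyMeasurable))
      (Filter.Eventually.of_forall fun y => ?_)
    rw [norm_smul, norm_planeWave, one_mul, innerSL_apply_norm]
  have h2 : Integrable fun y => planeWave (-ζ) y • v y := by
    refine hv.norm.mono' ((hpb _).smul hv.aestronglyMeasurable)
      (Filter.Eventually.of_forall fun y => ?_)
    rw [norm_smul, norm_planeWave, one_mul]
  ext w
  rw [ContinuousLinearMap.integral_apply h1, innerSL_apply_apply, ← inner_conj_symm,
    ← integral_inner h2, ← integral_conj]
  refine integral_congr_ae (Filter.Eventually.of_forall fun y => ?_)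
  simp only [_root_.smul_apply, innerSL_apply_apply, inner_smul_right, map_mul, inner_conj_symm,
    smul_eq_mul, planeWave_neg, Complex.conj_conj]

/-- The short-time Fourier transform of the density `⟨f₁, f₂⟩`, with window `|g|²`. -/
theorem enorm_window_inner_le {T₁ T₂ : 𝓢'(Rn d, E)} {f₁ f₂ : Rn d → E} (h₁ : IsGivenBy T₁ f₁)
    (h₂ : IsGivenBy T₂ f₂) (g : 𝓢(Rn d, ℂ)) (x : Rn d) (hV : Integrable fun ξ => stft g T₁ x ξ)
    (ζ : Rn d) :
    ‖∫ y, planeWave ζ y • (((‖g (y - x)‖ ^ 2 : ℝ) : ℂ) * inner ℂ (f₂ y) (f₁ y))‖ₑ ≤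
      ‖((2 * Real.pi : ℂ) ^ d)⁻¹‖ₑ *
        ∫⁻ η, ‖stft g T₁ x η‖ₑ * ‖stft g T₂ x (η - ζ)‖ₑ := by
  set κ := ((2 * Real.pi : ℂ) ^ d)⁻¹ with hκ
  -- The second factor is carried as an element of the dual, so that the pairing with the first is
  -- bilinear.
  let L : E →L[ℂ] (E →L[ℂ] ℂ) →L[ℂ] ℂ := ContinuousLinearMap.apply ℂ ℂ
  set v : Rn d → E := fun y => (starRingEnd ℂ) (g (y - x)) • f₂ y with hv
  have hvi : Integrable v := h₂.integrable_window g x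
  set b : Rn d → (E →L[ℂ] ℂ) := fun y => innerSL ℂ (v y) with hb
  have hbi : Integrable b := by
    refine hvi.norm.mono'
      ((innerSL ℂ).continuous.comp_aestronglyMeasurable hvi.aestronglyMeasurable)
      (Filter.Eventually.of_forall fun y => ?_)
    rw [hb, innerSL_apply_norm]
  have e1 : ∫ y, planeWave ζ y • (((‖g (y - x)‖ ^ 2 : ℝ) : ℂ) * inner ℂ (f₂ y) (f₁ y)) =
      κ • ∫ y, planeWave ζ y • L (∫ η, planeWave (-η) y • stft g T₁ x η) (b y) := by
    rw [← integral_smul]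
    refine integral_congr_ae ?_
    filter_upwards [h₁.window_ae_eq g x hV] with y hy
    have hL : κ • L (∫ η, planeWave (-η) y • stft g T₁ x η) (b y) =
        L ((starRingEnd ℂ) (g (y - x)) • f₁ y) (b y) := by
      rw [hy, map_smul]; rfl
    rw [smul_comm κ (planeWave ζ y), hL]
    congr 1
    change _ = inner ℂ ((starRingEnd ℂ) (g (y - x)) • f₂ y) ((starRingEnd ℂ) (g (y - x)) • f₁ y)
    rw [inner_smul_left, inner_smul_right, Complex.conj_conj, ← mul_assoc, Complex.mul_conj']
    push_cast
    rfl
  rw [e1, enorm_smul, integral_planeWave_mul_eq L hV hbi]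
  refine mul_le_mul_right ((enorm_integral_le_lintegral_enorm _).trans
    (lintegral_mono fun η => ?_)) _
  rw [hb, integral_planeWave_smul_innerSL hvi, neg_sub, ← h₂.stft_eq g x (η - ζ)]
  change ‖inner ℂ (stft g T₂ x (η - ζ)) (stft g T₁ x η)‖ₑ ≤ _
  rw [← ofReal_norm, ← ofReal_norm, ← ofReal_norm, ← ENNReal.ofReal_mul (norm_nonneg _), mul_comm]
  exact ENNReal.ofReal_le_ofReal (norm_inner_le_norm _ _)

/-- The windowed Fourier transform commutes with convolution by a potential. -/
theorem enorm_window_convolution_le {ρ : Rn d → ℂ} (hρ : AEStronglyMeasurable ρ) {γ : ℝ}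
    {S : ℝ≥0∞} (hS : S ≠ ∞) (hρS : ∀ x, ∫⁻ t, rieszKernel γ t * ‖ρ (x - t)‖ₑ ≤ S)
    (g : 𝓢(Rn d, ℂ)) (x ζ : Rn d) :
    ‖∫ y, planeWave ζ y • (((‖g (y - x)‖ ^ 2 : ℝ) : ℂ) * ∫ t, coulomb d γ t • ρ (y - t))‖ₑ ≤
      ∫⁻ t, rieszKernel γ t *
        ‖∫ y, planeWave ζ y • (((‖g (y - (x - t))‖ ^ 2 : ℝ) : ℂ) * ρ y)‖ₑ := by
  have hc : Measurable (coulomb d γ) := by unfold coulomb; fun_prop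
  set Θ : Rn d × Rn d → ℂ := fun z =>
    planeWave ζ z.1 • (((‖g (z.1 - x)‖ ^ 2 : ℝ) : ℂ) * (coulomb d γ z.2 • ρ (z.1 - z.2))) with hΘ
  have hgc : Continuous fun y => ((‖g (y - x)‖ ^ 2 : ℝ) : ℂ) := by fun_prop
  have hpw : Continuous (planeWave ζ) :=
    continuous_planeWave.comp (continuous_const.prodMk continuous_id)
  have hΘm : AEStronglyMeasurable Θ (volume.prod volume) := by
    refine (hpw.comp continuous_fst).aestronglyMeasurable.smul
      ((hgc.comp continuous_fst).aestronglyMeasurable.mul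
      ((hc.comp measurable_snd).aestronglyMeasurable.smul ?_))
    exact hρ.comp_quasiMeasurePreserving (quasiMeasurePreserving_sub_of_right_invariant _ _)
  have hΘe : ∀ z, ‖Θ z‖ₑ = ‖g (z.1 - x)‖ₑ ^ 2 * (rieszKernel γ z.2 * ‖ρ (z.1 - z.2)‖ₑ) := by
    intro z
    rw [hΘ, enorm_smul, enorm_planeWave, one_mul, enorm_mul, enorm_smul, enorm_coulomb]
    congr 1
    rw [← ofReal_norm, Complex.norm_real, Real.norm_of_nonneg (by positivity),
      ENNReal.ofReal_pow (norm_nonneg _), ofReal_norm]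
  have hΘi : Integrable Θ (volume.prod volume) := by
    refine ⟨hΘm, ?_⟩
    rw [hasFiniteIntegral_iff_enorm, lintegral_prod _ hΘm.enorm]
    simp_rw [hΘe]
    have hg2 : Measurable fun y => ‖g (y - x)‖ₑ ^ 2 := by
      have : Continuous fun y => g (y - x) := by fun_prop
      exact this.enorm.measurable.pow_const 2
    refine lt_of_le_of_lt (lintegral_mono fun y => ?_) (b := ∫⁻ y, ‖g (y - x)‖ₑ ^ 2 * S) ?_
    · rw [lintegral_const_mul' _ _ (by simp)]
      exact mul_le_mul_right (hρS y) _
    · rw [lintegral_mul_const _ hg2, lintegral_sub_right_eq_self (fun y => ‖g y‖ₑ ^ 2) x]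
      refine ENNReal.mul_lt_top ?_ hS.lt_top
      have h2 := ((g.memLp 2 volume).integrable_norm_pow (by norm_num)).2
      rw [hasFiniteIntegral_iff_enorm] at h2
      simpa [enorm_pow] using h2
  have e1 : ∫ y, planeWave ζ y • (((‖g (y - x)‖ ^ 2 : ℝ) : ℂ) * ∫ t, coulomb d γ t • ρ (y - t)) =
      ∫ t, ∫ y, Θ (y, t) := by
    rw [← integral_integral_swap (f := fun y t => Θ (y, t)) hΘi]
    refine integral_congr_ae (Filter.Eventually.of_forall fun y => ?_)
    simp only [hΘ]
    rw [integral_smul, integral_const_mul]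
  rw [e1]
  refine (enorm_integral_le_lintegral_enorm _).trans (lintegral_mono fun t => le_of_eq ?_)
  -- The translation by `t` is moved from `ρ` onto the window, at the cost of a phase of modulus
  -- one.
  have e2 : ∫ y, Θ (y, t) = (planeWave ζ t * (coulomb d γ t : ℂ)) *
      ∫ y, planeWave ζ y • (((‖g (y - (x - t))‖ ^ 2 : ℝ) : ℂ) * ρ y) := by
    rw [← integral_const_mul, ← integral_sub_right_eq_self (fun y => planeWave ζ t *
      (coulomb d γ t : ℂ) * (planeWave ζ y • (((‖g (y - (x - t))‖ ^ 2 : ℝ) : ℂ) * ρ y))) t]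
    refine integral_congr_ae (Filter.Eventually.of_forall fun y => ?_)
    simp only [hΘ]
    have h3 : planeWave ζ y = planeWave ζ (y - t) * planeWave ζ t := by
      rw [← planeWave_add_right, sub_add_cancel]
    have h4 : y - t - (x - t) = y - x := by abel
    rw [h3, h4, smul_eq_mul, smul_eq_mul, Complex.real_smul]
    ring
  rw [e2, enorm_mul, enorm_mul, enorm_planeWave, one_mul]
  congr 1
  rw [← enorm_coulomb, ← ofReal_norm, Complex.norm_real, ofReal_norm]

/-- The short-time Fourier transform of a product of functions. -/
theorem enorm_stft_smul_le {T w : 𝓢'(Rn d, E)} {f : Rn d → E} {u : Rn d → ℂ} (h : IsGivenBy T f)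
    (hw : IsGivenBy w fun y => u y • f y) (g : 𝓢(Rn d, ℂ)) (x : Rn d)
    (hV : Integrable fun ξ => stft g T x ξ)
    (hu : Integrable fun y => (((‖g (y - x)‖ ^ 2 : ℝ) : ℂ) * u y)) (ξ : Rn d) :
    ‖stft (schwartzMul g (schwartzMul g (schwartzConj g))) w x ξ‖ₑ ≤
      ‖((2 * Real.pi : ℂ) ^ d)⁻¹‖ₑ * ∫⁻ η, ‖stft g T x η‖ₑ *
        ‖∫ y, planeWave (ξ - η) y • (((‖g (y - x)‖ ^ 2 : ℝ) : ℂ) * u y)‖ₑ := by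
  set κ := ((2 * Real.pi : ℂ) ^ d)⁻¹ with hκ
  let L : E →L[ℂ] ℂ →L[ℂ] E := (ContinuousLinearMap.lsmul ℂ ℂ).flip
  -- The conjugate of the window `g g ḡ` is `|g|² ḡ`: the factor `|g|²` localizes `u` and the factor
  -- `ḡ` localizes `f`.
  have e1 : stft (schwartzMul g (schwartzMul g (schwartzConj g))) w x ξ =
      κ • ∫ y, planeWave ξ y • L (∫ η, planeWave (-η) y • stft g T x η)
        (((‖g (y - x)‖ ^ 2 : ℝ) : ℂ) * u y) := by
    rw [hw.stft_eq, ← integral_smul]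
    refine integral_congr_ae ?_
    filter_upwards [h.window_ae_eq g x hV] with y hy
    have hL : κ • L (∫ η, planeWave (-η) y • stft g T x η)
        (((‖g (y - x)‖ ^ 2 : ℝ) : ℂ) * u y) = L ((starRingEnd ℂ) (g (y - x)) • f y)
        (((‖g (y - x)‖ ^ 2 : ℝ) : ℂ) * u y) := by
      rw [hy, map_smul]; rfl
    rw [smul_comm κ (planeWave ξ y), hL]
    congr 1
    change _ = (((‖g (y - x)‖ ^ 2 : ℝ) : ℂ) * u y) • ((starRingEnd ℂ) (g (y - x)) • f y)
    rw [smul_smul, smul_smul]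
    congr 1
    simp only [schwartzMul_apply, schwartzConj_apply, map_mul, Complex.conj_conj]
    have := Complex.mul_conj' (g (y - x))
    push_cast
    rw [← this]
    ring
  rw [e1, enorm_smul, integral_planeWave_mul_eq L hV hu]
  refine mul_le_mul_right ((enorm_integral_le_lintegral_enorm _).trans
    (lintegral_mono fun η => ?_)) _
  change ‖(∫ y, planeWave (ξ - η) y • (((‖g (y - x)‖ ^ 2 : ℝ) : ℂ) * u y)) • stft g T x η‖ₑ ≤ _
  rw [enorm_smul, mul_comm]

end WindowedProducts

end

noncomputable section

set_option linter.unusedSectionVars false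

/-! ### Majorants in frequency for the spaces `M_s^{p,1}`. -/

section TriangleSpaces

variable {d : ℕ} {E : Type} [NormedAddCommGroup E] [InnerProductSpace ℂ E] [CompleteSpace E]

/-- The majorant of the short-time Fourier transform over the space variable. -/
def stftMajorant (p : ℝ) (g : 𝓢(Rn d, ℂ)) (T : 𝓢'(Rn d, E)) (ξ : Rn d) : ℝ≥0∞ :=
  (⨆ x, ‖stft g T x ξ‖ₑ) + lnorm volume p fun x => ‖stft g T x ξ‖ₑ

theorem measurable_stftMajorant (p : ℝ) (g : 𝓢(Rn d, ℂ)) (T : 𝓢'(Rn d, E)) :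
    Measurable (stftMajorant p g T) :=
  (measurable_iSup_stft g T).add (measurable_lnorm_stft p g T)

theorem modulationNorm_one_eq {p : ℝ} (hp : 0 < p) (s : ℝ) (g : 𝓢(Rn d, ℂ)) (T : 𝓢'(Rn d, E)) :
    modulationNorm g (ENNReal.ofReal p) (ENNReal.ofReal 1) s T =
      ∫⁻ ξ, japanese s ξ * lnorm volume p fun x => ‖stft g T x ξ‖ₑ := by
  rw [modulationNorm_eq hp one_pos, lnorm_one]

theorem exists_lintegral_stftMajorant_le {g : 𝓢(Rn d, ℂ)} (hg : g ≠ 0) {p s : ℝ} (hp : 1 ≤ p)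
    (hs : 0 ≤ s) : ∃ C : ℝ≥0, ∀ {E : Type} [NormedAddCommGroup E] [InnerProductSpace ℂ E]
      [CompleteSpace E] (T : 𝓢'(Rn d, E)), ∫⁻ ξ, japanese s ξ * stftMajorant p g T ξ ≤
        C * modulationNorm g (ENNReal.ofReal p) (ENNReal.ofReal 1) s T := by
  obtain ⟨C, hC⟩ := exists_lintegral_iSup_stft_le hg g hp hs
  refine ⟨C + 1, fun {E} _ _ _ T => ?_⟩
  have hm : Measurable fun ξ => japanese s ξ * ⨆ x, ‖stft g T x ξ‖ₑ :=
    (measurable_japanese s).mul (measurable_iSup_stft g T)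
  simp only [stftMajorant, mul_add]
  rw [lintegral_add_left hm, ← modulationNorm_one_eq (by linarith)]
  push_cast
  rw [add_mul, one_mul]
  gcongr
  exact hC T

theorem lintegral_le_lintegral_japanese {s : ℝ} (hs : 0 ≤ s) (a : Rn d → ℝ≥0∞) :
    ∫⁻ ξ, a ξ ≤ ∫⁻ ξ, japanese s ξ * a ξ :=
  lintegral_mono fun ξ => le_mul_of_one_le_left' (one_le_japanese hs ξ)

theorem integrable_stft {g : 𝓢(Rn d, ℂ)} {T : 𝓢'(Rn d, E)}
    (hT : ∫⁻ ξ, (⨆ x, ‖stft g T x ξ‖ₑ) < ∞) (x : Rn d) : Integrable fun ξ => stft g T x ξ :=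
  ⟨((continuous_stft g T).comp (continuous_const.prodMk continuous_id)).aestronglyMeasurable,
    lt_of_le_of_lt (lintegral_mono fun ξ => le_iSup (fun x => ‖stft g T x ξ‖ₑ) x) hT⟩

/-- The majorant over the first variable used for potentials of products. -/
def sliceMajorant (p : ℝ) (A : Rn d × Rn d → ℝ≥0∞) (ξ : Rn d) : ℝ≥0∞ :=
  (⨆ x, A (x, ξ)) + lnorm volume p fun x => A (x, ξ)

/-- Real powers are finite at zero, so the kernel has a finite value even at the origin; constants
can be pulled out of integrals without measurability. -/
theorem rieszKernel_ne_top (a : ℝ) (z : Rn d) : rieszKernel a z ≠ ∞ := ENNReal.ofReal_ne_top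

/-- After exchanging the integrals, the kernel bound `hC` is applied at each fixed `η` to the
product of the two slices: its supremum is at most the product of suprema, its `L^p` norm at most
the norm of the first slice times the supremum of the second. -/
theorem lintegral_rieszKernel_correlation_le {γ p : ℝ} (hp : 1 ≤ p) {C : ℝ≥0}
    (hC : ∀ (A : Rn d → ℝ≥0∞) (S : ℝ≥0∞), AEMeasurable A → (∀ᵐ y, A y ≤ S) → ∀ x,
      ∫⁻ t, rieszKernel γ t * A (x - t) ≤ C * (S + lnorm volume p A))
    {A₁ A₂ : Rn d × Rn d → ℝ≥0∞} (hA₁ : Measurable A₁) (hA₂ : Measurable A₂) (x ζ : Rn d) :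
    ∫⁻ t, rieszKernel γ t * ∫⁻ η, A₁ (x - t, η) * A₂ (x - t, η - ζ) ≤
      C * ∫⁻ η, sliceMajorant p A₁ η * sliceMajorant p A₂ (η - ζ) := by
  have hp0 : 0 < p := by linarith
  have hjm : Measurable fun w : Rn d × Rn d => rieszKernel γ w.1 *
      (A₁ (x - w.1, w.2) * A₂ (x - w.1, w.2 - ζ)) :=
    ((measurable_rieszKernel γ).comp measurable_fst).mul
      ((hA₁.comp ((measurable_const.sub measurable_fst).prodMk measurable_snd)).mul
      (hA₂.comp ((measurable_const.sub measurable_fst).prodMk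
        (measurable_snd.sub measurable_const))))
  have e1 : ∫⁻ t, rieszKernel γ t * ∫⁻ η, A₁ (x - t, η) * A₂ (x - t, η - ζ) =
      ∫⁻ η, ∫⁻ t, rieszKernel γ t * (A₁ (x - t, η) * A₂ (x - t, η - ζ)) := by
    rw [← lintegral_lintegral_swap hjm.aemeasurable]
    refine lintegral_congr fun t => ?_
    rw [lintegral_const_mul' _ _ (rieszKernel_ne_top γ t)]
  rw [e1, ← lintegral_const_mul' _ _ ENNReal.coe_ne_top]
  refine lintegral_mono fun η => ?_
  have hs₁ : Measurable fun y => A₁ (y, η) := hA₁.comp (measurable_id.prodMk measurable_const)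
  have hs₂ : Measurable fun y => A₂ (y, η - ζ) :=
    hA₂.comp (measurable_id.prodMk measurable_const)
  have hle₁ : ∀ y, A₁ (y, η) ≤ ⨆ x, A₁ (x, η) := fun y => le_iSup (fun x => A₁ (x, η)) y
  have hle₂ : ∀ y, A₂ (y, η - ζ) ≤ ⨆ x, A₂ (x, η - ζ) := fun y =>
    le_iSup (fun x => A₂ (x, η - ζ)) y
  refine (hC (fun y => A₁ (y, η) * A₂ (y, η - ζ)) ((⨆ x, A₁ (x, η)) * ⨆ x, A₂ (x, η - ζ))
    (hs₁.mul hs₂).aemeasurable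
    (Filter.Eventually.of_forall fun y => mul_le_mul' (hle₁ y) (hle₂ y)) x).trans ?_
  refine mul_le_mul_right ?_ _
  have hl : lnorm volume p (fun y => A₁ (y, η) * A₂ (y, η - ζ)) ≤
      (⨆ x, A₂ (x, η - ζ)) * lnorm volume p fun y => A₁ (y, η) := by
    rw [← lnorm_const_mul_of_measurable hp0 _ hs₁]
    refine lnorm_mono hp0 fun y => ?_
    rw [mul_comm]
    exact mul_le_mul_left (hle₂ y) _
  calc _ ≤ (⨆ x, A₁ (x, η)) * (⨆ x, A₂ (x, η - ζ)) +
        (⨆ x, A₂ (x, η - ζ)) * lnorm volume p fun y => A₁ (y, η) := add_le_add le_rfl hl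
    _ = sliceMajorant p A₁ η * ⨆ x, A₂ (x, η - ζ) := by rw [sliceMajorant]; ring
    _ ≤ _ := mul_le_mul_right le_self_add _

/-- The short-time Fourier transform of the potential of a density, with window `|g|²`. -/
theorem enorm_window_potential_le {γ : ℝ} {p : ℝ} (hp : 1 ≤ p) {C : ℝ≥0}
    (hC : ∀ (A : Rn d → ℝ≥0∞) (S : ℝ≥0∞), AEMeasurable A → (∀ᵐ y, A y ≤ S) → ∀ x,
      ∫⁻ t, rieszKernel γ t * A (x - t) ≤ C * (S + lnorm volume p A))
    {T₁ T₂ : 𝓢'(Rn d, E)} {f₁ f₂ : Rn d → E} (h₁ : IsGivenBy T₁ f₁)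
    (h₂ : IsGivenBy T₂ f₂) (g : 𝓢(Rn d, ℂ)) (hV : ∀ x, Integrable fun ξ => stft g T₁ x ξ)
    {S : ℝ≥0∞} (hS : S ≠ ∞)
    (hρS : ∀ x, ∫⁻ t, rieszKernel γ t * ‖(inner ℂ (f₂ (x - t)) (f₁ (x - t)) : ℂ)‖ₑ ≤ S)
    (x ζ : Rn d) :
    ‖∫ y, planeWave ζ y • (((‖g (y - x)‖ ^ 2 : ℝ) : ℂ) *
      ∫ t, coulomb d γ t • (inner ℂ (f₂ (y - t)) (f₁ (y - t)) : ℂ))‖ₑ ≤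
      ‖((2 * Real.pi : ℂ) ^ d)⁻¹‖ₑ *
        (C * ∫⁻ η, stftMajorant p g T₁ η * stftMajorant p g T₂ (η - ζ)) := by
  have hρ : AEStronglyMeasurable (fun y => (inner ℂ (f₂ y) (f₁ y) : ℂ)) :=
    h₂.aestronglyMeasurable.inner h₁.aestronglyMeasurable
  -- The potential averages in the space variable only; at each translate `x - t` the windowed
  -- density is a correlation of short-time Fourier transforms in frequency.
  refine (enorm_window_convolution_le hρ hS hρS g x ζ).trans ?_
  refine le_trans ?_ (mul_le_mul_right (lintegral_rieszKernel_correlation_le hp hC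
    (measurable_stft g T₁) (measurable_stft g T₂) x ζ) _)
  rw [← lintegral_const_mul' _ _ (by simp)]
  refine lintegral_mono fun t => ?_
  rw [mul_left_comm]
  exact mul_le_mul_right (enorm_window_inner_le h₁ h₂ g (x - t) (hV _) ζ) _

theorem lnorm_lintegral_mul_le {p : ℝ} (hp : 1 ≤ p) {A : Rn d × Rn d → ℝ≥0∞} (hA : Measurable A)
    {M : Rn d → ℝ≥0∞} (hM : Measurable M) (ξ : Rn d) :
    lnorm volume p (fun x => ∫⁻ η, A (x, η) * M (ξ - η)) ≤
      ∫⁻ η, (lnorm volume p fun x => A (x, η)) * M (ξ - η) := by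
  have hp0 : 0 < p := by linarith
  have hjm : Measurable (Function.uncurry fun x η : Rn d => A (x, η) * M (ξ - η)) :=
    hA.mul (hM.comp (measurable_const.sub measurable_snd))
  refine (lnorm_lintegral_le hp hjm).trans (le_of_eq (lintegral_congr fun η => ?_))
  have hs₁ : Measurable fun y => A (y, η) := hA.comp (measurable_id.prodMk measurable_const)
  rw [mul_comm _ (M (ξ - η)), ← lnorm_const_mul_of_measurable hp0 _ hs₁]
  simp_rw [mul_comm (M (ξ - η))]

/-- The short-time Fourier transform of the Hartree nonlinearity, when the windowed potential is
integrable. -/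
theorem modulationNorm_smul_le {T w : 𝓢'(Rn d, E)} {f : Rn d → E} {u : Rn d → ℂ}
    (h : IsGivenBy T f) (hw : IsGivenBy w fun y => u y • f y) (g : 𝓢(Rn d, ℂ))
    (hV : ∀ x, Integrable fun ξ => stft g T x ξ)
    (hu : ∀ x, Integrable fun y => (((‖g (y - x)‖ ^ 2 : ℝ) : ℂ) * u y)) {M : Rn d → ℝ≥0∞}
    (hM : Measurable M) (hMu : ∀ x ζ,
      ‖∫ y, planeWave ζ y • (((‖g (y - x)‖ ^ 2 : ℝ) : ℂ) * u y)‖ₑ ≤ M ζ) {p s : ℝ} (hp : 1 ≤ p)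
    (hs : 0 ≤ s) :
    modulationNorm (schwartzMul g (schwartzMul g (schwartzConj g))) (ENNReal.ofReal p)
      (ENNReal.ofReal 1) s w ≤ ‖((2 * Real.pi : ℂ) ^ d)⁻¹‖ₑ * (ENNReal.ofReal (2 ^ (s / 2)) *
        (modulationNorm g (ENNReal.ofReal p) (ENNReal.ofReal 1) s T *
          ∫⁻ ζ, japanese s ζ * M ζ)) := by
  have hp0 : 0 < p := by linarith
  have hpt : ∀ x ξ, ‖stft (schwartzMul g (schwartzMul g (schwartzConj g))) w x ξ‖ₑ ≤
      ‖((2 * Real.pi : ℂ) ^ d)⁻¹‖ₑ * ∫⁻ η, ‖stft g T x η‖ₑ * M (ξ - η) := fun x ξ =>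
    (enorm_stft_smul_le h hw g x (hV x) (hu x) ξ).trans
      (mul_le_mul_right (lintegral_mono fun η => mul_le_mul_right (hMu _ _) _) _)
  have hκ : ‖((2 * Real.pi : ℂ) ^ d)⁻¹‖ₑ ≠ ∞ := enorm_ne_top
  generalize ‖((2 * Real.pi : ℂ) ^ d)⁻¹‖ₑ = κ at hpt hκ
  rw [modulationNorm_one_eq hp0, modulationNorm_one_eq hp0]
  refine le_trans ?_ (mul_le_mul_right
    (lintegral_japanese_conv_le hs (measurable_lnorm_stft p g T) hM) _)
  rw [← lintegral_const_mul' _ _ hκ]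
  refine lintegral_mono fun ξ => ?_
  rw [mul_left_comm]
  refine mul_le_mul_right ?_ _
  refine (lnorm_mono hp0 fun x => hpt x ξ).trans ?_
  rw [lnorm_const_mul hp0 hκ]
  exact mul_le_mul_right (lnorm_lintegral_mul_le hp (measurable_stft g T) hM ξ) _

end TriangleSpaces

end

noncomputable section

set_option linter.unusedSectionVars false

/-! ### The trilinear estimate in `M_s^{p,1}`. -/

section TriangleSpacesBound

variable {d : ℕ} {E : Type} [NormedAddCommGroup E] [InnerProductSpace ℂ E] [CompleteSpace E]

theorem enorm_inner_le (v w : E) : ‖(inner ℂ v w : ℂ)‖ₑ ≤ ‖v‖ₑ * ‖w‖ₑ := by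
  rw [← ofReal_norm, ← ofReal_norm, ← ofReal_norm, ← ENNReal.ofReal_mul (norm_nonneg _)]
  exact ENNReal.ofReal_le_ofReal (norm_inner_le_norm _ _)

theorem exists_isGivenBy_of_modulationNorm_one {g : 𝓢(Rn d, ℂ)} (hg : g ≠ 0) {p s : ℝ}
    (hp : 1 ≤ p) (hs : 0 ≤ s) : ∃ C : ℝ≥0, ∀ {E : Type} [NormedAddCommGroup E]
      [InnerProductSpace ℂ E] [CompleteSpace E] (T : 𝓢'(Rn d, E)),
      modulationNorm g (ENNReal.ofReal p) (ENNReal.ofReal 1) s T < ∞ →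
      (∫⁻ ξ, (⨆ x, ‖stft g T x ξ‖ₑ) < ∞) ∧ (∃ f, IsGivenBy T f) ∧ ∀ f, IsGivenBy T f →
        (∀ᵐ y, ‖f y‖ₑ ≤ C * modulationNorm g (ENNReal.ofReal p) (ENNReal.ofReal 1) s T) ∧
        lnorm volume p (fun y => ‖f y‖ₑ) ≤
          C * modulationNorm g (ENNReal.ofReal p) (ENNReal.ofReal 1) s T := by
  obtain ⟨C₁, hC₁⟩ := exists_lintegral_iSup_stft_le hg g hp hs
  obtain ⟨C₂, hC₂⟩ := exists_stftSynthesis_le g hp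
  refine ⟨C₂ * C₁ + C₂, fun {E} _ _ _ T hT => ?_⟩
  have hp0 : 0 < p := by linarith
  obtain ⟨hsup, hnorm⟩ := hC₂ T
  have h1 := (lintegral_le_lintegral_japanese hs _).trans (hC₁ T)
  have h2 : ∫⁻ ξ, lnorm volume p (fun x => ‖stft g T x ξ‖ₑ) ≤
      modulationNorm g (ENNReal.ofReal p) (ENNReal.ofReal 1) s T := by
    rw [modulationNorm_one_eq hp0]
    exact lintegral_le_lintegral_japanese hs _
  have h3 : ∫⁻ ξ, (⨆ x, ‖stft g T x ξ‖ₑ) < ∞ :=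
    lt_of_le_of_lt h1 (ENNReal.mul_lt_top ENNReal.coe_lt_top hT)
  have hsyn := isGivenBy_stftSynthesis hg h3
  refine ⟨h3, ⟨_, hsyn⟩, fun f hf => ?_⟩
  have hae := hf.ae_eq hsyn
  push_cast
  rw [add_mul]
  refine ⟨?_, ?_⟩
  · filter_upwards [hae] with y hy
    rw [hy]
    refine (hsup y).trans (le_add_right ?_)
    rw [mul_assoc]
    exact mul_le_mul_right h1 _
  · have h4 : lnorm volume p (fun y => ‖f y‖ₑ) ≤
        lnorm volume p (fun y => ‖stftSynthesis g T y‖ₑ) := by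
      refine lnorm_mono_ae hp0 ?_
      filter_upwards [hae] with y hy
      rw [hy]
    exact h4.trans (hnorm.trans (le_add_left (mul_le_mul_right h2 _)))

/-- The density inherits both bounds from `f₁`, with the sup bound of `f₂` as a factor. Finiteness
for every `x` makes the potential a bounded function. -/
theorem exists_lintegral_rieszKernel_inner_le {γ : ℝ} (hγ : 0 < γ) (hγd : γ < d) {p : ℝ}
    (hp1 : 1 < p) (hp : p < d / (d - γ)) : ∃ C : ℝ≥0, ∀ {E : Type} [NormedAddCommGroup E]
      [InnerProductSpace ℂ E] [CompleteSpace E] (f₁ f₂ : Rn d → E) (S₁ S₂ : ℝ≥0∞),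
      AEStronglyMeasurable f₁ → AEStronglyMeasurable f₂ → S₂ ≠ ∞ → (∀ᵐ y, ‖f₁ y‖ₑ ≤ S₁) →
      (∀ᵐ y, ‖f₂ y‖ₑ ≤ S₂) → lnorm volume p (fun y => ‖f₁ y‖ₑ) ≤ S₁ → ∀ x,
      ∫⁻ t, rieszKernel γ t * ‖(inner ℂ (f₂ (x - t)) (f₁ (x - t)) : ℂ)‖ₑ ≤ C * (S₁ * S₂) := by
  obtain ⟨C, hC⟩ := exists_lintegral_rieszKernel_mul_le hγ hγd hp1 hp
  have hp0 : 0 < p := by linarith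
  refine ⟨C * 2, fun {E} _ _ _ f₁ f₂ S₁ S₂ hm₁ hm₂ hS₂ hf₁ hf₂ hl x => ?_⟩
  have hb : ∀ᵐ y, ‖(inner ℂ (f₂ y) (f₁ y) : ℂ)‖ₑ ≤ S₂ * ‖f₁ y‖ₑ := by
    filter_upwards [hf₂] with y hy
    exact (enorm_inner_le _ _).trans (mul_le_mul_left hy _)
  have h := hC (fun y => ‖(inner ℂ (f₂ y) (f₁ y) : ℂ)‖ₑ) (S₁ * S₂) (hm₂.inner hm₁).enorm
    (by
      filter_upwards [hb, hf₁] with y hy hy1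
      rw [mul_comm]
      exact hy.trans (mul_le_mul_right hy1 _)) x
  refine h.trans ?_
  push_cast
  rw [mul_assoc, two_mul]
  refine mul_le_mul_right (add_le_add le_rfl ((lnorm_mono_ae hp0 hb).trans ?_)) _
  rw [lnorm_const_mul hp0 hS₂, mul_comm]
  exact mul_le_mul_left hl _

/-- The trilinear estimate in `M_s^{p,1}`. -/
theorem exists_hartree_bound_one {γ : ℝ} (hγ : 0 < γ) (hγd : γ < d) {p s : ℝ}
    (hp1 : 1 < p) (hp : p < d / (d - γ)) (hs : 0 ≤ s) {g : 𝓢(Rn d, ℂ)} (hg : g ≠ 0) :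
    ∃ C : ℝ≥0, ∀ (T₁ T₂ T₃ : 𝓢'(Rn d, E)),
      modulationNorm g (ENNReal.ofReal p) (ENNReal.ofReal 1) s T₁ < ∞ →
      modulationNorm g (ENNReal.ofReal p) (ENNReal.ofReal 1) s T₂ < ∞ →
      modulationNorm g (ENNReal.ofReal p) (ENNReal.ofReal 1) s T₃ < ∞ →
      ∀ f₁ f₂ f₃ : Rn d → E, IsGivenBy T₁ f₁ → IsGivenBy T₂ f₂ → IsGivenBy T₃ f₃ →
      (∀ᵐ x, ∫⁻ t, rieszKernel γ t * ‖(inner ℂ (f₂ (x - t)) (f₁ (x - t)) : ℂ)‖ₑ < ∞) ∧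
      (∃ w, IsGivenBy w fun x =>
        (∫ t, coulomb d γ t • (inner ℂ (f₂ (x - t)) (f₁ (x - t)) : ℂ)) • f₃ x) ∧
      ∀ w, (IsGivenBy w fun x =>
        (∫ t, coulomb d γ t • (inner ℂ (f₂ (x - t)) (f₁ (x - t)) : ℂ)) • f₃ x) →
        modulationNorm g (ENNReal.ofReal p) (ENNReal.ofReal 1) s w ≤
          C * (modulationNorm g (ENNReal.ofReal p) (ENNReal.ofReal 1) s T₁ *
            modulationNorm g (ENNReal.ofReal p) (ENNReal.ofReal 1) s T₂ *
            modulationNorm g (ENNReal.ofReal p) (ENNReal.ofReal 1) s T₃) := by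
  obtain ⟨C₁, hC₁⟩ := exists_isGivenBy_of_modulationNorm_one hg hp1.le hs
  obtain ⟨C₂, hC₂⟩ := exists_lintegral_rieszKernel_inner_le hγ hγd hp1 hp
  obtain ⟨C₃, hC₃⟩ := exists_lintegral_rieszKernel_mul_le hγ hγd hp1 hp
  obtain ⟨C₄, hC₄⟩ := exists_lintegral_stftMajorant_le hg hp1.le hs
  -- The product estimate is obtained with the window `g |g|²`. It vanishes only where `g` does, so
  -- it is an admissible window, and `C₅` is the cost of returning to `g`.
  have hh : schwartzMul g (schwartzMul g (schwartzConj g)) ≠ 0 := by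
    intro h0
    apply hg
    ext y
    have h1 := congrArg (fun φ : 𝓢(Rn d, ℂ) => φ y) h0
    simpa using h1
  obtain ⟨C₅, hC₅⟩ := exists_modulationNorm_le hh g hp1.le le_rfl le_rfl le_rfl hs
  have hκ : ‖((2 * Real.pi : ℂ) ^ d)⁻¹‖ₑ ≠ ∞ := enorm_ne_top
  set c : ℝ≥0 := (2 ^ (s / 2) : ℝ).toNNReal with hc
  have hcE : ENNReal.ofReal (2 ^ (s / 2)) = c := rfl
  set k : ℝ≥0 := ‖((2 * Real.pi : ℂ) ^ d)⁻¹‖₊ with hk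
  have hkE : ‖((2 * Real.pi : ℂ) ^ d)⁻¹‖ₑ = k := rfl
  refine ⟨C₅ * (k * (c * (k * (C₃ * (c * (C₄ * C₄)))))),
    fun T₁ T₂ T₃ hT₁ hT₂ hT₃ f₁ f₂ f₃ h₁ h₂ h₃ => ?_⟩
  obtain ⟨hs₁, -, hf₁⟩ := hC₁ T₁ hT₁
  obtain ⟨hs₂, -, hf₂⟩ := hC₁ T₂ hT₂
  obtain ⟨hs₃, -, hf₃⟩ := hC₁ T₃ hT₃
  have hM₁ := hC₄ T₁
  have hM₂ := hC₄ T₂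
  set n₁ := modulationNorm g (ENNReal.ofReal p) (ENNReal.ofReal 1) s T₁
  set n₂ := modulationNorm g (ENNReal.ofReal p) (ENNReal.ofReal 1) s T₂
  set n₃ := modulationNorm g (ENNReal.ofReal p) (ENNReal.ofReal 1) s T₃ with hn₃
  obtain ⟨hb₁, hl₁⟩ := hf₁ f₁ h₁
  obtain ⟨hb₂, -⟩ := hf₂ f₂ h₂
  obtain ⟨hb₃, -⟩ := hf₃ f₃ h₃
  have hfin : ∀ n : ℝ≥0∞, n < ∞ → (C₁ : ℝ≥0∞) * n ≠ ∞ := fun n hn =>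
    ENNReal.mul_ne_top ENNReal.coe_ne_top hn.ne
  set S : ℝ≥0∞ := C₂ * ((C₁ * n₁) * (C₁ * n₂)) with hS
  have hST : S ≠ ∞ :=
    ENNReal.mul_ne_top ENNReal.coe_ne_top (ENNReal.mul_ne_top (hfin _ hT₁) (hfin _ hT₂))
  have hK : ∀ x, ∫⁻ t, rieszKernel γ t * ‖(inner ℂ (f₂ (x - t)) (f₁ (x - t)) : ℂ)‖ₑ ≤ S :=
    hC₂ f₁ f₂ _ _ h₁.aestronglyMeasurable h₂.aestronglyMeasurable (hfin _ hT₂) hb₁ hb₂ hl₁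
  set u : Rn d → ℂ := fun x => ∫ t, coulomb d γ t • (inner ℂ (f₂ (x - t)) (f₁ (x - t)) : ℂ)
    with hu
  have hum : AEStronglyMeasurable u := aestronglyMeasurable_coulomb_potential γ
    (ρ := fun y => (inner ℂ (f₂ y) (f₁ y) : ℂ))
    (h₂.aestronglyMeasurable.inner h₁.aestronglyMeasurable)
  have hub : ∀ x, ‖u x‖ₑ ≤ S := fun x =>
    (enorm_coulomb_potential_le γ (fun y => (inner ℂ (f₂ y) (f₁ y) : ℂ)) x).trans (hK x)
  have hubr : ∀ x, ‖u x‖ ≤ S.toReal := fun x => by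
    rw [← toReal_enorm]
    exact ENNReal.toReal_mono hST (hub x)
  refine ⟨Filter.Eventually.of_forall fun x => lt_of_le_of_lt (hK x) hST.lt_top, ?_, ?_⟩
  · refine exists_isGivenBy_of_memLp (p := ∞) (by simp) (memLp_top_of_bound
      (hum.smul h₃.aestronglyMeasurable) (S * (C₁ * n₃)).toReal ?_)
    filter_upwards [hb₃] with x hx
    rw [← toReal_enorm, enorm_smul]
    exact ENNReal.toReal_mono (ENNReal.mul_ne_top hST (hfin _ hT₃)) (mul_le_mul' (hub x) hx)
  · intro w hw
    -- A bound for the windowed Fourier transform of `u` that is uniform in `x`, so that `L^p`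
    -- integrability in space need only come from the third factor.
    set M : Rn d → ℝ≥0∞ := fun ζ => (k : ℝ≥0∞) *
      (C₃ * ∫⁻ η, stftMajorant p g T₁ η * stftMajorant p g T₂ (η - ζ)) with hM
    have hMi : Measurable fun ζ =>
        ∫⁻ η, stftMajorant p g T₁ η * stftMajorant p g T₂ (η - ζ) :=
      Measurable.lintegral_prod_right' (f := fun z : Rn d × Rn d =>
        stftMajorant p g T₁ z.2 * stftMajorant p g T₂ (z.2 - z.1))
        (((measurable_stftMajorant p g T₁).comp measurable_snd).mul
          ((measurable_stftMajorant p g T₂).comp (measurable_snd.sub measurable_fst)))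
    have hMm : Measurable M := (hMi.const_mul _).const_mul _
    have hMu : ∀ x ζ, ‖∫ y, planeWave ζ y • (((‖g (y - x)‖ ^ 2 : ℝ) : ℂ) * u y)‖ₑ ≤ M ζ :=
      enorm_window_potential_le hp1.le hC₃ h₁ h₂ g (integrable_stft hs₁) hST hK
    have hg2 : Integrable fun y => ((‖g y‖ ^ 2 : ℝ) : ℂ) :=
      ((g.memLp 2 volume).integrable_norm_pow (by norm_num)).ofReal
    have hui : ∀ x, Integrable fun y => (((‖g (y - x)‖ ^ 2 : ℝ) : ℂ) * u y) := fun x =>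
      (hg2.comp_sub_right x).mul_bdd (c := S.toReal) hum (Filter.Eventually.of_forall hubr)
    have hMint : ∫⁻ ζ, japanese s ζ * M ζ ≤ k * (C₃ * (c * (C₄ * n₁ * (C₄ * n₂)))) := by
      have e1 : ∀ ζ, japanese s ζ * M ζ = ((k : ℝ≥0∞) * C₃) * (japanese s ζ *
          ∫⁻ η, stftMajorant p g T₁ η * stftMajorant p g T₂ (η - ζ)) := fun ζ => by
        rw [hM]; ring
      simp_rw [e1]
      rw [lintegral_const_mul' _ _ (ENNReal.mul_ne_top ENNReal.coe_ne_top ENNReal.coe_ne_top),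
        mul_assoc]
      refine mul_le_mul_right (mul_le_mul_right ?_ _) _
      refine (lintegral_japanese_correlation_le hs (measurable_stftMajorant p g T₁)
        (measurable_stftMajorant p g T₂)).trans ?_
      rw [hcE]
      exact mul_le_mul_right (mul_le_mul' hM₁ hM₂) _
    calc _ ≤ C₅ * modulationNorm (schwartzMul g (schwartzMul g (schwartzConj g)))
          (ENNReal.ofReal p) (ENNReal.ofReal 1) s w := hC₅ w
      _ ≤ C₅ * (k * (c * (n₃ * ∫⁻ ζ, japanese s ζ * M ζ))) :=
          mul_le_mul_right (modulationNorm_smul_le h₃ hw g (integrable_stft hs₃) hui hMm hMu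
            hp1.le hs) _
      _ ≤ C₅ * (k * (c * (n₃ * (k * (C₃ * (c * (C₄ * n₁ * (C₄ * n₂)))))))) := by gcongr
      _ = _ := by push_cast; ring

end TriangleSpacesBound

end

noncomputable section

set_option linter.unusedSectionVars false

/-! ### Square integrable short-time Fourier transforms and `L²`. -/

section SquareIntegrable

variable {d : ℕ}

theorem lintegral_enorm_sq_eq (φ : 𝓢(Rn d, ℂ)) :
    ∫⁻ y, ‖φ y‖ₑ ^ (2 : ℝ) = ENNReal.ofReal (∫ y, ‖φ y‖ ^ 2) := by
  have h := (φ.memLp 2 volume).integrable_norm_pow (by norm_num)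
  rw [ofReal_integral_eq_lintegral_ofReal h (Filter.Eventually.of_forall fun y => by positivity)]
  refine lintegral_congr fun y => ?_
  rw [← ofReal_norm, ENNReal.ofReal_rpow_of_nonneg (norm_nonneg _) (by norm_num), Real.rpow_two]

/-- Plancherel's theorem after the dilation by `2π`, which produces `(2π)^d`. -/
theorem lintegral_enorm_waveTransform_sq (φ : 𝓢(Rn d, ℂ)) :
    ∫⁻ ξ, ‖waveTransform φ ξ‖ₑ ^ (2 : ℝ) =
      ENNReal.ofReal ((2 * Real.pi) ^ (d : ℝ)) * ∫⁻ y, ‖φ y‖ₑ ^ (2 : ℝ) := by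
  have hm : Measurable fun ξ => ‖waveTransform φ ξ‖ₑ ^ (2 : ℝ) :=
    (waveTransform φ).continuous.enorm.measurable.pow_const _
  rw [lintegral_eq_ofReal_mul_lintegral_smul (by positivity : (0 : ℝ) < 2 * Real.pi) hm]
  congr 1
  simp_rw [waveTransform_apply_eq, smul_smul]
  rw [inv_mul_cancel₀ (by positivity)]
  simp_rw [one_smul]
  rw [lintegral_enorm_sq_eq, lintegral_enorm_sq_eq, ← integral_norm_sq_fourier,
    FourierTransform.fourier_fourierInv_eq]

/-- The function `W_ψ(x, ξ) = ∫ exp(i y·ξ) g(y - x) ψ(y) dy`. -/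
def dualWindowed (g : 𝓢(Rn d, ℂ)) (ψ : Rn d → ℂ) (z : Rn d × Rn d) : ℂ :=
  ∫ y, planeWave (-z.2) y * (g (y - z.1) * ψ y)

theorem dualStft_eq_dualWindowed (g φ : 𝓢(Rn d, ℂ)) (x ξ : Rn d) :
    dualStft g φ x ξ = dualWindowed g φ (x, ξ) := dualStft_apply g φ x ξ

theorem stronglyMeasurable_dualWindowed (g : 𝓢(Rn d, ℂ)) {ψ : Rn d → ℂ}
    (hψ : AEStronglyMeasurable ψ) : StronglyMeasurable (dualWindowed g ψ) := by
  have e : dualWindowed g ψ = dualWindowed g (hψ.mk ψ) := by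
    funext z
    refine integral_congr_ae ?_
    filter_upwards [hψ.ae_eq_mk] with y hy
    rw [hy]
  rw [e]
  have h1 : Continuous fun w : (Rn d × Rn d) × Rn d => planeWave (-w.1.2) w.2 :=
    continuous_planeWave.comp (by fun_prop : Continuous fun w : (Rn d × Rn d) × Rn d =>
      ((-w.1.2, w.2) : Rn d × Rn d))
  have h2 : Continuous fun w : (Rn d × Rn d) × Rn d => g (w.2 - w.1.1) :=
    g.continuous.comp (by fun_prop)
  have h3 : StronglyMeasurable fun w : (Rn d × Rn d) × Rn d =>
      planeWave (-w.1.2) w.2 * (g (w.2 - w.1.1) * hψ.mk ψ w.2) :=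
    h1.stronglyMeasurable.mul (h2.stronglyMeasurable.mul
      (hψ.stronglyMeasurable_mk.comp_measurable measurable_snd))
  exact h3.integral_prod_right

/-- The orthogonality relation for the short-time Fourier transform of Schwartz functions. -/
theorem lintegral_dualWindowed_schwartz (g φ : 𝓢(Rn d, ℂ)) :
    ∫⁻ z, ‖dualWindowed g φ z‖ₑ ^ (2 : ℝ) ∂(volume.prod volume) =
      (ENNReal.ofReal ((2 * Real.pi) ^ (d : ℝ)) * ∫⁻ y, ‖g y‖ₑ ^ (2 : ℝ)) *
        ∫⁻ y, ‖φ y‖ₑ ^ (2 : ℝ) := by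
  have hm := (stronglyMeasurable_dualWindowed g
    φ.continuous.aestronglyMeasurable).measurable.enorm.pow_const (2 : ℝ)
  have hgm : Measurable fun y => ‖g y‖ₑ ^ (2 : ℝ) := g.continuous.enorm.measurable.pow_const _
  have hφm : Measurable fun y => ‖φ y‖ₑ ^ (2 : ℝ) := φ.continuous.enorm.measurable.pow_const _
  rw [lintegral_prod _ hm.aemeasurable]
  simp_rw [← dualStft_eq_dualWindowed, dualStft, lintegral_enorm_waveTransform_sq]
  rw [lintegral_const_mul' _ _ ENNReal.ofReal_ne_top, mul_assoc]
  congr 1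
  have hj : Measurable fun z : Rn d × Rn d => ‖g (z.2 - z.1)‖ₑ ^ (2 : ℝ) * ‖φ z.2‖ₑ ^ (2 : ℝ) :=
    (hgm.comp (measurable_snd.sub measurable_fst)).mul (hφm.comp measurable_snd)
  simp only [schwartzMul_apply, schwartzTranslate_apply, enorm_mul,
    ENNReal.mul_rpow_of_nonneg _ _ zero_le_two]
  rw [lintegral_lintegral_swap hj.aemeasurable, ← lintegral_const_mul _ hφm]
  refine lintegral_congr fun y => ?_
  have hgy : Measurable fun x => ‖g (y - x)‖ₑ ^ (2 : ℝ) :=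
    hgm.comp (measurable_const.sub measurable_id)
  rw [lintegral_mul_const _ hgy, lintegral_sub_left_eq_self (fun x => ‖g x‖ₑ ^ (2 : ℝ)) y]

theorem lnorm_two_eq {f : Rn d → ℂ} : lnorm volume 2 (fun y => ‖f y‖ₑ) = eLpNorm f 2 volume := by
  rw [← lnorm_eq_eLpNorm two_pos]; norm_num

theorem integrable_dualWindowed_integrand (g : 𝓢(Rn d, ℂ)) {ψ : Rn d → ℂ} (hψ : MemLp ψ 2)
    (z : Rn d × Rn d) : Integrable fun y => planeWave (-z.2) y * (g (y - z.1) * ψ y) := by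
  have h1 : Integrable fun y => g (y - z.1) * ψ y :=
    memLp_one_iff_integrable.1 (MemLp.smul (r := 1) hψ
      ((schwartzTranslate z.1 g).memLp 2 volume))
  have hp : Continuous (planeWave (-z.2)) :=
    continuous_planeWave.comp (continuous_const.prodMk continuous_id)
  exact h1.bdd_mul (c := 1) hp.aestronglyMeasurable
    (Filter.Eventually.of_forall fun y => (norm_planeWave _ _).le)

theorem dualWindowed_sub (g : 𝓢(Rn d, ℂ)) {φ ψ : Rn d → ℂ} (hφ : MemLp φ 2) (hψ : MemLp ψ 2)
    (z : Rn d × Rn d) :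
    dualWindowed g (fun y => φ y - ψ y) z = dualWindowed g φ z - dualWindowed g ψ z := by
  unfold dualWindowed
  rw [← integral_sub (integrable_dualWindowed_integrand g hφ z)
    (integrable_dualWindowed_integrand g hψ z)]
  refine integral_congr_ae (Filter.Eventually.of_forall fun y => ?_)
  simp only []
  ring

/-- Cauchy-Schwarz at each point of phase space. It gives pointwise convergence of the transforms
along an `L²` approximation. -/
theorem enorm_dualWindowed_le (g : 𝓢(Rn d, ℂ)) {ψ : Rn d → ℂ} (hψ : MemLp ψ 2)
    (z : Rn d × Rn d) :
    ‖dualWindowed g ψ z‖ₑ ≤ eLpNorm g 2 volume * eLpNorm ψ 2 volume := by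
  refine (enorm_integral_le_lintegral_enorm _).trans ?_
  have hgm : Measurable fun y => ‖g (y - z.1)‖ₑ :=
    (g.continuous.comp (continuous_id.sub continuous_const)).enorm.measurable
  calc ∫⁻ y, ‖planeWave (-z.2) y * (g (y - z.1) * ψ y)‖ₑ
      = ∫⁻ y, ((fun y => ‖g (y - z.1)‖ₑ) * fun y => ‖ψ y‖ₑ) y := by
        refine lintegral_congr fun y => ?_
        rw [enorm_mul, enorm_mul, enorm_planeWave, one_mul]; rfl
    _ ≤ lnorm volume 2 (fun y => ‖g (y - z.1)‖ₑ) * lnorm volume 2 (fun y => ‖ψ y‖ₑ) :=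
        ENNReal.lintegral_mul_le_Lp_mul_Lq volume Real.HolderConjugate.two_two hgm.aemeasurable
          hψ.1.enorm
    _ = _ := by
        have e : lnorm volume 2 (fun y => ‖g (y - z.1)‖ₑ) = eLpNorm g 2 volume := by
          rw [← lnorm_two_eq]
          unfold lnorm
          rw [lintegral_sub_right_eq_self (fun y => ‖g y‖ₑ ^ (2 : ℝ)) z.1]
        rw [e, lnorm_two_eq]

/-- Square integrable functions are limits of Schwartz functions. -/
theorem exists_schwartz_tendsto {ψ : Rn d → ℂ} (hψ : MemLp ψ 2) : ∃ φ : ℕ → 𝓢(Rn d, ℂ),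
    Filter.Tendsto (fun n => eLpNorm (fun y => φ n y - ψ y) 2 volume) Filter.atTop (nhds 0) := by
  have hd := denseRange_toLpCLM (E := Rn d) (F := ℂ) (μ := volume) (p := 2) (by simp)
  have h : ∀ n : ℕ, ∃ φ : 𝓢(Rn d, ℂ), dist (hψ.toLp ψ) (φ.toLp 2 volume) < 1 / ((n : ℝ) + 1) := by
    intro n
    obtain ⟨φ, hφ⟩ := hd.exists_dist_lt (hψ.toLp ψ) (Nat.one_div_pos_of_nat (α := ℝ) (n := n))
    exact ⟨φ, hφ⟩
  choose φ hφ using h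
  refine ⟨φ, ?_⟩
  have h1 : ∀ n, eLpNorm (fun y => φ n y - ψ y) 2 volume ≤
      ENNReal.ofReal (1 / ((n : ℝ) + 1)) := by
    intro n
    have h2 : eLpNorm (fun y => φ n y - ψ y) 2 volume =
        edist ((φ n).toLp 2 volume) (hψ.toLp ψ) := by
      rw [Lp.edist_def]
      refine eLpNorm_congr_ae ?_
      filter_upwards [(φ n).coeFn_toLp 2 volume, hψ.coeFn_toLp] with y h3 h4
      simp [h3, h4]
    rw [h2, edist_dist, dist_comm]
    exact ENNReal.ofReal_le_ofReal (hφ n).le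
  refine tendsto_of_tendsto_of_tendsto_of_le_of_le tendsto_const_nhds ?_ (fun n => zero_le) h1
  have := ENNReal.tendsto_ofReal (tendsto_one_div_add_atTop_nhds_zero_nat (𝕜 := ℝ))
  simpa using this

theorem lnorm_dualWindowed_schwartz (g φ : 𝓢(Rn d, ℂ)) :
    lnorm (volume.prod volume) 2 (fun z => ‖dualWindowed g φ z‖ₑ) =
      (ENNReal.ofReal ((2 * Real.pi) ^ (d : ℝ)) ^ (1 / 2 : ℝ) * eLpNorm g 2 volume) *
        eLpNorm φ 2 volume := by
  rw [lnorm, lintegral_dualWindowed_schwartz, ENNReal.mul_rpow_of_nonneg _ _ (by norm_num),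
    ENNReal.mul_rpow_of_nonneg _ _ (by norm_num), ← lnorm_two_eq, ← lnorm_two_eq]
  rfl

/-- The constant in the bound of the short-time Fourier transform on square integrable
functions. -/
def windowConst (g : 𝓢(Rn d, ℂ)) : ℝ≥0∞ :=
  ENNReal.ofReal ((2 * Real.pi) ^ (d : ℝ)) ^ (1 / 2 : ℝ) * eLpNorm g 2 volume

theorem windowConst_ne_top (g : 𝓢(Rn d, ℂ)) : windowConst g ≠ ∞ :=
  ENNReal.mul_ne_top (ENNReal.rpow_ne_top_of_nonneg (by norm_num) ENNReal.ofReal_ne_top)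
    (g.memLp 2 volume).eLpNorm_ne_top

/-- The orthogonality relation for Schwartz functions passes to `L²` by density, pointwise
convergence and Fatou's lemma; only the inequality survives, and only it is needed. -/
theorem lnorm_dualWindowed_le (g : 𝓢(Rn d, ℂ)) {ψ : Rn d → ℂ} (hψ : MemLp ψ 2) :
    lnorm (volume.prod volume) 2 (fun z => ‖dualWindowed g ψ z‖ₑ) ≤
      windowConst g * eLpNorm ψ 2 volume := by
  obtain ⟨φ, hφ⟩ := exists_schwartz_tendsto hψ
  have hφm : ∀ n, MemLp (φ n) 2 volume := fun n => (φ n).memLp 2 volume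
  have hsub : ∀ n, MemLp (fun y => φ n y - ψ y) 2 volume := fun n => (hφm n).sub hψ
  have hpt : ∀ z, Filter.Tendsto (fun n => ‖dualWindowed g (φ n) z‖ₑ ^ (2 : ℝ)) Filter.atTop
      (nhds (‖dualWindowed g ψ z‖ₑ ^ (2 : ℝ))) := by
    intro z
    have h1 : Filter.Tendsto (fun n => dualWindowed g (φ n) z) Filter.atTop
        (nhds (dualWindowed g ψ z)) := by
      rw [tendsto_iff_edist_tendsto_0]
      have h2 : Filter.Tendsto (fun n => eLpNorm g 2 volume *
          eLpNorm (fun y => φ n y - ψ y) 2 volume) Filter.atTop (nhds 0) := by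
        simpa using ENNReal.Tendsto.const_mul hφ (Or.inr (g.memLp 2 volume).eLpNorm_ne_top)
      refine tendsto_of_tendsto_of_tendsto_of_le_of_le tendsto_const_nhds h2
        (fun n => zero_le) (fun n => ?_)
      simp only []
      rw [edist_eq_enorm_sub, ← dualWindowed_sub g (hφm n) hψ]
      exact enorm_dualWindowed_le g (hsub n) z
    exact (ENNReal.continuous_rpow_const.tendsto _).comp h1.enorm
  have hnorm : Filter.Tendsto (fun n => eLpNorm (φ n) 2 volume) Filter.atTop
      (nhds (eLpNorm ψ 2 volume)) := by
    have h2 := (hφ.add_const (eLpNorm ψ 2 volume))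
    have h3 := (ENNReal.Tendsto.sub (tendsto_const_nhds (x := eLpNorm ψ 2 volume)) hφ
      (Or.inl hψ.eLpNorm_ne_top))
    rw [zero_add] at h2
    rw [tsub_zero] at h3
    refine tendsto_of_tendsto_of_tendsto_of_le_of_le h3 h2 (fun n => ?_) (fun n => ?_)
    · simp only []
      rw [tsub_le_iff_right]
      have : ψ = fun y => φ n y - (φ n y - ψ y) := by funext y; ring
      calc eLpNorm ψ 2 volume = eLpNorm (fun y => φ n y - (φ n y - ψ y)) 2 volume := by
            rw [← this]
        _ ≤ _ := eLpNorm_sub_le (hφm n).1 (hsub n).1 (by norm_num)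
    · have : (φ n : Rn d → ℂ) = fun y => (φ n y - ψ y) + ψ y := by funext y; ring
      calc eLpNorm (φ n) 2 volume = eLpNorm (fun y => (φ n y - ψ y) + ψ y) 2 volume := by
            rw [← this]
        _ ≤ _ := eLpNorm_add_le (hsub n).1 hψ.1 (by norm_num)
  rw [lnorm_le_iff two_pos]
  calc ∫⁻ z, ‖dualWindowed g ψ z‖ₑ ^ (2 : ℝ) ∂(volume.prod volume)
      = ∫⁻ z, Filter.liminf (fun n => ‖dualWindowed g (φ n) z‖ₑ ^ (2 : ℝ)) Filter.atTop
          ∂(volume.prod volume) := lintegral_congr fun z => ((hpt z).liminf_eq).symm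
    _ ≤ Filter.liminf (fun n => ∫⁻ z, ‖dualWindowed g (φ n) z‖ₑ ^ (2 : ℝ) ∂(volume.prod volume))
          Filter.atTop := lintegral_liminf_le fun n => (stronglyMeasurable_dualWindowed g
            (hφm n).1).measurable.enorm.pow_const _
    _ = Filter.liminf (fun n => (windowConst g * eLpNorm (φ n) 2 volume) ^ (2 : ℝ))
          Filter.atTop := by
        congr 1
        funext n
        rw [← lnorm_rpow two_pos, lnorm_dualWindowed_schwartz]; rfl
    _ = _ := by
        refine Filter.Tendsto.liminf_eq ?_
        exact (ENNReal.continuous_rpow_const.tendsto _).comp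
          (ENNReal.Tendsto.const_mul hnorm (Or.inr (windowConst_ne_top g)))

/-- The inversion constant. -/
def inversionConst (g : 𝓢(Rn d, ℂ)) : ℂ :=
  ((2 * Real.pi : ℂ) ^ d * ((∫ y, ‖g y‖ ^ 2 : ℝ) : ℂ))⁻¹

theorem enorm_tempered_le {g : 𝓢(Rn d, ℂ)} (hg : g ≠ 0) (T : 𝓢'(Rn d, ℂ)) (φ : 𝓢(Rn d, ℂ)) :
    ‖T φ‖ₑ ≤ ‖inversionConst g‖ₑ *
      ∫⁻ z, ‖stft g T z.1 z.2‖ₑ * ‖dualWindowed g φ z‖ₑ ∂(volume.prod volume) := by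
  have hc0 : (2 * Real.pi : ℂ) ^ d * ((∫ y, ‖g y‖ ^ 2 : ℝ) : ℂ) ≠ 0 := by
    refine mul_ne_zero (pow_ne_zero _ ?_) (by exact_mod_cast (integral_norm_sq_pos hg).ne')
    exact_mod_cast (by positivity : (2 * Real.pi : ℝ) ≠ 0)
  have h1 : T φ = inversionConst g • ∫ x, ∫ ξ, dualStft g φ x ξ • stft g T x ξ := by
    rw [inversionConst, eq_inv_smul_iff₀ hc0, tempered_inversion]
  have hm : Measurable fun z : Rn d × Rn d => ‖stft g T z.1 z.2‖ₑ * ‖dualWindowed g φ z‖ₑ :=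
    (measurable_stft g T).mul (stronglyMeasurable_dualWindowed g
      φ.continuous.aestronglyMeasurable).measurable.enorm
  rw [h1, enorm_smul, lintegral_prod _ hm.aemeasurable]
  refine mul_le_mul_right ((enorm_integral_le_lintegral_enorm _).trans (lintegral_mono fun x =>
    (enorm_integral_le_lintegral_enorm _).trans (lintegral_mono fun ξ => ?_))) _
  rw [enorm_smul, dualStft_eq_dualWindowed, mul_comm]

theorem lintegral_mul_le_lnorm {α : Type*} [MeasurableSpace α] {μ : Measure α}
    {a b : α → ℝ≥0∞} (ha : AEMeasurable a μ) (hb : AEMeasurable b μ) :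
    ∫⁻ z, a z * b z ∂μ ≤ lnorm μ 2 a * lnorm μ 2 b :=
  ENNReal.lintegral_mul_le_Lp_mul_Lq μ Real.HolderConjugate.two_two ha hb

theorem enorm_tempered_le_eLpNorm {g : 𝓢(Rn d, ℂ)} (hg : g ≠ 0) (T : 𝓢'(Rn d, ℂ))
    (φ : 𝓢(Rn d, ℂ)) :
    ‖T φ‖ₑ ≤ (‖inversionConst g‖ₑ * (lnorm (volume.prod volume) 2
      (fun z : Rn d × Rn d => ‖stft g T z.1 z.2‖ₑ) * windowConst g)) * eLpNorm φ 2 volume := by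
  refine (enorm_tempered_le hg T φ).trans ?_
  rw [mul_assoc, mul_assoc]
  refine mul_le_mul_right ((lintegral_mul_le_lnorm (measurable_stft g T).aemeasurable
    (stronglyMeasurable_dualWindowed g
      φ.continuous.aestronglyMeasurable).measurable.enorm.aemeasurable).trans ?_) _
  exact mul_le_mul_right (lnorm_dualWindowed_le g (φ.memLp 2 volume)) _

/-- A tempered distribution with square integrable short-time Fourier transform is a square
integrable function. -/
theorem exists_memLp_isGivenBy {g : 𝓢(Rn d, ℂ)} (hg : g ≠ 0) (T : 𝓢'(Rn d, ℂ))
    (hT : lnorm (volume.prod volume) 2 (fun z : Rn d × Rn d => ‖stft g T z.1 z.2‖ₑ) < ∞) :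
    ∃ f : Rn d → ℂ, MemLp f 2 ∧ IsGivenBy T f := by
  set K := ‖inversionConst g‖ₑ * (lnorm (volume.prod volume) 2
      (fun z : Rn d × Rn d => ‖stft g T z.1 z.2‖ₑ) * windowConst g) with hK
  have hKT : K ≠ ∞ := ENNReal.mul_ne_top enorm_ne_top
    (ENNReal.mul_ne_top hT.ne (windowConst_ne_top g))
  have hb : ∀ φ : 𝓢(Rn d, ℂ), ‖T φ‖ ≤ K.toReal * ‖toLpCLM ℂ ℂ 2 volume φ‖ := by
    intro φ
    have h1 := enorm_tempered_le_eLpNorm hg T φ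
    rw [← hK] at h1
    rw [toLpCLM_apply, norm_toLp, ← ENNReal.toReal_mul, ← toReal_enorm]
    exact ENNReal.toReal_mono (ENNReal.mul_ne_top hKT (φ.memLp 2 volume).eLpNorm_ne_top) h1
  -- `T` is bounded for the `L²` norm, so it extends to a functional on `L²`. The Riesz
  -- representation supplies `v`, and the function sought is its conjugate because the inner product
  -- conjugates its first slot.
  obtain ⟨L, hL⟩ := exists_clm_comp_eq_of_bound
    (toLpCLM ℂ ℂ 2 (volume : Measure (Rn d))).toLinearMap
    (T : 𝓢(Rn d, ℂ) →L[ℂ] ℂ).toLinearMap K.toReal hb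
  set v : Lp ℂ 2 (volume : Measure (Rn d)) := (InnerProductSpace.toDual ℂ _).symm L with hv
  have hf : MemLp (fun y => (starRingEnd ℂ) (v y)) 2 volume :=
    (Lp.memLp v).star
  refine ⟨fun y => (starRingEnd ℂ) (v y), hf, fun φ => ⟨?_, ?_⟩⟩
  · exact memLp_one_iff_integrable.1 (MemLp.smul (r := 1) hf (φ.memLp 2 volume))
  · have h1 : T φ = inner ℂ v (φ.toLp 2 volume) := by
      rw [hv, InnerProductSpace.toDual_symm_apply]
      exact (hL φ).symm
    rw [h1, L2.inner_def]
    refine integral_congr_ae ?_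
    filter_upwards [φ.coeFn_toLp 2 volume] with y hy
    rw [hy]
    simp

/-- The pairing of two square integrable functions is controlled by their short-time Fourier
transforms. -/
theorem enorm_integral_mul_le {g : 𝓢(Rn d, ℂ)} (hg : g ≠ 0) {T : 𝓢'(Rn d, ℂ)} {f : Rn d → ℂ}
    (h : IsGivenBy T f) (hf : MemLp f 2)
    (hT : lnorm (volume.prod volume) 2 (fun z : Rn d × Rn d => ‖stft g T z.1 z.2‖ₑ) < ∞)
    {ψ : Rn d → ℂ} (hψ : MemLp ψ 2) :
    ‖∫ y, ψ y * f y‖ₑ ≤ ‖inversionConst g‖ₑ *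
      ∫⁻ z, ‖stft g T z.1 z.2‖ₑ * ‖dualWindowed g ψ z‖ₑ ∂(volume.prod volume) := by
  obtain ⟨φ, hφ⟩ := exists_schwartz_tendsto hψ
  have hφm : ∀ n, MemLp (φ n) 2 volume := fun n => (φ n).memLp 2 volume
  have hsub : ∀ n, MemLp (fun y => φ n y - ψ y) 2 volume := fun n => (hφm n).sub hψ
  have hprod : ∀ {a : Rn d → ℂ}, MemLp a 2 volume → Integrable fun y => a y * f y := fun ha =>
    memLp_one_iff_integrable.1 (MemLp.smul (r := 1) hf ha)
  set V : Rn d × Rn d → ℝ≥0∞ := fun z => ‖stft g T z.1 z.2‖ₑ with hV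
  have hVm : Measurable V := measurable_stft g T
  have hWm : ∀ {a : Rn d → ℂ}, MemLp a 2 volume → Measurable fun z => ‖dualWindowed g a z‖ₑ :=
    fun ha => (stronglyMeasurable_dualWindowed g ha.1).measurable.enorm
  set Q := ∫⁻ z, V z * ‖dualWindowed g ψ z‖ₑ ∂(volume.prod volume) with hQ
  set κ := ‖inversionConst g‖ₑ with hκ
  have hκT : κ ≠ ∞ := enorm_ne_top
  set N := lnorm (volume.prod volume) 2 V with hN
  set N' := eLpNorm f 2 volume with hN'
  have hN'T : N' ≠ ∞ := hf.eLpNorm_ne_top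
  set e : ℕ → ℝ≥0∞ := fun n => eLpNorm (fun y => φ n y - ψ y) 2 volume with he
  -- For the Schwartz approximations the inversion formula applies; replacing `φ n` by `ψ` on both
  -- sides costs terms proportional to `e n`, which tends to zero.
  have hbound : ∀ n, ‖∫ y, ψ y * f y‖ₑ ≤
      κ * (Q + N * (windowConst g * e n)) + e n * N' := by
    intro n
    have h1 : ∫ y, ψ y * f y = T (φ n) - ∫ y, (φ n y - ψ y) * f y := by
      rw [(h (φ n)).2, ← integral_sub (h (φ n)).1 (hprod (hsub n))]
      refine integral_congr_ae (Filter.Eventually.of_forall fun y => ?_)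
      simp only [smul_eq_mul]
      ring
    rw [h1]
    refine (enorm_sub_le).trans (add_le_add ?_ ?_)
    · refine (enorm_tempered_le hg T (φ n)).trans (mul_le_mul_right ?_ _)
      have h2 : ∀ z, V z * ‖dualWindowed g (φ n) z‖ₑ ≤ V z * ‖dualWindowed g ψ z‖ₑ +
          V z * ‖dualWindowed g (fun y => φ n y - ψ y) z‖ₑ := by
        intro z
        rw [← mul_add]
        refine mul_le_mul_right ?_ _
        have h3 : dualWindowed g (φ n) z =
            dualWindowed g ψ z + dualWindowed g (fun y => φ n y - ψ y) z := by
          rw [dualWindowed_sub g (hφm n) hψ]; ring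
        rw [h3]
        exact enorm_add_le _ _
      refine (lintegral_mono h2).trans ?_
      have hm0 : Measurable fun z => V z * ‖dualWindowed g ψ z‖ₑ := hVm.mul (hWm hψ)
      rw [lintegral_add_left hm0]
      refine add_le_add le_rfl ((lintegral_mul_le_lnorm hVm.aemeasurable
        (hWm (hsub n)).aemeasurable).trans (mul_le_mul_right ?_ _))
      exact lnorm_dualWindowed_le g (hsub n)
    · refine (enorm_integral_le_lintegral_enorm _).trans ?_
      simp_rw [enorm_mul]
      refine (lintegral_mul_le_lnorm (hsub n).1.enorm hf.1.enorm).trans (le_of_eq ?_)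
      rw [lnorm_two_eq, lnorm_two_eq]
  have hlim : Filter.Tendsto (fun n => κ * (Q + N * (windowConst g * e n)) + e n * N')
      Filter.atTop (nhds (κ * (Q + N * (windowConst g * 0)) + 0 * N')) := by
    refine Filter.Tendsto.add ?_ (ENNReal.Tendsto.mul_const hφ (Or.inr hN'T))
    refine ENNReal.Tendsto.const_mul ?_ (Or.inr hκT)
    refine Filter.Tendsto.add tendsto_const_nhds ?_
    refine ENNReal.Tendsto.const_mul ?_ (Or.inr hT.ne)
    exact ENNReal.Tendsto.const_mul hφ (Or.inr (windowConst_ne_top g))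
  have := ge_of_tendsto' hlim hbound
  simpa using this

end SquareIntegrable

end

noncomputable section

set_option linter.unusedSectionVars false

/-! ### The Fourier transform of the density and its weighted integrability. -/

section Density

variable {d n : ℕ}

/-- The coordinates of a vector-valued tempered distribution. -/
def temperedCoord (T : 𝓢'(Rn d, EuclideanSpace ℂ (Fin n))) (k : Fin n) : 𝓢'(Rn d, ℂ) :=
  temperedComp (EuclideanSpace.proj k : EuclideanSpace ℂ (Fin n) →L[ℂ] ℂ) T

theorem enorm_coord_le (v : EuclideanSpace ℂ (Fin n)) (k : Fin n) : ‖v k‖ₑ ≤ ‖v‖ₑ := by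
  rw [← ofReal_norm, ← ofReal_norm]
  exact ENNReal.ofReal_le_ofReal (PiLp.norm_apply_le v k)

theorem enorm_stft_temperedCoord_le (g : 𝓢(Rn d, ℂ)) (T : 𝓢'(Rn d, EuclideanSpace ℂ (Fin n)))
    (k : Fin n) (x ξ : Rn d) : ‖stft g (temperedCoord T k) x ξ‖ₑ ≤ ‖stft g T x ξ‖ₑ :=
  enorm_coord_le (stft g T x ξ) k

theorem lnorm_stft_temperedCoord_le (g : 𝓢(Rn d, ℂ))
    (T : 𝓢'(Rn d, EuclideanSpace ℂ (Fin n))) (k : Fin n) :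
    lnorm (volume.prod volume) 2 (fun z : Rn d × Rn d => ‖stft g (temperedCoord T k) z.1 z.2‖ₑ) ≤
      lnorm (volume.prod volume) 2 (fun z : Rn d × Rn d => ‖stft g T z.1 z.2‖ₑ) :=
  lnorm_mono two_pos fun z => enorm_stft_temperedCoord_le g T k z.1 z.2

/-- A vector-valued tempered distribution with square integrable short-time Fourier transform is a
square integrable function. -/
theorem exists_memLp_isGivenBy_euclidean {g : 𝓢(Rn d, ℂ)} (hg : g ≠ 0)
    (T : 𝓢'(Rn d, EuclideanSpace ℂ (Fin n)))
    (hT : lnorm (volume.prod volume) 2 (fun z : Rn d × Rn d => ‖stft g T z.1 z.2‖ₑ) < ∞) :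
    ∃ f : Rn d → EuclideanSpace ℂ (Fin n), MemLp f 2 ∧ IsGivenBy T f := by
  choose f hf hfT using fun k => exists_memLp_isGivenBy hg (temperedCoord T k)
    ((lnorm_stft_temperedCoord_le g T k).trans_lt hT)
  have hsum : ∀ v : EuclideanSpace ℂ (Fin n),
      ∑ k, v k • (EuclideanSpace.single k 1 : EuclideanSpace ℂ (Fin n)) = v := by
    intro v
    ext j
    simp [Pi.single_apply]
  refine ⟨fun y => ∑ k, f k y • (EuclideanSpace.single k 1 : EuclideanSpace ℂ (Fin n)), ?_,
    fun φ => ?_⟩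
  · refine memLp_finsetSum _ fun k _ => ?_
    exact (ContinuousLinearMap.toSpanSingleton ℂ
      (EuclideanSpace.single k 1 : EuclideanSpace ℂ (Fin n))).comp_memLp' (hf k)
  · have hi : ∀ k, Integrable fun x =>
        (φ x • f k x) • (EuclideanSpace.single k 1 : EuclideanSpace ℂ (Fin n)) := fun k =>
      ((hfT k φ).1).smul_const _
    have he : (fun x => φ x • ∑ k, f k x • (EuclideanSpace.single k 1 :
        EuclideanSpace ℂ (Fin n))) = fun x => ∑ k, (φ x • f k x) • (EuclideanSpace.single k 1 :
        EuclideanSpace ℂ (Fin n)) := by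
      funext x
      rw [Finset.smul_sum]
      refine Finset.sum_congr rfl fun k _ => ?_
      rw [smul_assoc]
    simp only [he]
    refine ⟨integrable_finsetSum _ fun k _ => hi k, ?_⟩
    rw [integral_finsetSum _ fun k _ => hi k, ← hsum (T φ)]
    refine Finset.sum_congr rfl fun k _ => ?_
    rw [integral_smul_const, ← (hfT k φ).2]
    rfl

/-- Modulation by `ζ` becomes a shift in frequency and conjugation passes through the transform. -/
theorem dualWindowed_planeWave_mul_conj {T : 𝓢'(Rn d, ℂ)} {f : Rn d → ℂ} (h : IsGivenBy T f)
    (g : 𝓢(Rn d, ℂ)) (ζ x ξ : Rn d) :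
    dualWindowed g (fun y => planeWave ζ y * (starRingEnd ℂ) (f y)) (x, ξ) =
      (starRingEnd ℂ) (stft g T x (ξ - ζ)) := by
  rw [h.stft_eq, dualWindowed, ← integral_conj]
  refine integral_congr_ae (Filter.Eventually.of_forall fun y => ?_)
  simp only [smul_eq_mul, map_mul, Complex.conj_conj]
  have h1 : (starRingEnd ℂ) (planeWave (ξ - ζ) y) = planeWave (-ξ) y * planeWave ζ y := by
    rw [← planeWave_neg, ← planeWave_add]
    congr 1
    abel
  rw [h1]
  ring

/-- The pairing estimate with `ψ` equal to the modulated conjugate of `f₂`: the Fourier transform of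
a density is bounded by a correlation in phase space. -/
theorem enorm_integral_planeWave_mul_conj_le {g : 𝓢(Rn d, ℂ)} (hg : g ≠ 0)
    {T₁ T₂ : 𝓢'(Rn d, ℂ)} {f₁ f₂ : Rn d → ℂ} (h₁ : IsGivenBy T₁ f₁) (h₂ : IsGivenBy T₂ f₂)
    (hf₁ : MemLp f₁ 2) (hf₂ : MemLp f₂ 2)
    (hT : lnorm (volume.prod volume) 2 (fun z : Rn d × Rn d => ‖stft g T₁ z.1 z.2‖ₑ) < ∞)
    (ζ : Rn d) :
    ‖∫ y, planeWave ζ y * (starRingEnd ℂ) (f₂ y) * f₁ y‖ₑ ≤ ‖inversionConst g‖ₑ *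
      ∫⁻ z, ‖stft g T₁ z.1 z.2‖ₑ * ‖stft g T₂ z.1 (z.2 - ζ)‖ₑ ∂(volume.prod volume) := by
  have hp : Continuous (planeWave ζ) :=
    continuous_planeWave.comp (continuous_const.prodMk continuous_id)
  have hψ : MemLp (fun y => planeWave ζ y * (starRingEnd ℂ) (f₂ y)) 2 volume := by
    refine MemLp.of_le (hf₂.star) (hp.aestronglyMeasurable.mul hf₂.star.1)
      (Filter.Eventually.of_forall fun y => ?_)
    rw [norm_mul, norm_planeWave, one_mul]
    rfl
  refine (enorm_integral_mul_le hg h₁ hf₁ hT hψ).trans (le_of_eq ?_)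
  congr 1
  refine lintegral_congr fun z => ?_
  obtain ⟨x, ξ⟩ := z
  rw [dualWindowed_planeWave_mul_conj h₂]
  congr 1
  exact RCLike.enorm_conj _

theorem inner_eq_sum_coord (v w : EuclideanSpace ℂ (Fin n)) :
    (inner ℂ v w : ℂ) = ∑ k, (starRingEnd ℂ) (v k) * w k := by
  rw [PiLp.inner_apply]
  refine Finset.sum_congr rfl fun k _ => ?_
  rw [RCLike.inner_apply, mul_comm]

/-- Cauchy-Schwarz in `x` at fixed frequency leaves a correlation of functions of `ξ` alone. -/
theorem lintegral_prod_mul_le_lnorm {A₁ A₂ : Rn d × Rn d → ℝ≥0∞} (h₁ : Measurable A₁)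
    (h₂ : Measurable A₂) (ζ : Rn d) :
    ∫⁻ z : Rn d × Rn d, A₁ z * A₂ (z.1, z.2 - ζ) ∂(volume.prod volume) ≤
      ∫⁻ ξ, lnorm volume 2 (fun x => A₁ (x, ξ)) * lnorm volume 2 (fun x => A₂ (x, ξ - ζ)) := by
  have hm : Measurable fun z : Rn d × Rn d => A₁ z * A₂ (z.1, z.2 - ζ) :=
    h₁.mul (h₂.comp (measurable_fst.prodMk (measurable_snd.sub measurable_const)))
  rw [lintegral_prod_symm _ hm.aemeasurable]
  refine lintegral_mono fun ξ => ?_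
  have hs₁ : Measurable fun x => A₁ (x, ξ) := h₁.comp (measurable_id.prodMk measurable_const)
  have hs₂ : Measurable fun x => A₂ (x, ξ - ζ) :=
    h₂.comp (measurable_id.prodMk measurable_const)
  exact lintegral_mul_le_lnorm hs₁.aemeasurable hs₂.aemeasurable

/-- The Fourier transform of the `k`-th summand of the density. -/
theorem enorm_integral_planeWave_coord_le {g : 𝓢(Rn d, ℂ)} (hg : g ≠ 0)
    {T₁ T₂ : 𝓢'(Rn d, EuclideanSpace ℂ (Fin n))} {f₁ f₂ : Rn d → EuclideanSpace ℂ (Fin n)}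
    (h₁ : IsGivenBy T₁ f₁) (h₂ : IsGivenBy T₂ f₂) (hf₁ : MemLp f₁ 2) (hf₂ : MemLp f₂ 2)
    (hT : lnorm (volume.prod volume) 2 (fun z : Rn d × Rn d => ‖stft g T₁ z.1 z.2‖ₑ) < ∞)
    (ζ : Rn d) (k : Fin n) :
    ‖∫ y, planeWave ζ y * (starRingEnd ℂ) (f₂ y k) * f₁ y k‖ₑ ≤ ‖inversionConst g‖ₑ *
      ∫⁻ z, ‖stft g T₁ z.1 z.2‖ₑ * ‖stft g T₂ z.1 (z.2 - ζ)‖ₑ ∂(volume.prod volume) := by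
  have h₁' : IsGivenBy (temperedCoord T₁ k) fun y => f₁ y k := h₁.temperedComp _
  have h₂' : IsGivenBy (temperedCoord T₂ k) fun y => f₂ y k := h₂.temperedComp _
  have hf₁' : MemLp (fun y => f₁ y k) 2 volume :=
    (EuclideanSpace.proj k : EuclideanSpace ℂ (Fin n) →L[ℂ] ℂ).comp_memLp' hf₁
  have hf₂' : MemLp (fun y => f₂ y k) 2 volume :=
    (EuclideanSpace.proj k : EuclideanSpace ℂ (Fin n) →L[ℂ] ℂ).comp_memLp' hf₂
  refine (enorm_integral_planeWave_mul_conj_le hg h₁' h₂' hf₁' hf₂'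
    ((lnorm_stft_temperedCoord_le g T₁ k).trans_lt hT) ζ).trans (mul_le_mul_right ?_ _)
  exact lintegral_mono fun z => mul_le_mul' (enorm_stft_temperedCoord_le g T₁ k z.1 z.2)
    (enorm_stft_temperedCoord_le g T₂ k z.1 (z.2 - ζ))

/-- The Fourier transform of the density. -/
theorem enorm_integral_planeWave_inner_le {g : 𝓢(Rn d, ℂ)} (hg : g ≠ 0)
    {T₁ T₂ : 𝓢'(Rn d, EuclideanSpace ℂ (Fin n))} {f₁ f₂ : Rn d → EuclideanSpace ℂ (Fin n)}
    (h₁ : IsGivenBy T₁ f₁) (h₂ : IsGivenBy T₂ f₂) (hf₁ : MemLp f₁ 2) (hf₂ : MemLp f₂ 2)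
    (hT : lnorm (volume.prod volume) 2 (fun z : Rn d × Rn d => ‖stft g T₁ z.1 z.2‖ₑ) < ∞)
    (ζ : Rn d) :
    ‖∫ y, planeWave ζ y * (inner ℂ (f₂ y) (f₁ y) : ℂ)‖ₑ ≤ (n * ‖inversionConst g‖ₑ) *
      ∫⁻ ξ, (lnorm volume 2 fun x => ‖stft g T₁ x ξ‖ₑ) *
        lnorm volume 2 fun x => ‖stft g T₂ x (ξ - ζ)‖ₑ := by
  have hk : ∀ k, ‖∫ y, planeWave ζ y * (starRingEnd ℂ) (f₂ y k) * f₁ y k‖ₑ ≤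
      ‖inversionConst g‖ₑ * ∫⁻ ξ, (lnorm volume 2 fun x => ‖stft g T₁ x ξ‖ₑ) *
        lnorm volume 2 fun x => ‖stft g T₂ x (ξ - ζ)‖ₑ := fun k =>
    (enorm_integral_planeWave_coord_le hg h₁ h₂ hf₁ hf₂ hT ζ k).trans (mul_le_mul_right
      (lintegral_prod_mul_le_lnorm (measurable_stft g T₁) (measurable_stft g T₂) ζ) _)
  have hi : ∀ k, Integrable fun y => planeWave ζ y * (starRingEnd ℂ) (f₂ y k) * f₁ y k := by
    intro k
    have hp : Continuous (planeWave ζ) :=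
      continuous_planeWave.comp (continuous_const.prodMk continuous_id)
    have h3 : MemLp (fun y => f₁ y k) 2 volume :=
      (EuclideanSpace.proj k : EuclideanSpace ℂ (Fin n) →L[ℂ] ℂ).comp_memLp' hf₁
    have h4 : MemLp (fun y => (starRingEnd ℂ) (f₂ y k)) 2 volume :=
      ((EuclideanSpace.proj k : EuclideanSpace ℂ (Fin n) →L[ℂ] ℂ).comp_memLp' hf₂).star
    have h5 : Integrable fun y => (starRingEnd ℂ) (f₂ y k) * f₁ y k :=
      memLp_one_iff_integrable.1 (MemLp.smul (r := 1) h3 h4)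
    simp_rw [mul_assoc]
    exact h5.bdd_mul (c := 1) hp.aestronglyMeasurable
      (Filter.Eventually.of_forall fun y => (norm_planeWave _ _).le)
  have e1 : ∫ y, planeWave ζ y * (inner ℂ (f₂ y) (f₁ y) : ℂ) =
      ∑ k, ∫ y, planeWave ζ y * (starRingEnd ℂ) (f₂ y k) * f₁ y k := by
    rw [← integral_finsetSum _ fun k _ => hi k]
    refine integral_congr_ae (Filter.Eventually.of_forall fun y => ?_)
    simp only [inner_eq_sum_coord, Finset.mul_sum, mul_assoc]
  rw [e1]
  refine (enorm_sum_le _ _).trans ((Finset.sum_le_sum fun k _ => hk k).trans (le_of_eq ?_))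
  rw [Finset.sum_const, Finset.card_univ, Fintype.card_fin, nsmul_eq_mul, mul_assoc]

/-- The Riesz potential of the Fourier transform of the density is absolutely integrable. -/
theorem exists_lintegral_rieszKernel_correlation_le {γ : ℝ} (hγ : 0 < γ) (hγd : γ < d) :
    ∃ C : ℝ≥0, ∀ N₁ N₂ : Rn d → ℝ≥0∞, Measurable N₁ → Measurable N₂ →
      ∫⁻ ζ, rieszKernel (d - γ) ζ * ∫⁻ ξ, N₁ ξ * N₂ (ξ - ζ) ≤
        C * (lnorm volume (2 * d / (d + γ)) N₁ * lnorm volume (2 * d / (d + γ)) N₂) := by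
  obtain ⟨C, hC⟩ := exists_hardy_littlewood_sobolev hγ hγd
  refine ⟨C, fun N₁ N₂ h₁ h₂ => le_of_eq_of_le ?_ (hC N₁ N₂ h₁ h₂)⟩
  have hm : Measurable fun z : Rn d × Rn d =>
      rieszKernel (d - γ) z.1 * (N₁ z.2 * N₂ (z.2 - z.1)) :=
    ((measurable_rieszKernel _).comp measurable_fst).mul
      ((h₁.comp measurable_snd).mul (h₂.comp (measurable_snd.sub measurable_fst)))
  have e1 : ∫⁻ ζ, rieszKernel (d - γ) ζ * ∫⁻ ξ, N₁ ξ * N₂ (ξ - ζ) =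
      ∫⁻ ξ, ∫⁻ ζ, rieszKernel (d - γ) ζ * (N₁ ξ * N₂ (ξ - ζ)) := by
    rw [← lintegral_lintegral_swap hm.aemeasurable]
    refine lintegral_congr fun ζ => ?_
    rw [lintegral_const_mul' _ _ (rieszKernel_ne_top _ ζ)]
  rw [e1]
  refine lintegral_congr fun ξ => ?_
  -- The substitution `η = ξ - ζ` turns the correlation into the bilinear Hardy-Littlewood-Sobolev
  -- form.
  rw [← lintegral_sub_left_eq_self (fun ζ => rieszKernel (d - γ) ζ * (N₁ ξ * N₂ (ξ - ζ))) ξ]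
  refine lintegral_congr fun η => ?_
  rw [sub_sub_cancel]
  ring

end Density

/-! ### Finiteness almost everywhere of the potential of an integrable density. -/

section LocalPotential

variable {d : ℕ}

/-- The potential of an integrable function is finite almost everywhere. -/
theorem ae_lintegral_rieszKernel_lt_top {γ : ℝ} (hγ : 0 < γ) (hγd : γ < d) {ρ : Rn d → ℂ}
    (hρ : Integrable ρ) : ∀ᵐ x, ∫⁻ t, rieszKernel γ t * ‖ρ (x - t)‖ₑ < ∞ := by
  have hd : (0 : ℝ) < d := hγ.trans hγd
  have hmn : MeasurableSet {z : Rn d | ‖z‖ ≤ 1} := measurableSet_le measurable_norm measurable_const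
  have hcompl : {z : Rn d | ‖z‖ ≤ 1}ᶜ = {z : Rn d | 1 < ‖z‖} := by ext z; simp
  set k : Rn d → ℝ≥0∞ := {z : Rn d | ‖z‖ ≤ 1}.indicator (rieszKernel γ) with hk
  have hkm : Measurable k := (measurable_rieszKernel γ).indicator hmn
  -- An integrable part near the origin plus a part bounded by one. Convolution with the first
  -- preserves `L¹`, and the second contributes at most the `L¹` norm at every point.
  have hk1 : ∀ t, rieszKernel γ t ≤ k t + 1 := by
    intro t
    by_cases ht : ‖t‖ ≤ 1
    · have : k t = rieszKernel γ t := Set.indicator_of_mem (s := {z : Rn d | ‖z‖ ≤ 1}) ht _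
      rw [this]; exact le_self_add
    · refine le_add_left ?_
      rw [rieszKernel, ← ENNReal.ofReal_one]
      exact ENNReal.ofReal_le_ofReal
        (Real.rpow_le_one_of_one_le_of_nonpos (not_le.1 ht).le (by linarith))
  have hmeas : AEMeasurable (fun z : Rn d × Rn d => k z.2 * ‖ρ (z.1 - z.2)‖ₑ)
      (volume.prod volume) :=
    (hkm.comp measurable_snd).aemeasurable.mul (hρ.1.comp_quasiMeasurePreserving
      (quasiMeasurePreserving_sub_of_right_invariant volume volume)).enorm
  have hfin : ∫⁻ x, ∫⁻ t, k t * ‖ρ (x - t)‖ₑ < ∞ := by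
    rw [lintegral_lintegral_swap hmeas]
    have e1 : ∀ t, ∫⁻ x, k t * ‖ρ (x - t)‖ₑ = k t * ∫⁻ x, ‖ρ x‖ₑ := by
      intro t
      have hkt : k t ≠ ∞ := by
        refine ne_top_of_le_ne_top (rieszKernel_ne_top γ t) ?_
        exact Set.indicator_le_self _ _ t
      rw [lintegral_const_mul' _ _ hkt, lintegral_sub_right_eq_self (fun x => ‖ρ x‖ₑ) t]
    simp_rw [e1]
    rw [lintegral_mul_const _ hkm, hk, lintegral_indicator hmn]
    exact ENNReal.mul_lt_top (setLIntegral_rieszKernel_near_lt_top (by exact_mod_cast hd) hγd) hρ.2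
  have hm2 : AEMeasurable (fun x => ∫⁻ t, k t * ‖ρ (x - t)‖ₑ) volume := hmeas.lintegral_prod_right'
  filter_upwards [ae_lt_top' hm2 hfin.ne] with x hx
  have hqmp : Measure.QuasiMeasurePreserving (fun t : Rn d => x - t) volume volume :=
    (Measure.measurePreserving_sub_left volume x).quasiMeasurePreserving
  calc ∫⁻ t, rieszKernel γ t * ‖ρ (x - t)‖ₑ
      ≤ ∫⁻ t, (k t * ‖ρ (x - t)‖ₑ + ‖ρ (x - t)‖ₑ) := by
        refine lintegral_mono fun t => ?_
        refine (mul_le_mul_left (hk1 t) _).trans (le_of_eq ?_)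
        ring
    _ = (∫⁻ t, k t * ‖ρ (x - t)‖ₑ) + ∫⁻ t, ‖ρ (x - t)‖ₑ :=
        lintegral_add_right' _ (hρ.1.comp_quasiMeasurePreserving hqmp).enorm
    _ < ∞ := by
        rw [lintegral_sub_left_eq_self (fun y => ‖ρ y‖ₑ) x]
        exact ENNReal.add_lt_top.2 ⟨hx, hρ.2⟩

end LocalPotential

end

noncomputable section

set_option linter.unusedSectionVars false

/-! ### Fourier representation of the potential through Gaussians. -/

section GaussianSuperposition

variable {d : ℕ}

/-- The inverse Fourier transform of `exp(-t ‖z‖²)`, up to normalization. -/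
def heatKernel (t : ℝ) (ζ : Rn d) : ℝ :=
  (4 * Real.pi * t) ^ (-(d / 2 : ℝ)) * Real.exp (-(‖ζ‖ ^ 2 / (4 * t)))

theorem heatKernel_nonneg {t : ℝ} (ht : 0 < t) (ζ : Rn d) : 0 ≤ heatKernel t ζ := by
  unfold heatKernel
  positivity

theorem heat_integrand_eq (t : ℝ) (z ζ : Rn d) :
    (heatKernel t ζ : ℂ) * planeWave (-ζ) z =
      (((4 * Real.pi * t) ^ (-(d / 2 : ℝ)) : ℝ) : ℂ) *
        Complex.exp (-((1 / (4 * t) : ℝ) : ℂ) * ‖ζ‖ ^ 2 + Complex.I * (inner ℝ z ζ : ℝ)) := by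
  rw [heatKernel, planeWave, Complex.ofReal_mul, mul_assoc, Complex.ofReal_exp, ← Complex.exp_add]
  congr 2
  rw [inner_neg_right]
  push_cast
  ring

theorem integrable_heat {t : ℝ} (ht : 0 < t) (z : Rn d) :
    Integrable fun ζ => (heatKernel t ζ : ℂ) * planeWave (-ζ) z := by
  simp_rw [heat_integrand_eq]
  refine Integrable.const_mul ?_ _
  exact GaussianFourier.integrable_cexp_neg_mul_sq_norm_add
    (by rw [Complex.ofReal_re]; positivity) Complex.I z

theorem integrable_heatKernel {t : ℝ} (ht : 0 < t) :
    Integrable (heatKernel t : Rn d → ℝ) := by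
  have h := (integrable_heat (d := d) ht 0).norm
  refine h.congr (Filter.Eventually.of_forall fun ζ => ?_)
  simp only []
  rw [norm_mul, norm_planeWave, mul_one, Complex.norm_real,
    Real.norm_of_nonneg (heatKernel_nonneg ht ζ)]

theorem integral_heat {t : ℝ} (ht : 0 < t) (z : Rn d) :
    ∫ ζ, (heatKernel t ζ : ℂ) * planeWave (-ζ) z = (Real.exp (-(‖z‖ ^ 2 * t)) : ℂ) := by
  simp_rw [heat_integrand_eq]
  rw [integral_const_mul, GaussianFourier.integral_cexp_neg_mul_sq_norm_add
    (by rw [Complex.ofReal_re]; positivity) Complex.I z]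
  have h1 : (Real.pi / ((1 / (4 * t) : ℝ) : ℂ)) ^ (Module.finrank ℝ (Rn d) / 2 : ℂ) =
      (((4 * Real.pi * t) ^ (d / 2 : ℝ) : ℝ) : ℂ) := by
    rw [Complex.ofReal_cpow (by positivity)]
    have : (Module.finrank ℝ (Rn d)) = d := by simp
    rw [this]
    congr 1
    · push_cast
      field_simp
    · push_cast; ring
  rw [h1, ← mul_assoc, ← Complex.ofReal_mul, ← Real.rpow_add (by positivity), neg_add_cancel,
    Real.rpow_zero, Complex.ofReal_one, one_mul, Complex.ofReal_exp]
  congr 1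
  have ht' : (t : ℂ) ≠ 0 := by exact_mod_cast ht.ne'
  rw [Complex.I_sq]
  push_cast
  field_simp

/-- A Gamma integral. Since Gaussians have explicit transforms, writing the kernel as a
superposition of them gives its Fourier transform through absolutely convergent integrals. -/
theorem integral_gaussian_superposition {γ : ℝ} (hγ : 0 < γ) {z : Rn d} (hz : z ≠ 0) :
    ∫ t in Set.Ioi (0 : ℝ), t ^ (γ / 2 - 1) * Real.exp (-(‖z‖ ^ 2 * t)) =
      Real.Gamma (γ / 2) * ‖z‖ ^ (-γ) := by
  have hz' : 0 < ‖z‖ := norm_pos_iff.2 hz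
  rw [Real.integral_rpow_mul_exp_neg_mul_Ioi (by positivity) (by positivity), mul_comm, one_div,
    ← Real.rpow_two, ← Real.rpow_neg hz'.le, ← Real.rpow_mul hz'.le]
  congr 2
  ring

/-- The constant in the superposition of heat kernels. -/
def heatConst (d : ℕ) (γ : ℝ) : ℝ :=
  (4 * Real.pi) ^ (-(d / 2 : ℝ)) * (4 ^ ((d - γ) / 2) * Real.Gamma ((d - γ) / 2))

theorem heatConst_pos {γ : ℝ} (hγd : γ < d) : 0 < heatConst d γ := by
  have : 0 < Real.Gamma ((d - γ) / 2) := Real.Gamma_pos_of_pos (by linarith)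
  unfold heatConst
  positivity

/-- The substitution `t = 1 / x` turns the superposition of heat kernels into a Gamma integral of
parameter `(d - γ) / 2`. -/
theorem integral_heat_superposition {γ : ℝ} (hγd : γ < d) {ζ : Rn d} (hζ : ζ ≠ 0) :
    ∫ t in Set.Ioi (0 : ℝ), t ^ (γ / 2 - 1) * heatKernel t ζ =
      heatConst d γ * ‖ζ‖ ^ (-(d - γ)) := by
  have hz' : 0 < ‖ζ‖ := norm_pos_iff.2 hζ
  rw [← integral_comp_rpow_Ioi (fun t => t ^ (γ / 2 - 1) * heatKernel t ζ)
    (by norm_num : (-1 : ℝ) ≠ 0)]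
  have h1 : ∀ x ∈ Set.Ioi (0 : ℝ), (|(-1 : ℝ)| * x ^ ((-1 : ℝ) - 1)) •
      ((x ^ (-1 : ℝ)) ^ (γ / 2 - 1) * heatKernel (x ^ (-1 : ℝ)) ζ) =
      (4 * Real.pi) ^ (-(d / 2 : ℝ)) *
        (x ^ ((d - γ) / 2 - 1) * Real.exp (-(‖ζ‖ ^ 2 / 4 * x))) := by
    intro x hx
    have hx : 0 < x := hx
    rw [heatKernel, Real.mul_rpow (by positivity) (by positivity), abs_neg, abs_one, one_mul,
      smul_eq_mul, ← Real.rpow_mul hx.le, ← Real.rpow_mul hx.le]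
    have e1 : x ^ ((d - γ) / 2 - 1) =
        x ^ ((-1 : ℝ) - 1) * (x ^ (-1 * (γ / 2 - 1)) * x ^ (-1 * (-(d / 2 : ℝ)))) := by
      rw [← Real.rpow_add hx, ← Real.rpow_add hx]
      congr 1
      ring
    have e2 : ‖ζ‖ ^ 2 / (4 * x ^ (-1 : ℝ)) = ‖ζ‖ ^ 2 / 4 * x := by
      rw [Real.rpow_neg_one]
      field_simp
    rw [e1, e2]
    ring
  rw [setIntegral_congr_fun measurableSet_Ioi h1, integral_const_mul,
    Real.integral_rpow_mul_exp_neg_mul_Ioi (by linarith) (by positivity), heatConst]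
  have e3 : (1 / (‖ζ‖ ^ 2 / 4)) ^ ((d - γ) / 2) = 4 ^ ((d - γ) / 2) * ‖ζ‖ ^ (-(d - γ)) := by
    rw [one_div_div, Real.div_rpow (by norm_num) (by positivity), ← Real.rpow_two,
      ← Real.rpow_mul hz'.le, Real.rpow_neg hz'.le, div_eq_mul_inv]
    congr 3
    ring
  rw [e3]
  ring

theorem lintegral_enorm_of_integral_eq {k : ℝ → ℝ} (h0 : ∀ t, 0 < t → 0 ≤ k t) {c : ℝ}
    (hc : 0 < c) (h : ∫ t in Set.Ioi (0 : ℝ), k t = c) :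
    ∫⁻ t in Set.Ioi (0 : ℝ), ‖k t‖ₑ = ENNReal.ofReal c := by
  -- A non-zero Bochner integral forces integrability, as the integral of a non-integrable function
  -- is zero by convention.
  have hi : IntegrableOn k (Set.Ioi 0) := .of_integral_ne_zero (by rw [h]; exact hc.ne')
  rw [← h, ofReal_integral_eq_lintegral_ofReal hi
    ((ae_restrict_iff' measurableSet_Ioi).2 (Filter.Eventually.of_forall fun t ht => h0 t ht))]
  refine setLIntegral_congr_fun measurableSet_Ioi fun t ht => ?_
  exact Real.enorm_of_nonneg (h0 t ht)

/-- Fubini's theorem for a superposition of kernels. -/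
theorem integral_superposition_swap {k : ℝ → Rn d → ℝ} (hk : Measurable (Function.uncurry k))
    (h0 : ∀ t, 0 < t → ∀ z, 0 ≤ k t z) {κ : Rn d → ℝ}
    (hκ : ∀ᵐ z : Rn d, 0 < κ z ∧ ∫ t in Set.Ioi (0 : ℝ), k t z = κ z) {h : Rn d → ℂ}
    (hh : AEStronglyMeasurable h) (hfin : ∫⁻ z, ENNReal.ofReal (κ z) * ‖h z‖ₑ < ∞) :
    ∫ z, (κ z : ℂ) * h z = ∫ t in Set.Ioi (0 : ℝ), ∫ z, (k t z : ℂ) * h z := by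
  have hmeas : AEStronglyMeasurable (fun w : Rn d × ℝ => (k w.2 w.1 : ℂ) * h w.1)
      (volume.prod (volume.restrict (Set.Ioi 0))) := by
    refine AEStronglyMeasurable.mul ?_ hh.comp_fst
    exact (Complex.measurable_ofReal.comp
      (hk.comp (measurable_snd.prodMk measurable_fst))).aestronglyMeasurable
  have hint : Integrable (fun w : Rn d × ℝ => (k w.2 w.1 : ℂ) * h w.1)
      (volume.prod (volume.restrict (Set.Ioi 0))) := by
    refine ⟨hmeas, ?_⟩
    rw [HasFiniteIntegral, lintegral_prod _ hmeas.enorm]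
    refine lt_of_eq_of_lt (lintegral_congr_ae ?_) hfin
    filter_upwards [hκ] with z hz
    simp only [enorm_mul]
    rw [lintegral_mul_const' _ _ enorm_ne_top]
    congr 1
    rw [← lintegral_enorm_of_integral_eq (fun t ht => h0 t ht z) hz.1 hz.2]
    refine lintegral_congr fun t => ?_
    rw [← ofReal_norm, Complex.norm_real, ofReal_norm]
  rw [← integral_integral_swap (f := fun z t => (k t z : ℂ) * h z) hint]
  refine integral_congr_ae ?_
  filter_upwards [hκ] with z hz
  rw [integral_mul_const, ← hz.2]
  congr 1
  exact integral_ofReal.symm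

theorem measurable_heatKernel : Measurable fun w : ℝ × Rn d => heatKernel w.1 w.2 := by
  unfold heatKernel
  fun_prop

/-- The Gaussian average of an integrable function in terms of its Fourier transform. -/
theorem integral_gaussian_mul {t : ℝ} (ht : 0 < t) {ρ : Rn d → ℂ} (hρ : Integrable ρ) (x : Rn d) :
    ∫ z, ((Real.exp (-(‖z‖ ^ 2 * t)) : ℝ) : ℂ) * ρ (x - z) =
      ∫ ζ, (heatKernel t ζ : ℂ) * (planeWave (-ζ) x * ∫ y, planeWave ζ y * ρ y) := by
  have hρx : Integrable fun z => ρ (x - z) := hρ.comp_sub_left x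
  have hprod : Integrable (fun w : Rn d × Rn d => (heatKernel t w.2 : ℂ) * planeWave (-w.2) w.1 *
      ρ (x - w.1)) (volume.prod volume) := by
    have h1 : Integrable (fun w : Rn d × Rn d => ρ (x - w.1) * (heatKernel t w.2 : ℂ))
        (volume.prod volume) := hρx.mul_prod (integrable_heatKernel ht).ofReal
    have hc : Continuous fun w : Rn d × Rn d => planeWave (-w.2) w.1 :=
      continuous_planeWave.comp (by fun_prop : Continuous fun w : Rn d × Rn d =>
        ((-w.2, w.1) : Rn d × Rn d))
    have h2 := h1.bdd_mul (c := 1) hc.aestronglyMeasurable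
      (Filter.Eventually.of_forall fun w => (norm_planeWave _ _).le)
    refine h2.congr (Filter.Eventually.of_forall fun w => ?_)
    simp only []
    ring
  calc ∫ z, ((Real.exp (-(‖z‖ ^ 2 * t)) : ℝ) : ℂ) * ρ (x - z)
      = ∫ z, ∫ ζ, (heatKernel t ζ : ℂ) * planeWave (-ζ) z * ρ (x - z) := by
        refine integral_congr_ae (Filter.Eventually.of_forall fun z => ?_)
        simp only []
        rw [integral_mul_const, integral_heat ht]
    _ = ∫ ζ, ∫ z, (heatKernel t ζ : ℂ) * planeWave (-ζ) z * ρ (x - z) :=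
        integral_integral_swap hprod
    _ = _ := by
        refine integral_congr_ae (Filter.Eventually.of_forall fun ζ => ?_)
        simp only [mul_assoc]
        rw [integral_const_mul]
        congr 1
        rw [← integral_const_mul,
          ← integral_sub_left_eq_self (fun y => planeWave (-ζ) x * (planeWave ζ y * ρ y)) volume x]
        refine integral_congr_ae (Filter.Eventually.of_forall fun z => ?_)
        simp only []
        have h3 : planeWave (-ζ) z = planeWave ζ (-z) := by simp [planeWave]
        rw [← mul_assoc, sub_eq_add_neg, planeWave_add_right, ← mul_assoc, ← planeWave_add,
          neg_add_cancel, planeWave_zero, one_mul, h3]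

theorem aestronglyMeasurable_integral_planeWave {ρ : Rn d → ℂ} (hρ : AEStronglyMeasurable ρ) :
    AEStronglyMeasurable fun ζ => ∫ y, planeWave ζ y * ρ y := by
  have hpc : Continuous fun w : Rn d × Rn d => planeWave w.1 w.2 := continuous_planeWave
  have h2 : AEStronglyMeasurable (fun w : Rn d × Rn d => planeWave w.1 w.2 * ρ w.2)
      (volume.prod volume) := hpc.aestronglyMeasurable.mul hρ.comp_snd
  exact h2.integral_prod_right'

/-- The Fourier representation of the potential `|·|^{-γ} ∗ ρ`. -/
theorem coulomb_potential_eq {γ : ℝ} (hγ : 0 < γ) (hγd : γ < d) {ρ : Rn d → ℂ}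
    (hρ : Integrable ρ)
    (hm : ∫⁻ ζ, rieszKernel (d - γ) ζ * ‖∫ y, planeWave ζ y * ρ y‖ₑ < ∞) {x : Rn d}
    (hx : ∫⁻ z, rieszKernel γ z * ‖ρ (x - z)‖ₑ < ∞) :
    ∫ z, coulomb d γ z • ρ (x - z) = ∫ ζ, planeWave (-ζ) x *
      (((heatConst d γ / Real.Gamma (γ / 2) * ‖ζ‖ ^ (-(d - γ)) : ℝ) : ℂ) *
        ∫ y, planeWave ζ y * ρ y) := by
  have hd : (0 : ℝ) < d := hγ.trans hγd
  have : Nonempty (Fin d) := ⟨⟨0, by exact_mod_cast hd⟩⟩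
  have : Nontrivial (Rn d) := inferInstance
  have hne : ∀ᵐ z : Rn d, z ≠ 0 := Measure.ae_ne volume 0
  set Γ := Real.Gamma (γ / 2) with hΓ
  have hΓ0 : 0 < Γ := Real.Gamma_pos_of_pos (by linarith)
  have hH := heatConst_pos hγd
  have hρ' : AEStronglyMeasurable (fun ζ => planeWave (-ζ) x * ∫ y, planeWave ζ y * ρ y) volume := by
    have h1 : Continuous fun ζ => planeWave (-ζ) x :=
      continuous_planeWave.comp (by fun_prop : Continuous fun ζ : Rn d => ((-ζ, x) : Rn d × Rn d))
    exact h1.aestronglyMeasurable.mul (aestronglyMeasurable_integral_planeWave hρ.1)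
  -- `e1` resolves `|z|^{-γ}` into Gaussians and `e2` resolves `|ζ|^{-(d-γ)}` into heat kernels. For
  -- each `t` the two integrands agree by `integral_gaussian_mul`, and the hypotheses `hx` and `hm`
  -- justify the two exchanges of integrals.
  have e1 := integral_superposition_swap
    (k := fun t (z : Rn d) => t ^ (γ / 2 - 1) * Real.exp (-(‖z‖ ^ 2 * t)))
    (κ := fun z => Γ * ‖z‖ ^ (-γ)) (h := fun z => ρ (x - z))
    (by unfold Function.uncurry; fun_prop) (fun t ht z => by positivity)
    (by
      filter_upwards [hne] with z hz
      have : 0 < ‖z‖ := norm_pos_iff.2 hz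
      exact ⟨by positivity, integral_gaussian_superposition hγ hz⟩)
    (hρ.comp_sub_left x).1
    (by
      simp_rw [ENNReal.ofReal_mul hΓ0.le, mul_assoc]
      rw [lintegral_const_mul' _ _ ENNReal.ofReal_ne_top]
      exact ENNReal.mul_lt_top ENNReal.ofReal_lt_top hx)
  have e2 := integral_superposition_swap
    (k := fun t (ζ : Rn d) => t ^ (γ / 2 - 1) * heatKernel t ζ)
    (κ := fun ζ => heatConst d γ * ‖ζ‖ ^ (-(d - γ)))
    (h := fun ζ => planeWave (-ζ) x * ∫ y, planeWave ζ y * ρ y)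
    ((measurable_fst.pow_const _).mul measurable_heatKernel)
    (fun t ht ζ => mul_nonneg (by positivity) (heatKernel_nonneg ht ζ))
    (by
      filter_upwards [hne] with z hz
      have : 0 < ‖z‖ := norm_pos_iff.2 hz
      exact ⟨by positivity, integral_heat_superposition hγd hz⟩)
    hρ'
    (by
      simp_rw [ENNReal.ofReal_mul hH.le, mul_assoc, enorm_mul, enorm_planeWave, one_mul]
      rw [lintegral_const_mul' _ _ ENNReal.ofReal_ne_top]
      exact ENNReal.mul_lt_top ENNReal.ofReal_lt_top hm)
  have e3 : ∫ z, ((Γ * ‖z‖ ^ (-γ) : ℝ) : ℂ) * ρ (x - z) =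
      ∫ ζ, ((heatConst d γ * ‖ζ‖ ^ (-(d - γ)) : ℝ) : ℂ) *
        (planeWave (-ζ) x * ∫ y, planeWave ζ y * ρ y) := by
    rw [e1, e2]
    refine setIntegral_congr_fun measurableSet_Ioi fun t ht => ?_
    simp only [Complex.ofReal_mul, mul_assoc]
    rw [integral_const_mul, integral_const_mul, integral_gaussian_mul ht hρ]
  have hΓc : (Γ : ℂ) ≠ 0 := by exact_mod_cast hΓ0.ne'
  have e4 : ∫ z, coulomb d γ z • ρ (x - z) =
      (Γ : ℂ)⁻¹ * ∫ z, ((Γ * ‖z‖ ^ (-γ) : ℝ) : ℂ) * ρ (x - z) := by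
    rw [← integral_const_mul]
    refine integral_congr_ae (Filter.Eventually.of_forall fun z => ?_)
    simp only [coulomb, Complex.real_smul, Complex.ofReal_mul, ← mul_assoc]
    rw [inv_mul_cancel₀ hΓc, one_mul]
  rw [e4, e3, ← integral_const_mul]
  refine integral_congr_ae (Filter.Eventually.of_forall fun ζ => ?_)
  simp only [Complex.ofReal_mul, Complex.ofReal_div]
  ring

end GaussianSuperposition

end

noncomputable section

set_option linter.unusedSectionVars false

/-! ### Multiplication by functions with integrable Fourier transform. -/

section FourierMultiplier

variable {d : ℕ} {F : Type} [NormedAddCommGroup F] [NormedSpace ℂ F] [CompleteSpace F]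

/-- Young's inequality for convolution in the frequency variable, in mixed norms. -/
theorem lnorm_lnorm_lintegral_mul_le {p q : ℝ} (hp : 1 ≤ p) (hq : 1 ≤ q)
    {B : Rn d × Rn d → ℝ≥0∞} (hB : Measurable B) {M : Rn d → ℝ≥0∞} (hM : Measurable M) :
    lnorm volume q (fun ξ : Rn d => lnorm volume p fun x : Rn d => ∫⁻ η, M η * B (x, ξ - η)) ≤
      (∫⁻ η, M η) * lnorm volume q fun ξ => lnorm volume p fun x => B (x, ξ) := by
  have hp0 : 0 < p := by linarith
  have hq0 : 0 < q := by linarith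
  have hN : Measurable fun ξ : Rn d => lnorm volume p fun x : Rn d => B (x, ξ) := by
    have h1 : Measurable fun ξ => ∫⁻ x, B (x, ξ) ^ p :=
      Measurable.lintegral_prod_left' (f := fun z : Rn d × Rn d => B z ^ p) (hB.pow_const p)
    exact h1.pow_const _
  set N : Rn d → ℝ≥0∞ := fun ξ => lnorm volume p fun x => B (x, ξ) with hNdef
  have h1 : ∀ ξ, (lnorm volume p fun x : Rn d => ∫⁻ η, M η * B (x, ξ - η)) ≤
      ∫⁻ η, M η * N (ξ - η) := by
    intro ξ
    have hj : Measurable (Function.uncurry fun x η : Rn d => M η * B (x, ξ - η)) :=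
      (hM.comp measurable_snd).mul
        (hB.comp (measurable_fst.prodMk (measurable_const.sub measurable_snd)))
    refine (lnorm_lintegral_le hp hj).trans (le_of_eq (lintegral_congr fun η => ?_))
    have hs : Measurable fun x => B (x, ξ - η) := hB.comp (measurable_id.prodMk measurable_const)
    exact lnorm_const_mul_of_measurable hp0 (M η) hs
  refine (lnorm_mono hq0 h1).trans ?_
  have hj : Measurable (Function.uncurry fun ξ η : Rn d => M η * N (ξ - η)) :=
    (hM.comp measurable_snd).mul (hN.comp (measurable_fst.sub measurable_snd))
  refine (lnorm_lintegral_le hq hj).trans (le_of_eq ?_)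
  rw [← lintegral_mul_const _ hM]
  refine lintegral_congr fun η => ?_
  have hs : Measurable fun ξ => N (ξ - η) := hN.comp (measurable_id.sub measurable_const)
  rw [lnorm_const_mul_of_measurable hq0 (M η) hs]
  congr 1
  unfold lnorm
  rw [lintegral_sub_right_eq_self (fun ξ => N ξ ^ q) η]

/-- Multiplication by a function with integrable Fourier transform is bounded on modulation
spaces. -/
theorem modulationNorm_fourier_smul_le {p q : ℝ} (hp : 1 ≤ p) (hq : 1 ≤ q) (g : 𝓢(Rn d, ℂ))
    {T w : 𝓢'(Rn d, F)} {f : Rn d → F} {A u : Rn d → ℂ} (hT : IsGivenBy T f)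
    (hw : IsGivenBy w fun x => u x • f x) (hA : Integrable A)
    (hu : ∀ᵐ y, u y = ∫ η, planeWave (-η) y • A η) :
    modulationNorm g (ENNReal.ofReal p) (ENNReal.ofReal q) 0 w ≤
      (∫⁻ η, ‖A η‖ₑ) * modulationNorm g (ENNReal.ofReal p) (ENNReal.ofReal q) 0 T := by
  have hp0 : 0 < p := by linarith
  have hq0 : 0 < q := by linarith
  set M : Rn d → ℝ≥0∞ := fun η => ‖hA.1.mk A η‖ₑ with hM
  have hMm : Measurable M := hA.1.stronglyMeasurable_mk.measurable.enorm
  have hMA : ∀ᵐ η, ‖A η‖ₑ = M η := by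
    filter_upwards [hA.1.ae_eq_mk] with η h
    rw [hM, h]
  have h1 : ∀ x ξ, ‖stft g w x ξ‖ₑ ≤ ∫⁻ η, M η * ‖stft g T x (ξ - η)‖ₑ := by
    intro x ξ
    -- Multiplication by `exp(i y·η)` shifts the frequency by `η` and leaves `x` alone, so
    -- translation invariance of the mixed norm suffices.
    have e1 : stft g w x ξ = ∫ η, A η • stft g T x (ξ - η) := by
      have e2 := integral_planeWave_mul_eq (ContinuousLinearMap.lsmul ℂ ℂ : ℂ →L[ℂ] F →L[ℂ] F) hA
        (hT.integrable_window g x) ξ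
      simp only [ContinuousLinearMap.lsmul_apply] at e2
      simp_rw [hT.stft_eq g x]
      rw [hw.stft_eq g x, ← e2]
      refine integral_congr_ae ?_
      filter_upwards [hu] with y hy
      rw [hy, smul_comm ((starRingEnd ℂ) (g (y - x)))]
    rw [e1]
    refine (enorm_integral_le_lintegral_enorm _).trans (le_of_eq (lintegral_congr_ae ?_))
    filter_upwards [hMA] with η h
    rw [enorm_smul, h]
  rw [modulationNorm_eq hp0 hq0, modulationNorm_eq hp0 hq0]
  simp_rw [japanese_zero, one_mul]
  rw [lintegral_congr_ae hMA]
  exact (lnorm_mono hq0 fun ξ => lnorm_mono hp0 fun x => h1 x ξ).trans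
    (lnorm_lnorm_lintegral_mul_le hp hq (measurable_stft g T) hMm)

theorem modulationNorm_two_two_eq (g : 𝓢(Rn d, ℂ)) (T : 𝓢'(Rn d, F)) :
    modulationNorm g (ENNReal.ofReal 2) (ENNReal.ofReal 2) 0 T =
      lnorm (volume.prod volume) 2 (fun z : Rn d × Rn d => ‖stft g T z.1 z.2‖ₑ) := by
  rw [modulationNorm_eq two_pos two_pos]
  simp_rw [japanese_zero, one_mul]
  rw [lnorm, lnorm, lintegral_prod_symm _ ((measurable_stft g T).pow_const _).aemeasurable]
  simp_rw [lnorm_rpow two_pos]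

end FourierMultiplier

/-! ### The trilinear estimate in `M^{p,q}`. -/

section SquareIntegrableBound

variable {d m : ℕ}

/-- The trilinear bound in `M^{p,q}` for `1 ≤ p ≤ 2` and `1 ≤ q ≤ 2 d / (d + γ)`. -/
theorem exists_hartree_bound_two {γ : ℝ} (hγ : 0 < γ) (hγd : γ < d) {p q : ℝ}
    (hp1 : 1 ≤ p) (hp : p ≤ 2) (hq1 : 1 ≤ q) (hq : q ≤ 2 * d / (d + γ)) {g : 𝓢(Rn d, ℂ)}
    (hg : g ≠ 0) :
    ∃ C : ℝ≥0, ∀ (T₁ T₂ T₃ : 𝓢'(Rn d, EuclideanSpace ℂ (Fin m))),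
      modulationNorm g (ENNReal.ofReal p) (ENNReal.ofReal q) 0 T₁ < ∞ →
      modulationNorm g (ENNReal.ofReal p) (ENNReal.ofReal q) 0 T₂ < ∞ →
      modulationNorm g (ENNReal.ofReal p) (ENNReal.ofReal q) 0 T₃ < ∞ →
      ∀ f₁ f₂ f₃ : Rn d → EuclideanSpace ℂ (Fin m),
      IsGivenBy T₁ f₁ → IsGivenBy T₂ f₂ → IsGivenBy T₃ f₃ →
      (∀ᵐ x, ∫⁻ t, rieszKernel γ t * ‖(inner ℂ (f₂ (x - t)) (f₁ (x - t)) : ℂ)‖ₑ < ∞) ∧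
      (∃ w, IsGivenBy w fun x =>
        (∫ t, coulomb d γ t • (inner ℂ (f₂ (x - t)) (f₁ (x - t)) : ℂ)) • f₃ x) ∧
      ∀ w, (IsGivenBy w fun x =>
        (∫ t, coulomb d γ t • (inner ℂ (f₂ (x - t)) (f₁ (x - t)) : ℂ)) • f₃ x) →
        modulationNorm g (ENNReal.ofReal p) (ENNReal.ofReal q) 0 w ≤
          C * (modulationNorm g (ENNReal.ofReal p) (ENNReal.ofReal q) 0 T₁ *
            modulationNorm g (ENNReal.ofReal p) (ENNReal.ofReal q) 0 T₂ *
            modulationNorm g (ENNReal.ofReal p) (ENNReal.ofReal q) 0 T₃) := by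
  have hd : (0 : ℝ) < d := hγ.trans hγd
  have hq0 : 0 < 2 * d / (d + γ) := by positivity
  have hq2 : 2 * d / (d + γ) ≤ 2 := by
    rw [div_le_iff₀ (by positivity)]
    linarith
  -- Two embeddings: `Ca` into `M^{2,2d/(d+γ)}`, which feeds the Hardy-Littlewood-Sobolev
  -- inequality, and `Cb` into `M^{2,2}`, which makes the functions square integrable and the
  -- density integrable.
  obtain ⟨Ca, hCa⟩ := exists_modulationNorm_le hg g hp1 hq1 hp hq le_rfl
  obtain ⟨Cb, hCb⟩ := exists_modulationNorm_le hg g hp1 hq1 hp (hq.trans hq2) le_rfl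
  obtain ⟨Ch, hCh⟩ := exists_lintegral_rieszKernel_correlation_le hγ hγd
  set c : ℝ := heatConst d γ / Real.Gamma (γ / 2) with hc
  have hc0 : 0 ≤ c := (div_pos (heatConst_pos hγd) (Real.Gamma_pos_of_pos (by linarith))).le
  set k : ℝ≥0 := ‖inversionConst g‖₊ with hk
  have hkE : ‖inversionConst g‖ₑ = k := rfl
  refine ⟨c.toNNReal * ((m * k) * (Ch * (Ca * Ca))),
    fun T₁ T₂ T₃ hT₁ hT₂ hT₃ f₁ f₂ f₃ h₁ h₂ h₃ => ?_⟩
  have hV : ∀ T : 𝓢'(Rn d, EuclideanSpace ℂ (Fin m)),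
      modulationNorm g (ENNReal.ofReal p) (ENNReal.ofReal q) 0 T < ∞ →
      lnorm (volume.prod volume) 2 (fun z : Rn d × Rn d => ‖stft g T z.1 z.2‖ₑ) < ∞ := by
    intro T hT
    rw [← modulationNorm_two_two_eq]
    exact (hCb T).trans_lt (ENNReal.mul_lt_top ENNReal.coe_lt_top hT)
  have hL : ∀ (T : 𝓢'(Rn d, EuclideanSpace ℂ (Fin m))) (f : Rn d → EuclideanSpace ℂ (Fin m)),
      modulationNorm g (ENNReal.ofReal p) (ENNReal.ofReal q) 0 T < ∞ → IsGivenBy T f →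
      MemLp f 2 := by
    intro T f hT hf
    obtain ⟨f', hf', hTf'⟩ := exists_memLp_isGivenBy_euclidean hg T (hV T hT)
    exact hf'.ae_eq (hTf'.ae_eq hf)
  have hf₁ := hL T₁ f₁ hT₁ h₁
  have hf₂ := hL T₂ f₂ hT₂ h₂
  have hf₃ := hL T₃ f₃ hT₃ h₃
  set N : 𝓢'(Rn d, EuclideanSpace ℂ (Fin m)) → Rn d → ℝ≥0∞ := fun T ξ =>
    lnorm volume 2 fun x => ‖stft g T x ξ‖ₑ with hN
  have hNm : ∀ T, Measurable (N T) := fun T => measurable_lnorm_stft 2 g T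
  have hNq : ∀ T, lnorm volume (2 * d / (d + γ)) (N T) ≤
      Ca * modulationNorm g (ENNReal.ofReal p) (ENNReal.ofReal q) 0 T := by
    intro T
    refine le_of_eq_of_le ?_ (hCa T)
    rw [modulationNorm_eq two_pos hq0]
    simp_rw [japanese_zero, one_mul]
    rfl
  set n₁ := modulationNorm g (ENNReal.ofReal p) (ENNReal.ofReal q) 0 T₁
  set n₂ := modulationNorm g (ENNReal.ofReal p) (ENNReal.ofReal q) 0 T₂
  set ρ : Rn d → ℂ := fun y => (inner ℂ (f₂ y) (f₁ y) : ℂ) with hρdef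
  have hρ : Integrable ρ := by
    refine Integrable.mono (memLp_one_iff_integrable.1
      (MemLp.smul (r := 1) hf₁.norm hf₂.norm)) (hf₂.1.inner hf₁.1)
      (Filter.Eventually.of_forall fun y => ?_)
    refine (norm_inner_le_norm _ _).trans (le_of_eq ?_)
    simp
  have hint : ∫⁻ ζ, rieszKernel (d - γ) ζ * ‖∫ y, planeWave ζ y * ρ y‖ₑ ≤
      (m * k) * (Ch * ((Ca * n₁) * (Ca * n₂))) := by
    calc _ ≤ ∫⁻ ζ, (m * k) * (rieszKernel (d - γ) ζ * ∫⁻ ξ, N T₁ ξ * N T₂ (ξ - ζ)) := by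
          refine lintegral_mono fun ζ => ?_
          refine (mul_le_mul_right (enorm_integral_planeWave_inner_le hg h₁ h₂ hf₁ hf₂
            (hV T₁ hT₁) ζ) _).trans (le_of_eq ?_)
          rw [hkE]
          ring
      _ = (m * k) * ∫⁻ ζ, rieszKernel (d - γ) ζ * ∫⁻ ξ, N T₁ ξ * N T₂ (ξ - ζ) :=
          lintegral_const_mul' _ _
            (ENNReal.mul_ne_top (ENNReal.natCast_ne_top m) ENNReal.coe_ne_top)
      _ ≤ _ := mul_le_mul_right ((hCh _ _ (hNm T₁) (hNm T₂)).trans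
          (mul_le_mul_right (mul_le_mul' (hNq T₁) (hNq T₂)) _)) _
  have hint' : ∫⁻ ζ, rieszKernel (d - γ) ζ * ‖∫ y, planeWave ζ y * ρ y‖ₑ < ∞ := by
    refine hint.trans_lt (ENNReal.mul_lt_top (ENNReal.mul_lt_top
      (ENNReal.natCast_lt_top m) ENNReal.coe_lt_top) (ENNReal.mul_lt_top ENNReal.coe_lt_top
      (ENNReal.mul_lt_top ?_ ?_)))
    · exact ENNReal.mul_lt_top ENNReal.coe_lt_top hT₁
    · exact ENNReal.mul_lt_top ENNReal.coe_lt_top hT₂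
  -- The frequency side of the potential: `u` is the integral of `A` against plane waves, and the
  -- `L¹` norm of `A` has just been bounded by `n₁ n₂`.
  set A : Rn d → ℂ := fun ζ => ((c * ‖ζ‖ ^ (-(d - γ)) : ℝ) : ℂ) * ∫ y, planeWave ζ y * ρ y with hA
  have hAe : ∀ ζ, ‖A ζ‖ₑ = ENNReal.ofReal c *
      (rieszKernel (d - γ) ζ * ‖∫ y, planeWave ζ y * ρ y‖ₑ) := by
    intro ζ
    rw [hA, enorm_mul, ← mul_assoc]
    congr 1
    rw [← ofReal_norm, Complex.norm_real, Real.norm_of_nonneg (by positivity),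
      ENNReal.ofReal_mul hc0]
    rfl
  have hAl : ∫⁻ ζ, ‖A ζ‖ₑ = ENNReal.ofReal c *
      ∫⁻ ζ, rieszKernel (d - γ) ζ * ‖∫ y, planeWave ζ y * ρ y‖ₑ := by
    simp_rw [hAe]
    exact lintegral_const_mul' _ _ ENNReal.ofReal_ne_top
  have hAm : AEStronglyMeasurable A := by
    refine AEStronglyMeasurable.mul ?_ (aestronglyMeasurable_integral_planeWave hρ.1)
    have : Measurable fun ζ : Rn d => c * ‖ζ‖ ^ (-(d - γ)) :=
      (measurable_norm.pow_const _).const_mul _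
    exact (Complex.measurable_ofReal.comp this).aestronglyMeasurable
  have hAlt : ∫⁻ ζ, ‖A ζ‖ₑ < ∞ := by
    rw [hAl]
    exact ENNReal.mul_lt_top ENNReal.ofReal_lt_top hint'
  have hAi : Integrable A := ⟨hAm, hAlt⟩
  have hfin := ae_lintegral_rieszKernel_lt_top hγ hγd hρ
  set u : Rn d → ℂ := fun x => ∫ t, coulomb d γ t • ρ (x - t) with hu
  have huA : ∀ᵐ x, u x = ∫ η, planeWave (-η) x • A η := by
    filter_upwards [hfin] with x hx
    exact coulomb_potential_eq hγ hγd hρ hint' hx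
  have hub : ∀ᵐ x, ‖u x‖ ≤ (∫⁻ ζ, ‖A ζ‖ₑ).toReal := by
    filter_upwards [huA] with x hx
    rw [hx, ← toReal_enorm]
    refine ENNReal.toReal_mono hAlt.ne ((enorm_integral_le_lintegral_enorm _).trans
      (le_of_eq (lintegral_congr fun η => ?_)))
    rw [enorm_smul, enorm_planeWave, one_mul]
  have hum : AEStronglyMeasurable u := aestronglyMeasurable_coulomb_potential γ hρ.1
  refine ⟨hfin, ?_, ?_⟩
  · refine exists_isGivenBy_of_memLp (p := 2) (by norm_num)
      (MemLp.of_le_mul (c := (∫⁻ ζ, ‖A ζ‖ₑ).toReal) hf₃ (hum.smul hf₃.1) ?_)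
    filter_upwards [hub] with x hx
    rw [norm_smul]
    exact mul_le_mul_of_nonneg_right hx (norm_nonneg _)
  · intro w hw
    refine (modulationNorm_fourier_smul_le hp1 hq1 g h₃ hw hAi huA).trans ?_
    rw [hAl]
    calc _ ≤ (ENNReal.ofReal c * ((m * k) * (Ch * ((Ca * n₁) * (Ca * n₂))))) *
          modulationNorm g (ENNReal.ofReal p) (ENNReal.ofReal q) 0 T₃ := by gcongr
      _ = _ := by
          push_cast
          rw [ENNReal.ofReal]
          ring

end SquareIntegrableBound

end

noncomputable section

set_option linter.unusedSectionVars false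

/-! ### Both scales together, and reduction to the case without `β`. -/

section Hartree

variable {d m : ℕ}

theorem modulationNorm_temperedComp_le {F G : Type} [NormedAddCommGroup F] [NormedSpace ℂ F]
    [CompleteSpace F] [NormedAddCommGroup G] [NormedSpace ℂ G] [CompleteSpace G] {p q : ℝ}
    (hp : 0 < p) (hq : 0 < q) (s : ℝ) (g : 𝓢(Rn d, ℂ)) (L : F →L[ℂ] G) (T : 𝓢'(Rn d, F)) :
    modulationNorm g (ENNReal.ofReal p) (ENNReal.ofReal q) s (temperedComp L T) ≤
      ‖L‖ₑ * modulationNorm g (ENNReal.ofReal p) (ENNReal.ofReal q) s T := by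
  rw [modulationNorm_eq hp hq, modulationNorm_eq hp hq,
    ← lnorm_const_mul hq (enorm_ne_top : ‖L‖ₑ ≠ ∞)]
  refine lnorm_mono hq fun ξ => ?_
  rw [mul_left_comm, ← lnorm_const_mul hp (enorm_ne_top : ‖L‖ₑ ≠ ∞)]
  refine mul_le_mul_right (lnorm_mono hp fun x => ?_) _
  rw [stft_temperedComp]
  exact L.le_opENorm _

/-- The elements of the two scales of modulation spaces are functions. -/
theorem exists_isGivenBy_of_modulationNorm {γ : ℝ} (hγ : 0 < γ) (hγd : γ < d) {p q s : ℝ}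
    (hX : (1 ≤ p ∧ p ≤ 2 ∧ 1 ≤ q ∧ q ≤ 2 * d / (d + γ) ∧ s = 0) ∨
      (1 < p ∧ p < d / (d - γ) ∧ q = 1 ∧ 0 ≤ s))
    {g : 𝓢(Rn d, ℂ)} (hg : g ≠ 0) (T : 𝓢'(Rn d, EuclideanSpace ℂ (Fin m)))
    (hT : modulationNorm g (ENNReal.ofReal p) (ENNReal.ofReal q) s T < ∞) :
    ∃ f, IsGivenBy T f := by
  rcases hX with ⟨hp1, hp2, hq1, hq2, rfl⟩ | ⟨hp1, hp2, rfl, hs⟩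
  · have hd : (0 : ℝ) < d := hγ.trans hγd
    have hq : q ≤ 2 := hq2.trans (by rw [div_le_iff₀ (by positivity)]; linarith)
    obtain ⟨C, hC⟩ := exists_modulationNorm_le hg g hp1 hq1 hp2 hq le_rfl
    obtain ⟨f, -, hf⟩ := exists_memLp_isGivenBy_euclidean hg T (by
      rw [← modulationNorm_two_two_eq]
      exact (hC T).trans_lt (ENNReal.mul_lt_top ENNReal.coe_lt_top hT))
    exact ⟨f, hf⟩
  · obtain ⟨C, hC⟩ := exists_isGivenBy_of_modulationNorm_one hg hp1.le hs
    exact (hC T hT).2.1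

/-- The trilinear bound in the two scales of modulation spaces. -/
theorem exists_hartree_bound {γ : ℝ} (hγ : 0 < γ) (hγd : γ < d) {p q s : ℝ}
    (hX : (1 ≤ p ∧ p ≤ 2 ∧ 1 ≤ q ∧ q ≤ 2 * d / (d + γ) ∧ s = 0) ∨
      (1 < p ∧ p < d / (d - γ) ∧ q = 1 ∧ 0 ≤ s))
    {g : 𝓢(Rn d, ℂ)} (hg : g ≠ 0) :
    ∃ C : ℝ≥0, ∀ (T₁ T₂ T₃ : 𝓢'(Rn d, EuclideanSpace ℂ (Fin m))),
      modulationNorm g (ENNReal.ofReal p) (ENNReal.ofReal q) s T₁ < ∞ →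
      modulationNorm g (ENNReal.ofReal p) (ENNReal.ofReal q) s T₂ < ∞ →
      modulationNorm g (ENNReal.ofReal p) (ENNReal.ofReal q) s T₃ < ∞ →
      ∀ f₁ f₂ f₃ : Rn d → EuclideanSpace ℂ (Fin m),
      IsGivenBy T₁ f₁ → IsGivenBy T₂ f₂ → IsGivenBy T₃ f₃ →
      (∀ᵐ x, ∫⁻ t, rieszKernel γ t * ‖(inner ℂ (f₂ (x - t)) (f₁ (x - t)) : ℂ)‖ₑ < ∞) ∧
      (∃ w, IsGivenBy w fun x =>
        (∫ t, coulomb d γ t • (inner ℂ (f₂ (x - t)) (f₁ (x - t)) : ℂ)) • f₃ x) ∧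
      ∀ w, (IsGivenBy w fun x =>
        (∫ t, coulomb d γ t • (inner ℂ (f₂ (x - t)) (f₁ (x - t)) : ℂ)) • f₃ x) →
        modulationNorm g (ENNReal.ofReal p) (ENNReal.ofReal q) s w ≤
          C * (modulationNorm g (ENNReal.ofReal p) (ENNReal.ofReal q) s T₁ *
            modulationNorm g (ENNReal.ofReal p) (ENNReal.ofReal q) s T₂ *
            modulationNorm g (ENNReal.ofReal p) (ENNReal.ofReal q) s T₃) := by
  rcases hX with ⟨hp1, hp2, hq1, hq2, rfl⟩ | ⟨hp1, hp2, rfl, hs⟩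
  · exact exists_hartree_bound_two hγ hγd hp1 hp2 hq1 hq2 hg
  · exact exists_hartree_bound_one hγ hγd hp1 hp2 hs hg

end Hartree

end

theorem lemma3p2 (d : ℕ) (γ : ℝ) (hγ : 0 < γ) (hγd : γ < d)
    (α : Fin d → Matrix (Fin (2 ^ ((d + 1) / 2))) (Fin (2 ^ ((d + 1) / 2))) ℂ)
    (β : Matrix (Fin (2 ^ ((d + 1) / 2))) (Fin (2 ^ ((d + 1) / 2))) ℂ)
    (hαβ : IsDiracSystem α β)
    (p q s : ℝ)
    (hX : (1 ≤ p ∧ p ≤ 2 ∧ 1 ≤ q ∧ q ≤ 2 * d / (d + γ) ∧ s = 0) ∨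
      (1 < p ∧ p < d / (d - γ) ∧ q = 1 ∧ 0 ≤ s))
    (g : 𝓢(EuclideanSpace ℝ (Fin d), ℂ)) (hg : g ≠ 0) :
    ∃ C : ℝ≥0, ∀ ψ₁ ψ₂ ψ₃ :
        𝓢'(EuclideanSpace ℝ (Fin d), EuclideanSpace ℂ (Fin (2 ^ ((d + 1) / 2)))),
      modulationNorm g (ENNReal.ofReal p) (ENNReal.ofReal q) s ψ₁ < ∞ →
      modulationNorm g (ENNReal.ofReal p) (ENNReal.ofReal q) s ψ₂ < ∞ →
      modulationNorm g (ENNReal.ofReal p) (ENNReal.ofReal q) s ψ₃ < ∞ →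
      (∃ w, IsHartree γ β ψ₁ ψ₂ ψ₃ w) ∧
      ∀ w, IsHartree γ β ψ₁ ψ₂ ψ₃ w →
        modulationNorm g (ENNReal.ofReal p) (ENNReal.ofReal q) s w ≤
          C * (modulationNorm g (ENNReal.ofReal p) (ENNReal.ofReal q) s ψ₁ *
            modulationNorm g (ENNReal.ofReal p) (ENNReal.ofReal q) s ψ₂ *
            modulationNorm g (ENNReal.ofReal p) (ENNReal.ofReal q) s ψ₃) := by
  have hp0 : 0 < p := by rcases hX with h | h <;> linarith [h.1]
  have hq0 : 0 < q := by
    rcases hX with h | h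
    · linarith [h.2.2.1]
    · linarith [h.2.2.1]
  obtain ⟨C, hC⟩ := exists_hartree_bound (m := 2 ^ ((d + 1) / 2)) hγ hγd hX hg
  set L := Matrix.toEuclideanCLM (𝕜 := ℂ) β with hL
  have hcomp := fun T => modulationNorm_temperedComp_le (d := d) hp0 hq0 s g L T
  have hcompT : ∀ T, modulationNorm g (ENNReal.ofReal p) (ENNReal.ofReal q) s T < ∞ →
      modulationNorm g (ENNReal.ofReal p) (ENNReal.ofReal q) s (temperedComp L T) < ∞ :=
    fun T hT => (hcomp T).trans_lt (ENNReal.mul_lt_top enorm_lt_top hT)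
  refine ⟨C * (‖L‖₊ * ‖L‖₊), fun ψ₁ ψ₂ ψ₃ h₁ h₂ h₃ => ?_⟩
  -- The matrix is absorbed into the second and third distributions, which produces the factor
  -- `‖L‖²` of the constant.
  have key := hC ψ₁ (temperedComp L ψ₂) (temperedComp L ψ₃) h₁ (hcompT _ h₂) (hcompT _ h₃)
  constructor
  · obtain ⟨f₁, hf₁⟩ := exists_isGivenBy_of_modulationNorm hγ hγd hX hg ψ₁ h₁
    obtain ⟨f₂, hf₂⟩ := exists_isGivenBy_of_modulationNorm hγ hγd hX hg ψ₂ h₂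
    obtain ⟨f₃, hf₃⟩ := exists_isGivenBy_of_modulationNorm hγ hγd hX hg ψ₃ h₃
    obtain ⟨hfin, ⟨w, hw⟩, -⟩ := key f₁ _ _ hf₁ (hf₂.temperedComp L) (hf₃.temperedComp L)
    refine ⟨w, f₁, f₂, f₃, hf₁, hf₂, hf₃, ?_, hw⟩
    filter_upwards [hfin] with x hx
    exact convolutionExistsAt_coulomb
      ((hf₂.temperedComp L).aestronglyMeasurable.inner hf₁.aestronglyMeasurable) hx
  · rintro w ⟨f₁, f₂, f₃, hf₁, hf₂, hf₃, -, hw⟩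
    refine ((key f₁ _ _ hf₁ (hf₂.temperedComp L) (hf₃.temperedComp L)).2.2 w hw).trans ?_
    refine (mul_le_mul_right (mul_le_mul' (mul_le_mul' le_rfl (hcomp ψ₂)) (hcomp ψ₃)) _).trans
      (le_of_eq ?_)
    have : ‖L‖ₑ = (‖L‖₊ : ℝ≥0∞) := rfl
    rw [this]
    push_cast
    ring
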